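/- \textbf{Setting.} A \emph{polynomial parametric Markov chain} (pMC) over a single parameter $x$ consists of a finite non-empty state set $S$, an initial state, and a transition function $\mathbf P\colon S\times S\to\mathbb Q[x]$, whose edges are the pairs $(s,t)$ with $\mathbf P(s,t)\neq 0$ in $\mathbb Q[x]$; a state without outgoing edges is a \emph{trap}. A value $\xi\in\mathbb R$ is \emph{admissible} if $\sum_{t}\mathbf P(s,t)(\xi)=1$ for every non-trap $s$, and $\mathbf P(s,t)(\xi)>0$ if and only if $(s,t)$ is an edge. An admissible $\xi$ yields a Markov chain $\mathfrak M(\xi)$ with path measures $\Pr_s^{\mathfrak M(\xi)}$ and expectations $\mathrm E_s^{\mathfrak M(\xi)}$, $s\in S$; a path that enters a trap is regarded as staying there forever. Let $T\subseteq S$ and let $wgt$ assign to each state a weight in $\mathbb Q(x)$, given as a fraction of polynomials. For a path $\pi=s_0s_1s_2\dots$ that reaches $T$, the \emph{weight accumulated until reaching $T$} is $\sum_{i<h}wgt(s_i)$, where $h$ is least with $s_h\in T$. The \emph{mean payoff} of $\pi$ is $\limsup_{m\to\infty}\frac1{m+1}\sum_{i\le m}wgt_T(s_i)$, where $wgt_T(t)=wgt(t)$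 for $t\in T$ and $wgt_T(t)=0$ for $t\notin T$ (the plain mean payoff is the case $T=S$). Inputs and outputs are encoded as lists of integers written in binary: a polynomial of degree $d$ is given by $d$ and the list of all its $d+1$ rational coefficients, and a fraction by its numerator and denominator. Polynomial time means polynomially many bit operations in the bit length of the input. \textbf{Lemma.} There are polynomial-time algorithms for the following three tasks. (1) Given a polynomial pMC $\mathfrak M$ over a single parameter and $T\subseteq S$, compute for all $s\in S$ polynomials $f_s,g_s\in\mathbb Q[x]$ with $g_s\neq0$ such that, for every admissible $\xi$, $g_s(\xi)\ne 0$ and $\Pr_s^{\mathfrak M(\xi)}(\Diamond T)=f_s(\xi)/g_s(\xi)$. (2) Given $\mathfrak M$, $T$ and $wgt$, compute for each $s\in S$ either the answer ``undefined'' or polynomials $f_s,g_s\in\mathbb Q[x]$ with $g_s\neq0$, such that the following holds for every admissible $\xi$ at which no denominator of a weight vanishes. If $\Pr_s^{\mathfrak M(\xi)}(\Diamond T)<1$, the answer is ``undefined''. If $\Pr_s^{\mathfrak M(\xi)}(\Diamond T)=1$, then polynomials are returned, $g_s(\xi)\neq0$, the weight accumulated until reaching $T$ is integrable, and its expectation is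 $f_s(\xi)/g_s(\xi)$. (3) Given $\mathfrak M$, $T$ and $wgt$, compute for all $s\in S$ polynomials $f_s,g_s\in\mathbb Q[x]$ with $g_s\neq0$ such that, for every admissible $\xi$ at which no denominator of a weight vanishes, $g_s(\xi)\neq 0$, the mean payoff is integrable, and its expectation from $s$ equals $f_s(\xi)/g_s(\xi)$. -/

import Mathlib

open MeasureTheory ProbabilityTheory Polynomial

/-! ## Machine model: random access machine with logarithmic cost

Registers are indexed by integers and hold integers of unbounded size; there is a read-only input
tape and a write-only output tape of integers.  Every operation is charged with the bit lengths of
all the addresses and numbers that take part in it, so that polynomial time on this machine is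
polynomial time on Turing machines.  Programs are given in structured form (`ite`, `loop`) instead
of by jumps. -/

namespace Ram

/-- Bit length of an integer, with one bit for the sign. -/
def bitLen (z : ℤ) : ℕ := z.natAbs.size + 1

/-- Expressions; `reg a` is the content of the register whose address is the value of `a`. -/
inductive Expr : Type
  | lit (z : ℤ)
  | reg (a : Expr)
  | plus (a b : Expr)
  | minus (a b : Expr)
  | times (a b : Expr)
  | quot (a b : Expr)

/-- Value of an expression; `quot` is the integer division `/` of `ℤ` (with value `0` when the
divisor is `0`). -/
def Expr.eval (m : ℤ → ℤ) : Expr → ℤ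
  | .lit z => z
  | .reg a => m (a.eval m)
  | .plus a b => a.eval m + b.eval m
  | .minus a b => a.eval m - b.eval m
  | .times a b => a.eval m * b.eval m
  | .quot a b => a.eval m / b.eval m

/-- Logarithmic cost of evaluating an expression. -/
def Expr.cost (m : ℤ → ℤ) : Expr → ℕ
  | .lit z => bitLen z
  | .reg a => a.cost m + bitLen (a.eval m) + bitLen (m (a.eval m))
  | .plus a b => a.cost m + b.cost m + bitLen (a.eval m) + bitLen (b.eval m)
  | .minus a b => a.cost m + b.cost m + bitLen (a.eval m) + bitLen (b.eval m)
  | .times a b => a.cost m + b.cost m + bitLen (a.eval m) + bitLen (b.eval m)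
  | .quot a b => a.cost m + b.cost m + bitLen (a.eval m) + bitLen (b.eval m)

/-- Programs: `store a e` writes the value of `e` into the register with address `a`,
`read a` moves the next integer of the input tape into that register (`0` at the end of the tape),
`write e` appends the value of `e` to the output tape, `ite e c d` runs `c` if `e > 0` and `d`
otherwise, and `loop e c` repeats `c` as long as `e > 0`. -/
inductive Cmd : Type
  | skip
  | store (a e : Expr)
  | read (a : Expr)
  | write (e : Expr)
  | seq (c d : Cmd)
  | ite (e : Expr) (c d : Cmd)
  | loop (e : Expr) (c : Cmd)

/-- Configuration: registers, rest of the input tape, output tape. -/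
structure State : Type where
  mem : ℤ → ℤ
  inp : List ℤ
  out : List ℤ

/-- `Exec c σ τ t`: program `c` started in `σ` halts in `τ`, at total logarithmic cost `t`. -/
inductive Exec : Cmd → State → State → ℕ → Prop
  | skip (σ : State) : Exec .skip σ σ 1
  | store (a e : Expr) (σ : State) :
      Exec (.store a e) σ
        ⟨Function.update σ.mem (a.eval σ.mem) (e.eval σ.mem), σ.inp, σ.out⟩
        (a.cost σ.mem + e.cost σ.mem + bitLen (a.eval σ.mem) + bitLen (e.eval σ.mem))
  | read (a : Expr) (σ : State) :
      Exec (.read a) σ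
        ⟨Function.update σ.mem (a.eval σ.mem) (σ.inp.headD 0), σ.inp.tail, σ.out⟩
        (a.cost σ.mem + bitLen (a.eval σ.mem) + bitLen (σ.inp.headD 0))
  | write (e : Expr) (σ : State) :
      Exec (.write e) σ ⟨σ.mem, σ.inp, σ.out ++ [e.eval σ.mem]⟩
        (e.cost σ.mem + bitLen (e.eval σ.mem))
  | seq (c d : Cmd) (σ τ υ : State) (t u : ℕ) :
      Exec c σ τ t → Exec d τ υ u → Exec (.seq c d) σ υ (t + u)
  | ite_pos (e : Expr) (c d : Cmd) (σ τ : State) (t : ℕ) :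
      0 < e.eval σ.mem → Exec c σ τ t →
      Exec (.ite e c d) σ τ (e.cost σ.mem + bitLen (e.eval σ.mem) + t)
  | ite_neg (e : Expr) (c d : Cmd) (σ τ : State) (t : ℕ) :
      e.eval σ.mem ≤ 0 → Exec d σ τ t →
      Exec (.ite e c d) σ τ (e.cost σ.mem + bitLen (e.eval σ.mem) + t)
  | loop_done (e : Expr) (c : Cmd) (σ : State) :
      e.eval σ.mem ≤ 0 →
      Exec (.loop e c) σ σ (e.cost σ.mem + bitLen (e.eval σ.mem))
  | loop_step (e : Expr) (c : Cmd) (σ τ υ : State) (t u : ℕ) :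
      0 < e.eval σ.mem → Exec c σ τ t → Exec (.loop e c) τ υ u →
      Exec (.loop e c) σ υ (e.cost σ.mem + bitLen (e.eval σ.mem) + t + u)

/-- Started on the input tape `x` with all registers `0`, the program `c` halts with the output
tape `y` after time `t`. -/
def OutputsInTime (c : Cmd) (x y : List ℤ) (t : ℕ) : Prop :=
  ∃ σ : State, Exec c ⟨fun _ => 0, x, []⟩ σ t ∧ σ.out = y

/-- Size in bits of a tape. -/
def tapeSize (x : List ℤ) : ℕ := (x.map bitLen).sum

/-- `f` is computable in time polynomial in the bit size of the encoded input. -/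
def PolyTimeComputable {α : Type} {β : α → Type} (encIn : α → List ℤ)
    (encOut : ∀ a, β a → List ℤ) (f : ∀ a, β a) : Prop :=
  ∃ (c : Cmd) (p : ℕ[X]), ∀ a : α, ∃ t : ℕ,
    OutputsInTime c (encIn a) (encOut a (f a)) t ∧ t ≤ p.eval (tapeSize (encIn a))

end Ram

namespace ParamMC

/-! ## Markov chains and their path measures -/

/-- The state `s` has no successor. -/
def IsTrap {n : ℕ} {R : Type} [Zero R] (P : Fin n → Fin n → R) (s : Fin n) : Prop :=
  ∀ t, P s t = 0

/-- A finite Markov chain with states `0, …, n - 1`, initial state `init` and edges the pairs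
with `P s t ≠ 0`; states without outgoing edge (traps) are allowed. -/
structure MarkovChain (n : ℕ) : Type where
  init : Fin n
  P : Fin n → Fin n → ℝ
  nonneg : ∀ s t, 0 ≤ P s t
  sum_eq_one : ∀ s, ¬ IsTrap P s → ∑ t, P s t = 1

namespace MarkovChain

variable {n : ℕ} (C : MarkovChain n)

open Classical in
/-- Transition probabilities of the stuttering extension: a trap repeats itself forever, so that
maximal finite paths become infinite ones. -/
noncomputable def stepProb (s t : Fin n) : ℝ :=
  if IsTrap C.P s then (if s = t then 1 else 0) else C.P s t

lemma stepProb_nonneg (s t : Fin n) : 0 ≤ C.stepProb s t := by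
  unfold stepProb
  split_ifs
  · exact zero_le_one
  · exact le_rfl
  · exact C.nonneg s t

lemma sum_stepProb (s : Fin n) : ∑ t, C.stepProb s t = 1 := by
  unfold stepProb
  by_cases h : IsTrap C.P s
  · simp [h]
  · simpa [h] using C.sum_eq_one s h

/-- Distribution of the successor of `s`. -/
noncomputable def stepMeasure (s : Fin n) : Measure (Fin n) :=
  ∑ t, ENNReal.ofReal (C.stepProb s t) • Measure.dirac t

instance (s : Fin n) : IsProbabilityMeasure (C.stepMeasure s) := by
  refine ⟨?_⟩
  simp only [stepMeasure, Measure.coe_finsetSum, Finset.sum_apply, Measure.smul_apply,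
    measure_univ, smul_eq_mul, mul_one]
  rw [← ENNReal.ofReal_sum_of_nonneg (fun t _ => C.stepProb_nonneg s t), C.sum_stepProb,
    ENNReal.ofReal_one]

/-- One step of the chain as a Markov kernel. -/
noncomputable def stepKernel : Kernel (Fin n) (Fin n) := Kernel.ofFunOfCountable C.stepMeasure

instance : IsMarkovKernel C.stepKernel :=
  ⟨fun s => inferInstanceAs (IsProbabilityMeasure (C.stepMeasure s))⟩

/-- The same step, as a kernel on finite histories: only the last state matters. -/
noncomputable def histKernel (m : ℕ) :
    Kernel ((i : Finset.Iic m) → (fun _ : ℕ => Fin n) i) ((fun _ : ℕ => Fin n) (m + 1)) :=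
  C.stepKernel.comap (fun h => h ⟨m, Finset.mem_Iic.2 le_rfl⟩) (measurable_pi_apply _)

instance (m : ℕ) : IsMarkovKernel (C.histKernel m) := by
  unfold histKernel; infer_instance

/-- The probability measure on paths that start in `s`. -/
noncomputable def pathMeasure (s : Fin n) : Measure (ℕ → Fin n) :=
  Kernel.traj (X := fun _ : ℕ => Fin n) C.histKernel 0 (fun _ => s)

/-- Probability of reaching the set `T` from `s`. -/
noncomputable def reachProb (s : Fin n) (T : Finset (Fin n)) : ℝ :=
  (C.pathMeasure s).real {ω | ∃ i, ω i ∈ T}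

end MarkovChain

/-- Weight accumulated along a path until `T` is reached, `∑_{i < h} w (ω i)` with `h` the first
time at which `ω` is in `T`.  (On paths that never reach `T` the value is irrelevant; it is only
used when those have probability `0`.) -/
noncomputable def accWeight {n : ℕ} (w : Fin n → ℝ) (T : Finset (Fin n)) (ω : ℕ → Fin n) : ℝ :=
  ∑ i ∈ Finset.range (sInf {i | ω i ∈ T}), w (ω i)

/-- Mean payoff of a path, the long-run average of the weights, where states outside `T` have
weight `0`; `T = Finset.univ` is the plain mean payoff. -/
noncomputable def meanPayoff {n : ℕ} (w : Fin n → ℝ) (T : Finset (Fin n)) (ω : ℕ → Fin n) : ℝ :=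
  Filter.limsup
    (fun m : ℕ => (∑ i ∈ Finset.range (m + 1), if ω i ∈ T then w (ω i) else 0) / ((m : ℝ) + 1))
    Filter.atTop

/-! ## Polynomial parametric Markov chains over one parameter -/

/-- A polynomial pMC over a single parameter, with states `0, …, n - 1`.  The edges are the pairs
with `P s t ≠ 0` in `ℚ[X]`. -/
structure PolyPMC (n : ℕ) : Type where
  init : Fin n
  P : Fin n → Fin n → ℚ[X]

namespace PolyPMC

variable {n : ℕ} (M : PolyPMC n)

/-- The transition function obtained by evaluating at `ξ`. -/
noncomputable def evalP (ξ : ℝ) (s t : Fin n) : ℝ := aeval ξ (M.P s t)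

/-- Admissible valuations: the probabilities of a non-trap sum up to `1`, and exactly the edges
have positive value. -/
def Admissible (ξ : ℝ) : Prop :=
  (∀ s, ¬ IsTrap M.P s → ∑ t, M.evalP ξ s t = 1) ∧
  ∀ s t, 0 < M.evalP ξ s t ↔ M.P s t ≠ 0

/-- The Markov chain obtained from an admissible valuation. -/
noncomputable def inst (ξ : ℝ) (h : M.Admissible ξ) : MarkovChain n where
  init := M.init
  P := M.evalP ξ
  nonneg s t := by
    by_cases hst : M.P s t = 0
    · simp [evalP, hst]
    · exact ((h.2 s t).2 hst).le
  sum_eq_one s hs := by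
    refine h.1 s fun htrap => hs fun t => ?_
    simp [evalP, htrap t]

end PolyPMC

/-- A fraction of polynomials, representing a rational function in one variable. -/
structure Fraction : Type where
  num : ℚ[X]
  den : ℚ[X]
  den_ne_zero : den ≠ 0

/-- The fraction has a value at `ξ`. -/
def Fraction.DefinedAt (r : Fraction) (ξ : ℝ) : Prop := aeval ξ r.den ≠ 0

/-- The value of the fraction at `ξ`. -/
noncomputable def Fraction.eval (r : Fraction) (ξ : ℝ) : ℝ := aeval ξ r.num / aeval ξ r.den

/-- Problem instance: a pMC with a set `T` of states. -/
structure Instance : Type where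
  n : ℕ
  M : PolyPMC n
  T : Finset (Fin n)

/-- Problem instance with a (parametric) weight function, given by fractions. -/
structure WeightedInstance extends Instance where
  wgt : Fin n → Fraction

/-- All weights have a value at `ξ`. -/
def WeightedInstance.WeightsDefinedAt (I : WeightedInstance) (ξ : ℝ) : Prop :=
  ∀ s, (I.wgt s).DefinedAt ξ

/-- The weight function at `ξ`. -/
noncomputable def WeightedInstance.evalWgt (I : WeightedInstance) (ξ : ℝ) (s : Fin I.n) : ℝ :=
  (I.wgt s).eval ξ

/-! ## Encodings as lists of integers -/

/-- A polynomial is given by its degree `d` and its `d + 1` rational coefficients, each as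
numerator and denominator. -/
def encPoly (p : ℚ[X]) : List ℤ :=
  (p.natDegree : ℤ) ::
    (List.range (p.natDegree + 1)).flatMap fun i => [(p.coeff i).num, ((p.coeff i).den : ℤ)]

/-- Numerator, then denominator. -/
def encFraction (r : Fraction) : List ℤ := encPoly r.num ++ encPoly r.den

/-- Optional values, with a leading flag. -/
def encOption (o : Option Fraction) : List ℤ :=
  match o with
  | none => [0]
  | some r => 1 :: encFraction r

/-- A vector is the concatenation of its entries. -/
def encVec {α : Type} (enc : α → List ℤ) {n : ℕ} (v : Fin n → α) : List ℤ :=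
  (List.finRange n).flatMap fun s => enc (v s)

/-- Number of states, initial state, transition matrix, indicator vector of `T`. -/
def encInstance (I : Instance) : List ℤ :=
  (I.n : ℤ) :: (I.M.init : ℤ) ::
    (encVec (encVec encPoly) I.M.P ++ encVec (fun s => [if s ∈ I.T then 1 else 0]) id)

/-- The instance, followed by the weights. -/
def encWeightedInstance (I : WeightedInstance) : List ℤ :=
  encInstance I.toInstance ++ encVec encFraction I.wgt

end ParamMC

namespace Ram

/-! ## Running programs with a time bound and a postcondition -/

/-! All three quantities come from one linear system, the gain and bias equations of a finite chain
with stochastic matrix `P` and weight vector `w`: `P g = g` and `w = g + (h - P h)`. Summing `P ^ i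
w` telescopes to `m g + h - P ^ m h`, and `P ^ m h` stays bounded, so `g` is the limit of the
averages of the expected weights, and `h` records the transient deviation from it. With the states
of `T` made absorbing and `w` the indicator of `T`, the gain is the reachability probability
(`reachProb_eq`). With `w` set to zero on `T` and `T` reached almost surely from `s`, the gain at
`s` is zero and the bias at `s` is the expected accumulated weight (`accWeight_eq`). Without
absorption, and with the weights restricted to `T`, the gain is the expected mean payoff
(`meanPayoff_eq`). In that case the weight along a path splits into `g` of the current state, a
telescoping term and a martingale difference, and the averages of the differences vanish almost
surely.

To make the system square and invertible, the harmonicity equation of one representative of each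
bottom strongly connected component is replaced by the condition that the bias vanishes there. The
dropped equation follows from the others (`mulVec_eq_of_nonrep`), and the minimum principle shows
that the homogeneous system has only the zero solution (`system_injective`). At admissible values
exactly the edges have positive probability, so components, representatives and almost sure
reachability depend on the graph only. Hence one matrix over `ℤ[X]`, obtained by clearing
denominators, specializes to an invertible real matrix at every admissible value (`sol_spec`).

The system is solved by a Faddeev–LeVerrier recursion scaled by factorials, which needs no division
and therefore commutes with evaluation (`fl_map`, `fl_solve`). Arithmetic in `ℤ[X]` is avoided by
Kronecker substitution: every polynomial is replaced by its value at a large power of two, the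
recursion runs on integers, and the coefficients of the results are recovered as balanced digits
(`rounded_quotient`). The submultiplicative size `nu` controls coefficients and degrees at once and
shows that polynomially many bits suffice (`nu_outPoly_le`).

For the running time, the algorithm is written in a small language of arrays with bounded loops. Its
expressions and statements are translated to machine programs once and for all (`PE.compiles`,
`Stm.compiles`): if all numbers have at most `l` bits and all loops at most `l` rounds, the time is
polynomial in `l`. What remains is to exhibit such an `l` that is polynomial in the input size. -/

lemma bitLen_le {x : ℤ} {b : ℕ} (h : |x| ≤ 2 ^ b) : bitLen x ≤ b + 2 := by
  have h1 : x.natAbs < 2 ^ (b + 1) := by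
    have : (x.natAbs : ℤ) < 2 ^ (b + 1) := by
      rw [Int.natCast_natAbs, pow_succ]
      have : (0 : ℤ) < 2 ^ b := by positivity
      linarith
    exact_mod_cast this
  have := Nat.size_le.2 h1
  unfold bitLen
  omega

/-- `c` started in `σ` halts after time at most `B` in a state that satisfies `Q`. -/
def Does (c : Cmd) (σ : State) (B : ℕ) (Q : State → Prop) : Prop :=
  ∃ τ t, Exec c σ τ t ∧ t ≤ B ∧ Q τ

namespace Does

variable {c d : Cmd} {σ : State} {B B' E : ℕ} {Q Q' : State → Prop}

lemma mono (h : Does c σ B Q) (hB : B ≤ B') (hQ : ∀ τ, Q τ → Q' τ) : Does c σ B' Q' := by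
  obtain ⟨τ, t, h1, h2, h3⟩ := h
  exact ⟨τ, t, h1, h2.trans hB, hQ τ h3⟩

lemma seq (h : Does c σ B fun τ => Does d τ B' Q) : Does (.seq c d) σ (B + B') Q := by
  obtain ⟨τ, t, h1, h2, υ, u, h3, h4, h5⟩ := h
  exact ⟨υ, t + u, .seq _ _ _ _ _ _ _ h1 h3, by omega, h5⟩

lemma skip (hQ : Q σ) : Does .skip σ 1 Q := ⟨σ, 1, .skip σ, le_rfl, hQ⟩

lemma store {a e : Expr}
    (hB : a.cost σ.mem + e.cost σ.mem + bitLen (a.eval σ.mem) + bitLen (e.eval σ.mem) ≤ B)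
    (hQ : Q ⟨Function.update σ.mem (a.eval σ.mem) (e.eval σ.mem), σ.inp, σ.out⟩) :
    Does (.store a e) σ B Q :=
  ⟨_, _, .store a e σ, hB, hQ⟩

lemma read {a : Expr}
    (hB : a.cost σ.mem + bitLen (a.eval σ.mem) + bitLen (σ.inp.headD 0) ≤ B)
    (hQ : Q ⟨Function.update σ.mem (a.eval σ.mem) (σ.inp.headD 0), σ.inp.tail, σ.out⟩) :
    Does (.read a) σ B Q :=
  ⟨_, _, .read a σ, hB, hQ⟩

lemma write {e : Expr} (hB : e.cost σ.mem + bitLen (e.eval σ.mem) ≤ B)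
    (hQ : Q ⟨σ.mem, σ.inp, σ.out ++ [e.eval σ.mem]⟩) : Does (.write e) σ B Q :=
  ⟨_, _, .write e σ, hB, hQ⟩

lemma ite {e : Expr} (hE : e.cost σ.mem + bitLen (e.eval σ.mem) ≤ E)
    (h : if 0 < e.eval σ.mem then Does c σ B Q else Does d σ B Q) :
    Does (.ite e c d) σ (E + B) Q := by
  split_ifs at h with h0 <;> obtain ⟨τ, t, h1, h2, h3⟩ := h
  · exact ⟨τ, _, .ite_pos e c d σ τ t h0 h1, by omega, h3⟩
  · exact ⟨τ, _, .ite_neg e c d σ τ t (not_lt.1 h0) h1, by omega, h3⟩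

/-- Only loops whose number of rounds is known beforehand occur. The invariant is indexed by the
round, so termination needs no separate argument; the last summand `E` pays for the failing test at
the end. -/
lemma loop {e : Expr} (N : ℕ) (I : ℕ → State → Prop) (h0 : I 0 σ)
    (hstep : ∀ k σ, k < N → I k σ → 0 < e.eval σ.mem ∧ e.cost σ.mem + bitLen (e.eval σ.mem) ≤ E ∧
      Does c σ B (I (k + 1)))
    (hend : ∀ σ, I N σ → e.eval σ.mem ≤ 0 ∧ e.cost σ.mem + bitLen (e.eval σ.mem) ≤ E) :
    Does (.loop e c) σ (N * (E + B) + E) (I N) := by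
  have key : ∀ r k σ, k + r = N → I k σ → Does (.loop e c) σ (r * (E + B) + E) (I N) := by
    intro r
    induction r with
    | zero =>
      intro k σ hk hI
      obtain rfl : k = N := by omega
      obtain ⟨h1, h2⟩ := hend σ hI
      exact ⟨σ, _, .loop_done e c σ h1, by omega, hI⟩
    | succ r ih =>
      intro k σ hk hI
      obtain ⟨h1, h2, τ, t, h3, h4, h5⟩ := hstep k σ (by omega) hI
      obtain ⟨υ, u, h6, h7, h8⟩ := ih (k + 1) τ (by omega) h5
      refine ⟨υ, _, .loop_step e c σ τ υ t u h1 h3 h6, ?_, h8⟩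
      rw [add_mul]
      omega
  exact key N 0 σ (by omega) h0

end Does

/-! ## Expressions with bounded sums and products -/

inductive BinOp : Type
  | add | sub | mul | div

namespace BinOp

def eval : BinOp → ℤ → ℤ → ℤ
  | add, x, y => x + y
  | sub, x, y => x - y
  | mul, x, y => x * y
  | div, x, y => x / y

def expr : BinOp → Expr → Expr → Expr
  | add => .plus
  | sub => .minus
  | mul => .times
  | div => .quot

lemma eval_expr (o : BinOp) (a b : Expr) (m : ℤ → ℤ) :
    (o.expr a b).eval m = o.eval (a.eval m) (b.eval m) := by
  cases o <;> rfl

lemma cost_expr (o : BinOp) (a b : Expr) (m : ℤ → ℤ) :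
    (o.expr a b).cost m = a.cost m + b.cost m + bitLen (a.eval m) + bitLen (b.eval m) := by
  cases o <;> rfl

/-- The exponents add up for a product, and the extra `1` absorbs a sum because both powers are at
least one. An integer quotient never exceeds its dividend in absolute value. -/
lemma abs_eval_le (o : BinOp) {x y : ℤ} {a b : ℕ} (hx : |x| ≤ 2 ^ a) (hy : |y| ≤ 2 ^ b) :
    |o.eval x y| ≤ 2 ^ (a + b + 1) := by
  have ha : (1 : ℤ) ≤ 2 ^ a := one_le_pow₀ (by norm_num)
  have hb : (1 : ℤ) ≤ 2 ^ b := one_le_pow₀ (by norm_num)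
  have hab : (2 : ℤ) ^ (a + b + 1) = 2 * (2 ^ a * 2 ^ b) := by ring
  have hs : |x| + |y| ≤ 2 ^ (a + b + 1) := by rw [hab]; nlinarith
  cases o with
  | add => exact (abs_add_le x y).trans hs
  | sub => exact (abs_sub x y).trans hs
  | mul =>
    simp only [eval]
    rw [abs_mul, hab]
    nlinarith [mul_le_mul hx hy (abs_nonneg y) (by positivity)]
  | div =>
    simp only [eval]
    have h1 : |x / y| ≤ |x| := by
      have := Int.natAbs_ediv_le_natAbs x y
      zify at this
      exact this
    rw [hab]; nlinarith
end BinOp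

/-- Expressions over arrays, with de Bruijn indices for the loop variables; `pos c a b` is `a` if
`c > 0` and `b` otherwise, `fold p b e` is the product (`p = true`) or the sum of `e` over all
values `0, …, b - 1` of a new loop variable. -/
inductive PE : Type
  | lit (z : ℤ)
  | var (k : ℕ)
  | get (a : Fin 30) (i : PE)
  | bin (o : BinOp) (a b : PE)
  | pos (c a b : PE)
  | size (a : PE)
  | fold (p : Bool) (b e : PE)

/-- Contents of the arrays. -/
abbrev Mem := Fin 30 → ℤ → ℤ

def foldVal (p : Bool) (f : ℕ → ℤ) (N : ℕ) : ℤ :=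
  if p then ∏ k ∈ Finset.range N, f k else ∑ k ∈ Finset.range N, f k

def foldOp (p : Bool) : BinOp := if p then .mul else .add

def foldInit (p : Bool) : ℤ := if p then 1 else 0

lemma foldVal_zero (p : Bool) (f : ℕ → ℤ) : foldVal p f 0 = foldInit p := by
  cases p <;> simp [foldVal, foldInit]

lemma foldVal_succ (p : Bool) (f : ℕ → ℤ) (N : ℕ) :
    foldVal p f (N + 1) = (foldOp p).eval (foldVal p f N) (f N) := by
  cases p <;> simp [foldVal, foldOp, BinOp.eval, Finset.sum_range_succ, Finset.prod_range_succ]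

/-- Every round adds at most `b + 1` bits to the accumulator, for sums and products alike, so the
exponent is linear in the number of rounds. -/
lemma abs_foldVal_le (p : Bool) (f : ℕ → ℤ) (N b : ℕ) (h : ∀ k < N, |f k| ≤ 2 ^ b) :
    |foldVal p f N| ≤ 2 ^ (N * (b + 1)) := by
  induction N with
  | zero => cases p <;> simp [foldVal]
  | succ N ih =>
    have h1 := ih fun k hk => h k (by omega)
    have h2 := h N (by omega)
    rw [foldVal_succ]
    refine ((foldOp p).abs_eval_le h1 h2).trans (le_of_eq ?_)
    congr 1; ring

namespace PE

/-- Index `0` is the innermost loop variable, a variable out of scope has value `0`, and a fold with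
a negative bound is empty. -/
def eval (μ : Mem) : PE → List ℤ → ℤ
  | lit z, _ => z
  | var k, env => env.getD k 0
  | get a i, env => μ a (i.eval μ env)
  | bin o a b, env => o.eval (a.eval μ env) (b.eval μ env)
  | pos c a b, env => if 0 < c.eval μ env then a.eval μ env else b.eval μ env
  | size a, env => (a.eval μ env).natAbs.size
  | fold p b e, env => foldVal p (fun k => e.eval μ ((k : ℤ) :: env)) (b.eval μ env).toNat

/-- All bounds of sums and products are at most `l`. -/
def Ok (l : ℕ) (μ : Mem) : PE → List ℤ → Prop
  | lit _, _ => True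
  | var _, _ => True
  | get _ i, env => i.Ok l μ env
  | bin _ a b, env => a.Ok l μ env ∧ b.Ok l μ env
  | pos c a b, env => c.Ok l μ env ∧ if 0 < c.eval μ env then a.Ok l μ env else b.Ok l μ env
  | size a, env => a.Ok l μ env
  | fold _ b e, env => b.Ok l μ env ∧ b.eval μ env ≤ l ∧
      ∀ k : ℕ, (k : ℤ) < b.eval μ env → e.Ok l μ ((k : ℤ) :: env)

/-- Bound for the bit length of the value, as a polynomial in a bound for the bit lengths of the
contents of the arrays and for the loop bounds. -/
noncomputable def bits : PE → ℕ[X]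
  | lit z => C z.natAbs
  | var _ => X
  | get _ i => X + i.bits
  | bin _ a b => a.bits + b.bits + 1
  | pos c a b => c.bits + a.bits + b.bits
  | size a => a.bits + 1
  | fold _ b e => b.bits + X * (e.bits + 1)

end PE

/-- All entries of the arrays are bounded by `2 ^ l`. -/
def MemLe (l : ℕ) (μ : Mem) : Prop := ∀ a i, |μ a i| ≤ 2 ^ l

def EnvLe (l : ℕ) (env : List ℤ) : Prop := ∀ x ∈ env, |x| ≤ 2 ^ l

lemma pow_bound {x : ℤ} {a b : ℕ} (h : |x| ≤ 2 ^ a) (hab : a ≤ b) : |x| ≤ 2 ^ b :=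
  h.trans (pow_le_pow_right₀ (by norm_num) hab)

lemma EnvLe.cons {l : ℕ} {env : List ℤ} (h : EnvLe l env) {k : ℕ} (hk : k ≤ l) :
    EnvLe l ((k : ℤ) :: env) := by
  intro x hx
  rcases List.mem_cons.1 hx with rfl | hx
  · rw [Nat.abs_cast]
    have := Nat.lt_two_pow_self (n := k)
    have h2 : (2:ℕ) ^ k ≤ 2 ^ l := Nat.pow_le_pow_right (by norm_num) hk
    exact_mod_cast this.le.trans h2
  · exact h x hx

lemma size_natAbs_le {x : ℤ} {b : ℕ} (h : |x| ≤ 2 ^ b) : x.natAbs.size ≤ b + 1 := by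
  have := bitLen_le h
  unfold bitLen at this
  omega

/-- Folds are the only operation whose growth depends on data. There `Ok` caps the number of rounds
by `l`, which keeps the exponent a polynomial in `l`. -/
lemma PE.abs_eval_le {l : ℕ} {μ : Mem} (hμ : MemLe l μ) (e : PE) :
    ∀ {env : List ℤ}, EnvLe l env → e.Ok l μ env → |e.eval μ env| ≤ 2 ^ (e.bits.eval l) := by
  induction e with
  | lit z =>
    intro env _ _
    simp only [eval, bits, eval_C]
    rw [← Int.natCast_natAbs]
    exact_mod_cast Nat.lt_two_pow_self.le
  | var k =>
    intro env henv _
    simp only [eval, bits, eval_X]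
    rcases lt_or_ge k env.length with h | h
    · rw [List.getD_eq_getElem _ _ h]
      exact henv _ (List.getElem_mem h)
    · rw [List.getD_eq_default _ _ h]
      simp
  | get a i _ =>
    intro env _ _
    exact pow_bound (hμ _ _) (by simp [bits])
  | bin o a b iha ihb =>
    intro env henv hok
    simp only [eval, bits, eval_add, eval_one]
    exact o.abs_eval_le (iha henv hok.1) (ihb henv hok.2)
  | pos c a b _ iha ihb =>
    intro env henv hok
    obtain ⟨_, h⟩ := hok
    simp only [eval, bits, eval_add]
    split_ifs at h ⊢ with h0
    · exact pow_bound (iha henv h) (by omega)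
    · exact pow_bound (ihb henv h) (by omega)
  | size a ih =>
    intro env henv hok
    simp only [eval, bits, eval_add, eval_one, Nat.abs_cast]
    have h1 := size_natAbs_le (ih henv hok)
    have h2 := h1.trans Nat.lt_two_pow_self.le
    exact_mod_cast h2
  | fold p b e _ ihe =>
    intro env henv hok
    obtain ⟨_, h2, h3⟩ := hok
    simp only [eval, bits, eval_add, eval_mul, eval_X, eval_one]
    refine pow_bound (abs_foldVal_le p _ _ (e.bits.eval l) fun k hk => ?_) ?_
    · exact ihe (henv.cons (by omega)) (h3 k (by omega))
    · have : (b.eval μ env).toNat ≤ l := by omega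
      nlinarith

/-! ## Translation into machine programs -/

/-- Addresses of temporary registers and of loop variables. -/
def tmp (s : ℕ) : ℤ := 32 * s

def vreg (v : ℕ) : ℤ := 32 * v + 1

def rg (a : ℤ) : Expr := .reg (.lit a)

/-- Expression for the address of an entry of an array. -/
def cell (a : Fin 30) (x : ℤ) : Expr := .plus (.times (.lit 32) (rg x)) (.lit (a.val + 2))

/-- Code for an expression below `d` loops. It leaves its value in temporary `s` and touches only
temporaries from `s` on and loop variables from `d` on. Loop variables are numbered from the
outside, so index `k` is stored as number `d - 1 - k`. A bit length is found by halving the absolute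
value until it is zero. -/
def PE.comp : PE → ℕ → ℕ → Cmd
  | lit z, _, s => .store (.lit (tmp s)) (.lit z)
  | var k, d, s =>
    .store (.lit (tmp s)) (if k < d then rg (vreg (d - 1 - k)) else .lit 0)
  | get a i, d, s => .seq (i.comp d s) (.store (.lit (tmp s)) (.reg (cell a (tmp s))))
  | bin o a b, d, s => .seq (a.comp d s) (.seq (b.comp d (s + 1))
      (.store (.lit (tmp s)) (o.expr (rg (tmp s)) (rg (tmp (s + 1))))))
  | pos c a b, d, s => .seq (c.comp d s) (.ite (rg (tmp s)) (a.comp d s) (b.comp d s))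
  | size a, d, s => .seq (a.comp d s)
      (.seq (.ite (rg (tmp s)) .skip (.store (.lit (tmp s)) (.minus (.lit 0) (rg (tmp s)))))
      (.seq (.store (.lit (tmp (s + 1))) (.lit 0))
      (.seq (.loop (rg (tmp s))
        (.seq (.store (.lit (tmp (s + 1))) (.plus (rg (tmp (s + 1))) (.lit 1)))
          (.store (.lit (tmp s)) (.quot (rg (tmp s)) (.lit 2)))))
      (.store (.lit (tmp s)) (rg (tmp (s + 1)))))))
  | fold p b e, d, s => .seq (b.comp d s)
      (.seq (.store (.lit (tmp (s + 1))) (.lit (foldInit p)))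
      (.seq (.store (.lit (vreg d)) (.lit 0))
      (.seq (.loop (.minus (rg (tmp s)) (rg (vreg d)))
        (.seq (e.comp (d + 1) (s + 2))
        (.seq (.store (.lit (tmp (s + 1)))
            ((foldOp p).expr (rg (tmp (s + 1))) (rg (tmp (s + 2)))))
          (.store (.lit (vreg d)) (.plus (rg (vreg d)) (.lit 1))))))
      (.store (.lit (tmp s)) (rg (tmp (s + 1)))))))

/-- The registers `m` hold the arrays `μ` and the loop variables `env`. -/
structure Rel (μ : Mem) (env : List ℤ) (m : ℤ → ℤ) : Prop where
  arr : ∀ (a : Fin 30) (i : ℤ), m (32 * i + (a.val + 2)) = μ a i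
  var : ∀ k < env.length, m (vreg (env.length - 1 - k)) = env.getD k 0

/-- `m` and `m'` agree outside of temporaries from `s` on and loop variables from `d` on. -/
structure Same (d s : ℕ) (m m' : ℤ → ℤ) : Prop where
  arr : ∀ (a : Fin 30) (i : ℤ), m' (32 * i + (a.val + 2)) = m (32 * i + (a.val + 2))
  tmp : ∀ k < s, m' (tmp k) = m (tmp k)
  var : ∀ k < d, m' (vreg k) = m (vreg k)

lemma Same.trans {d s : ℕ} {m m' m'' : ℤ → ℤ} (h : Same d s m m') (h' : Same d s m' m'') :
    Same d s m m'' :=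
  ⟨fun a i => (h'.arr a i).trans (h.arr a i), fun k hk => (h'.tmp k hk).trans (h.tmp k hk),
    fun k hk => (h'.var k hk).trans (h.var k hk)⟩

lemma Same.mono {d s d' s' : ℕ} {m m' : ℤ → ℤ} (h : Same d s m m') (hd : d' ≤ d) (hs : s' ≤ s) :
    Same d' s' m m' :=
  ⟨h.arr, fun k hk => h.tmp k (by omega), fun k hk => h.var k (by omega)⟩

/-- The three kinds of registers occupy different residues modulo 32: `0` for temporaries, `1` for
loop variables and `2` to `31` for the thirty arrays. They are disjoint for negative array indices
as well. -/
lemma tmp_ne_arr (k : ℕ) (a : Fin 30) (i : ℤ) : 32 * i + ((a.val : ℤ) + 2) ≠ tmp k := by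
  unfold tmp; omega

lemma vreg_ne_arr (k : ℕ) (a : Fin 30) (i : ℤ) : 32 * i + ((a.val : ℤ) + 2) ≠ vreg k := by
  unfold vreg; omega

lemma vreg_ne_tmp (k j : ℕ) : vreg k ≠ tmp j := by unfold vreg tmp; omega

lemma tmp_inj {k j : ℕ} : tmp k = tmp j ↔ k = j := by unfold tmp; omega

lemma vreg_inj {k j : ℕ} : vreg k = vreg j ↔ k = j := by unfold vreg; omega

lemma Same.update_tmp {d s k : ℕ} (hk : s ≤ k) (m : ℤ → ℤ) (x : ℤ) :
    Same d s m (Function.update m (Ram.tmp k) x) := by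
  refine ⟨fun a i => ?_, fun j hj => ?_, fun j _ => ?_⟩
  · rw [Function.update_of_ne (tmp_ne_arr k a i)]
  · rw [Function.update_of_ne (by rw [Ne, tmp_inj]; omega)]
  · rw [Function.update_of_ne (vreg_ne_tmp _ _)]

lemma Same.update_vreg {d s k : ℕ} (hk : d ≤ k) (m : ℤ → ℤ) (x : ℤ) :
    Same d s m (Function.update m (vreg k) x) := by
  refine ⟨fun a i => ?_, fun j hj => ?_, fun j _ => ?_⟩
  · rw [Function.update_of_ne (vreg_ne_arr k a i)]
  · rw [Function.update_of_ne (vreg_ne_tmp _ _).symm]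
  · rw [Function.update_of_ne (by rw [Ne, vreg_inj]; omega)]

lemma Rel.same {μ : Mem} {env : List ℤ} {m m' : ℤ → ℤ} (h : Rel μ env m) {d s : ℕ}
    (h' : Same d s m m') (hd : env.length ≤ d) : Rel μ env m' :=
  ⟨fun a i => (h'.arr a i).trans (h.arr a i),
    fun k hk => (h'.var _ (by omega)).trans (h.var k hk)⟩

lemma Rel.cons {μ : Mem} {env : List ℤ} {m : ℤ → ℤ} (h : Rel μ env m) {x : ℤ}
    (hx : m (vreg env.length) = x) : Rel μ (x :: env) m := by
  refine ⟨h.arr, fun k hk => ?_⟩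
  cases k with
  | zero => simpa using hx
  | succ k =>
    simp only [List.length_cons] at hk
    have := h.var k (by omega)
    simp only [List.length_cons, List.getD_cons_succ]
    rw [← this]
    congr 2
    omega

/-- Postcondition of the code of an expression. -/
def EvalPost (d s : ℕ) (σ : State) (v : ℤ) (τ : State) : Prop :=
  τ.inp = σ.inp ∧ τ.out = σ.out ∧ Same d s σ.mem τ.mem ∧ τ.mem (tmp s) = v

/-- The translation of `e` computes its value in polynomial time. -/
def PE.Compiles (e : PE) : Prop :=
  ∀ d s : ℕ, ∃ T : ℕ[X], ∀ (l : ℕ) (μ : Mem) (env : List ℤ) (σ : State),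
    env.length = d → Rel μ env σ.mem → MemLe l μ → EnvLe l env → e.Ok l μ env →
    Does (e.comp d s) σ (T.eval l) (EvalPost d s σ (e.eval μ env))

lemma PE.Compiles.lit (z : ℤ) : PE.Compiles (PE.lit z) := by
  intro d s
  refine ⟨C (2 * bitLen (tmp s) + 2 * bitLen z), fun l μ env σ _ _ _ _ _ => ?_⟩
  refine .store ?_ ⟨rfl, rfl, .update_tmp le_rfl _ _, ?_⟩
  · simp [Expr.cost, Expr.eval]; omega
  · simp [Expr.eval, PE.eval]

lemma PE.Compiles.var (k : ℕ) : PE.Compiles (PE.var k) := by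
  intro d s
  refine ⟨C (2 * bitLen (tmp s) + 2 * bitLen (vreg (d - 1 - k)) + 4 + 2 * bitLen 0) + 2 * X,
    fun l μ env σ hd hR hμ henv hok => ?_⟩
  simp only [PE.comp]
  subst hd
  split_ifs with hk
  · refine .store ?_ ⟨rfl, rfl, .update_tmp le_rfl _ _, ?_⟩
    · have : |σ.mem (vreg (env.length - 1 - k))| ≤ 2 ^ l := by
        rw [hR.var k hk, List.getD_eq_getElem _ _ hk]
        exact henv _ (List.getElem_mem hk)
      have := bitLen_le this
      simp [Expr.cost, Expr.eval, rg]; omega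
    · simp [Expr.eval, PE.eval, rg, hR.var k hk]
  · refine .store ?_ ⟨rfl, rfl, .update_tmp le_rfl _ _, ?_⟩
    · simp [Expr.cost, Expr.eval]; omega
    · simp only [Expr.eval, PE.eval, Function.update_self]
      rw [List.getD_eq_default _ _ (by omega)]

lemma PE.Compiles.get (a : Fin 30) {i : PE} (ih : i.Compiles) : PE.Compiles (PE.get a i) := by
  intro d s
  obtain ⟨T, hT⟩ := ih d s
  refine ⟨T + (C (2 * bitLen (tmp s) + 2 * bitLen (tmp s) + 2 * bitLen 32 +
      2 * bitLen (a.val + 2) + bitLen 32 + 50) + 20 * i.bits + 2 * X + C (bitLen (a.val + 2) * 20)),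
    fun l μ env σ hd hR hμ henv hok => ?_⟩
  rw [eval_add]
  refine (Does.mono (hT l μ env σ hd hR hμ henv hok) le_rfl ?_).seq
  rintro τ ⟨h1, h2, h3, h4⟩
  have hR' := hR.same h3 hd.le
  have hv := i.abs_eval_le hμ henv hok
  have hcell : (cell a (tmp s)).eval τ.mem = 32 * i.eval μ env + (a.val + 2) := by
    simp [cell, Expr.eval, rg, h4]
  refine .store ?_ ⟨h1, h2, h3.trans (.update_tmp le_rfl _ _), ?_⟩
  · have b1 := bitLen_le hv
    have b2 := bitLen_le (hμ a (i.eval μ env))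
    have e32 : |(32 : ℤ)| ≤ 2 ^ 5 := by norm_num
    have b3 : |32 * i.eval μ env| ≤ 2 ^ (5 + i.bits.eval l + 1) :=
      BinOp.abs_eval_le .mul e32 hv
    have ea : |((a.val : ℤ) + 2)| ≤ 2 ^ 5 := by
      have := a.isLt
      rw [abs_of_nonneg (by positivity)]; norm_num; omega
    have b4 : |32 * i.eval μ env + (a.val + 2)| ≤ 2 ^ ((5 + i.bits.eval l + 1) + 5 + 1) :=
      BinOp.abs_eval_le (a := 5 + i.bits.eval l + 1) .add b3 ea
    have b3' := bitLen_le b3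
    have b4' := bitLen_le b4
    simp only [Expr.eval, Expr.cost, hcell, hR'.arr]
    simp only [cell, Expr.eval, rg, Expr.cost, h4, eval_add, eval_mul, eval_C, eval_X,
      eval_ofNat]
    omega
  · simp [Expr.eval, hcell, hR'.arr, PE.eval]

lemma PE.Compiles.bin (o : BinOp) {a b : PE} (iha : a.Compiles) (ihb : b.Compiles) : PE.Compiles (PE.bin o a b) := by
  intro d s
  obtain ⟨Ta, hTa⟩ := iha d s
  obtain ⟨Tb, hTb⟩ := ihb d (s + 1)
  refine ⟨Ta + (Tb + (C (4 * bitLen (tmp s) + 2 * bitLen (tmp (s + 1)) + 20)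
      + 4 * a.bits + 4 * b.bits)), fun l μ env σ hd hR hμ henv hok => ?_⟩
  rw [eval_add, eval_add]
  refine (Does.mono (hTa l μ env σ hd hR hμ henv hok.1) le_rfl ?_).seq
  rintro τ ⟨h1, h2, h3, h4⟩
  refine (Does.mono (hTb l μ env τ hd (hR.same h3 hd.le) hμ henv hok.2) le_rfl ?_).seq
  rintro υ ⟨h1', h2', h3', h4'⟩
  -- The second operand uses temporaries from `s + 1` on only, so the first result survives.
  have h5 : υ.mem (tmp s) = a.eval μ env := (h3'.tmp s (by omega)).trans h4
  have hva := a.abs_eval_le hμ henv hok.1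
  have hvb := b.abs_eval_le hμ henv hok.2
  refine .store ?_ ⟨h1'.trans h1, h2'.trans h2,
    h3.trans ((h3'.mono le_rfl (by omega)).trans (.update_tmp le_rfl _ _)), ?_⟩
  · have b1 := bitLen_le hva
    have b2 := bitLen_le hvb
    have b3 := bitLen_le (o.abs_eval_le hva hvb)
    simp only [Expr.eval, Expr.cost, rg, o.eval_expr, o.cost_expr, h4', h5, eval_add, eval_mul,
      eval_C, eval_ofNat]
    omega
  · simp [Expr.eval, o.eval_expr, rg, h4', h5, PE.eval]

lemma PE.Compiles.pos {c a b : PE} (ihc : c.Compiles) (iha : a.Compiles) (ihb : b.Compiles) : PE.Compiles (PE.pos c a b) := by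
  intro d s
  obtain ⟨Tc, hTc⟩ := ihc d s
  obtain ⟨Ta, hTa⟩ := iha d s
  obtain ⟨Tb, hTb⟩ := ihb d s
  refine ⟨Tc + ((C (2 * bitLen (tmp s) + 10) + 2 * c.bits) + (Ta + Tb)),
    fun l μ env σ hd hR hμ henv hok => ?_⟩
  simp only [eval_add]
  refine (Does.mono (hTc l μ env σ hd hR hμ henv hok.1) le_rfl ?_).seq
  rintro τ ⟨h1, h2, h3, h4⟩
  have hR' := hR.same h3 hd.le
  have b1 := bitLen_le (c.abs_eval_le hμ henv hok.1)
  refine .ite ?_ ?_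
  · simp only [Expr.eval, Expr.cost, rg, h4, eval_mul, eval_C, eval_ofNat]
    omega
  · have h5 := hok.2
    simp only [Expr.eval, rg, h4, PE.eval]
    split_ifs at h5 ⊢ with h0
    · refine Does.mono (hTa l μ env τ hd hR' hμ henv h5) (by simp) ?_
      rintro υ ⟨h1', h2', h3', h4'⟩
      exact ⟨h1'.trans h1, h2'.trans h2, h3.trans h3', h4'⟩
    · refine Does.mono (hTb l μ env τ hd hR' hμ henv h5) (by simp) ?_
      rintro υ ⟨h1', h2', h3', h4'⟩
      exact ⟨h1'.trans h1, h2'.trans h2, h3.trans h3', h4'⟩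

/-- After `k` halvings, temporary `s` holds the absolute value divided by `2 ^ k` and the next
temporary holds `k`. The value first becomes zero when `k` is the bit length, which is at most the
bit bound of `a` plus one; this bounds the number of rounds. -/
lemma PE.Compiles.size {a : PE} (ih : a.Compiles) : PE.Compiles (PE.size a) := by
  intro d s
  obtain ⟨T, hT⟩ := ih d s
  set c0 := bitLen (tmp s) with hc0
  set c1 := bitLen (tmp (s + 1)) with hc1
  have hl0 : bitLen 0 = 1 := by simp [bitLen]
  have hl1 : bitLen 1 = 2 := by simp [bitLen]
  have hl2 : bitLen 2 = 3 := by simp [bitLen, Nat.size, Nat.binaryRec]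
  refine ⟨T + (((C (2 * c0 + 4) + 2 * a.bits) + (C (4 * c0 + 20) + 4 * a.bits)) +
      (C (2 * c1 + 2) + (((a.bits + 1) * ((C (2 * c0 + 4) + 2 * a.bits) +
        ((C (4 * c1 + 20) + 4 * a.bits) + (C (4 * c0 + 20) + 4 * a.bits))) +
        (C (2 * c0 + 4) + 2 * a.bits)) +
      (C (4 * c1 + 4 * c0 + 20) + 4 * a.bits)))),
    fun l μ env σ hd hR hμ henv hok => ?_⟩
  have hv := a.abs_eval_le hμ henv hok
  set v := a.eval μ env with hvdef
  set q := a.bits.eval l with hq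
  have bv := bitLen_le hv
  have hsz := size_natAbs_le hv
  simp only [eval_add, eval_mul, eval_C, eval_ofNat, eval_one]
  refine (Does.mono (hT l μ env σ hd hR hμ henv hok) le_rfl ?_).seq
  rintro τ ⟨h1, h2, h3, h4⟩
  refine Does.seq ?_
  have key : ∀ τ : State, EvalPost d s σ v.natAbs τ → Does
      (.seq (.store (.lit (tmp (s + 1))) (.lit 0))
      (.seq (.loop (rg (tmp s))
      (.seq (.store (.lit (tmp (s + 1))) (.plus (rg (tmp (s + 1))) (.lit 1)))
        (.store (.lit (tmp s)) (.quot (rg (tmp s)) (.lit 2)))))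
      (.store (.lit (tmp s)) (rg (tmp (s + 1)))))) τ
      (2 * c1 + 2 + ((q + 1) * (2 * c0 + 4 + 2 * q + (4 * c1 + 20 + 4 * q + (4 * c0 + 20 + 4 * q))) +
        (2 * c0 + 4 + 2 * q) + (4 * c1 + 4 * c0 + 20 + 4 * q)))
      (EvalPost d s σ (((a.eval μ env).natAbs.size : ℕ) : ℤ)) := by
    rintro τ ⟨h1, h2, h3, h4⟩
    refine Does.seq (.store ?_ ?_)
    · simp [Expr.eval, Expr.cost, hl0]; omega
    refine Does.seq ?_
    have hloop := Does.loop (σ := ⟨Function.update τ.mem (tmp (s + 1)) 0, τ.inp, τ.out⟩)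
      (e := rg (tmp s))
      (c := (.seq (.store (.lit (tmp (s + 1))) (.plus (rg (tmp (s + 1))) (.lit 1)))
        (.store (.lit (tmp s)) (.quot (rg (tmp s)) (.lit 2)))))
      (E := 2 * c0 + 4 + 2 * q) (B := 4 * c1 + 20 + 4 * q + (4 * c0 + 20 + 4 * q))
      (v.natAbs.size) (fun k τ' => τ'.inp = σ.inp ∧ τ'.out = σ.out ∧ Same d s σ.mem τ'.mem ∧
        τ'.mem (tmp s) = ((v.natAbs / 2 ^ k : ℕ) : ℤ) ∧ τ'.mem (tmp (s + 1)) = (k : ℤ))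
      ?_ ?_ ?_
    · refine Does.mono hloop ?_ ?_
      · gcongr
      · rintro υ ⟨g1, g2, g3, g4, g5⟩
        refine .store ?_ ⟨g1, g2, g3.trans (.update_tmp le_rfl _ _), ?_⟩
        · have : bitLen (v.natAbs.size : ℤ) ≤ q + 3 := by
            have : |(v.natAbs.size : ℤ)| ≤ 2 ^ (q + 1) := by
              rw [Nat.abs_cast]
              exact_mod_cast hsz.trans Nat.lt_two_pow_self.le
            exact bitLen_le this
          simp [Expr.eval, Expr.cost, rg, g5]; omega
        · simp [Expr.eval, rg, g5, hvdef]
    · refine ⟨h1, h2, h3.trans (.update_tmp (by omega) _ _), ?_, ?_⟩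
      · simp only
        rw [Function.update_of_ne (by rw [Ne, tmp_inj]; omega), h4]; simp
      · simp
    · rintro k σ' hk ⟨g1, g2, g3, g4, g5⟩
      have hpos : 0 < v.natAbs / 2 ^ k :=
        Nat.div_pos (Nat.lt_size.1 hk) (by positivity)
      have hbk : ∀ j, bitLen ((v.natAbs / 2 ^ j : ℕ) : ℤ) ≤ q + 2 := by
        intro j
        apply bitLen_le
        rw [Nat.abs_cast]
        refine le_trans ?_ hv
        rw [← Int.natCast_natAbs]
        exact_mod_cast Nat.div_le_self _ _
      have hkk : ∀ j ≤ q + 1, bitLen (j : ℤ) ≤ q + 3 := by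
        intro j hj
        apply bitLen_le
        rw [Nat.abs_cast]
        exact_mod_cast hj.trans Nat.lt_two_pow_self.le
      have hdiv : ((v.natAbs / 2 ^ k : ℕ) : ℤ) / 2 = ((v.natAbs / 2 ^ (k + 1) : ℕ) : ℤ) := by
        rw [pow_succ, ← Nat.div_div_eq_div_mul]
        push_cast; rfl
      refine ⟨?_, ?_, ?_⟩
      · simp only [rg, Expr.eval, g4]; exact_mod_cast hpos
      · have := hbk k
        simp only [rg, Expr.eval, Expr.cost, g4]; omega
      · refine Does.seq (.store ?_ (.store ?_ ⟨g1, g2, ?_, ?_, ?_⟩))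
        · have e1 := hkk k (by omega)
          have e2 := hkk (k + 1) (by omega)
          push_cast at e2
          simp only [rg, Expr.eval, Expr.cost, g5, hl1]; omega
        · have e1 := hbk k
          have e2 := hbk (k + 1)
          simp only [rg, Expr.eval, Expr.cost, hl2]
          rw [Function.update_of_ne (by rw [Ne, tmp_inj]; omega), g4, hdiv]
          omega
        · exact g3.trans ((Same.update_tmp (by omega) _ _).trans (.update_tmp le_rfl _ _))
        · simp only [rg, Expr.eval, Function.update_self]
          rw [Function.update_of_ne (by rw [Ne, tmp_inj]; omega), g4, hdiv]
        · simp only [rg, Expr.eval]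
          rw [Function.update_of_ne (by rw [Ne, tmp_inj]; omega)]
          simp [g5]
    · rintro σ' ⟨g1, g2, g3, g4, g5⟩
      have h0 : v.natAbs / 2 ^ v.natAbs.size = 0 := Nat.div_eq_of_lt (Nat.lt_size_self _)
      simp only [rg, Expr.eval, Expr.cost, g4, h0, Nat.cast_zero, hl0]
      refine ⟨le_rfl, by omega⟩
  refine Does.mono (Does.ite (B := 4 * c0 + 20 + 4 * q) (E := 2 * c0 + 4 + 2 * q) (Q := EvalPost d s σ v.natAbs) ?_ ?_) le_rfl key
  · simp only [Expr.eval, Expr.cost, rg, h4, ← hvdef]; omega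
  · simp only [rg, Expr.eval, h4, ← hvdef]
    split_ifs with h0
    · exact (Does.skip (Q := EvalPost d s σ v.natAbs) ⟨h1, h2, h3, by rw [h4, ← hvdef]; omega⟩).mono (by omega) fun _ h => h
    · refine .store ?_ ⟨h1, h2, h3.trans (.update_tmp le_rfl _ _), ?_⟩
      · have : bitLen (-v) = bitLen v := by simp [bitLen]
        simp only [Expr.eval, Expr.cost, h4, ← hvdef, hl0, zero_sub, this]; omega
      · simp only [Expr.eval, h4, ← hvdef, Function.update_self]; omega

/-- Temporary `s` keeps the bound, `s + 1` the accumulator, and `s + 2` receives the value of the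
body; the counter is loop variable `d`. At most `l` rounds occur, so the time is `l` times the
polynomial bound of one round, plus overhead. -/
lemma PE.Compiles.fold (p : Bool) {b e : PE} (ihb : b.Compiles) (ihe : e.Compiles) : PE.Compiles (PE.fold p b e) := by
  intro d s
  obtain ⟨Tb, hTb⟩ := ihb d s
  obtain ⟨Te, hTe⟩ := ihe (d + 1) (s + 2)
  set c0 := bitLen (tmp s) with hc0
  set c1 := bitLen (tmp (s + 1)) with hc1
  set c2 := bitLen (tmp (s + 2)) with hc2
  set cv := bitLen (vreg d) with hcv
  have hl0 : bitLen 0 = 1 := by simp [bitLen]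
  have hl1 : bitLen 1 = 2 := by simp [bitLen]
  refine ⟨Tb + (C (2 * c1 + 4) + (C (2 * cv + 4) +
    ((X * ((C (2 * c0 + 2 * cv + 20) + 4 * b.bits + 4 * X) + (Te + ((C (4 * c1 + 2 * c2 + 20) + 4 * (X * (e.bits + 1)) + 4 * e.bits) +
      (C (4 * cv + 20) + 4 * X)))) + (C (2 * c0 + 2 * cv + 20) + 4 * b.bits + 4 * X)) +
    (C (2 * c0 + 2 * c1 + 20) + 4 * (X * (e.bits + 1)))))),
    fun l μ env σ hd hR hμ henv hok => ?_⟩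
  obtain ⟨ok1, ok2, ok3⟩ := hok
  have hvb := b.abs_eval_le hμ henv ok1
  have bvb := bitLen_le hvb
  set vb := b.eval μ env with hvbdef
  set qb := b.bits.eval l with hqb
  set qe := e.bits.eval l with hqe
  have hNl : vb.toNat ≤ l := by omega
  have hve : ∀ k < vb.toNat, |e.eval μ ((k : ℤ) :: env)| ≤ 2 ^ qe := fun k hk =>
    e.abs_eval_le hμ (henv.cons (by omega)) (ok3 k (by omega))
  set f : ℕ → ℤ := fun k => e.eval μ ((k : ℤ) :: env) with hf
  have hacc : ∀ k ≤ vb.toNat, bitLen (foldVal p f k) ≤ l * (qe + 1) + 2 := by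
    intro k hk
    refine bitLen_le (pow_bound (abs_foldVal_le p f k qe fun j hj => hve j (by omega)) ?_)
    gcongr; omega
  have hkk : ∀ k ≤ l + 1, bitLen (k : ℤ) ≤ l + 3 := by
    intro j hj
    apply bitLen_le
    rw [Nat.abs_cast]
    exact_mod_cast hj.trans Nat.lt_two_pow_self.le
  simp only [eval_add, eval_mul, eval_C, eval_ofNat, eval_one, eval_X]
  refine (Does.mono (hTb l μ env σ hd hR hμ henv ok1) le_rfl ?_).seq
  rintro τ ⟨h1, h2, h3, h4⟩
  refine Does.seq (.store ?_ ?_)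
  · have : bitLen (foldInit p) ≤ 2 := by cases p <;> simp [foldInit, hl0, hl1]
    simp only [Expr.eval, Expr.cost]; omega
  refine Does.seq (.store ?_ ?_)
  · simp only [Expr.eval, Expr.cost, hl0]; omega
  refine Does.seq ?_
  simp only [Expr.eval]
  set E := 2 * c0 + 2 * cv + 20 + 4 * qb + 4 * l with hE
  have hloop := Does.loop (σ := ⟨Function.update (Function.update τ.mem (tmp (s + 1)) (foldInit p)) (vreg d) 0, τ.inp, τ.out⟩)
      (e := .minus (rg (tmp s)) (rg (vreg d)))
      (c := (.seq (e.comp (d + 1) (s + 2))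
      (.seq (.store (.lit (tmp (s + 1)))
          ((foldOp p).expr (rg (tmp (s + 1))) (rg (tmp (s + 2)))))
        (.store (.lit (vreg d)) (.plus (rg (vreg d)) (.lit 1))))))
      (E := E)
      (B := Te.eval l + ((4 * c1 + 2 * c2 + 20 + 4 * (l * (qe + 1)) + 4 * qe) + (4 * cv + 20 + 4 * l)))
      (vb.toNat) (fun k τ' => τ'.inp = σ.inp ∧ τ'.out = σ.out ∧ Same d s σ.mem τ'.mem ∧
        τ'.mem (tmp s) = vb ∧ τ'.mem (tmp (s + 1)) = foldVal p f k ∧ τ'.mem (vreg d) = k)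
      ?_ ?_ ?_
  · refine Does.mono hloop ?_ ?_
    · gcongr
    · rintro υ ⟨g1, g2, g3, g4, g5, g6⟩
      refine .store ?_ ⟨g1, g2, g3.trans (.update_tmp le_rfl _ _), ?_⟩
      · have := hacc _ le_rfl
        simp only [Expr.eval, Expr.cost, rg, g5, ← hqe]; omega
      · simp [Expr.eval, rg, g5, PE.eval, hf, hvbdef]
  · refine ⟨h1, h2, h3.trans ((Same.update_tmp (by omega) _ _).trans (.update_vreg le_rfl _ _)), ?_, ?_, ?_⟩
    · simp only
      rw [Function.update_of_ne (vreg_ne_tmp _ _).symm, Function.update_of_ne (by rw [Ne, tmp_inj]; omega), h4]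
    · simp only
      rw [Function.update_of_ne (vreg_ne_tmp _ _).symm, Function.update_self, foldVal_zero]
    · simp
  · rintro k σ' hk ⟨g1, g2, g3, g4, g5, g6⟩
    refine ⟨?_, ?_, ?_⟩
    · simp only [rg, Expr.eval, g4, g6]; omega
    · have e1 := hkk k (by omega)
      have e2 : |vb - k| ≤ 2 ^ qb := by
        rw [abs_of_nonneg (by omega)]
        exact le_trans (by omega) ((le_abs_self vb).trans hvb)
      have e3 := bitLen_le e2
      simp only [rg, Expr.eval, Expr.cost, g4, g6]; omega
    · have hR' : Rel μ ((k : ℤ) :: env) σ'.mem :=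
        (hR.same g3 hd.le).cons (by rw [hd]; exact g6)
      refine Does.seq ((hTe l μ ((k : ℤ) :: env) σ' (by simp [hd]) hR' hμ (henv.cons (by omega)) (ok3 k (by omega))).mono le_rfl ?_)
      rintro υ ⟨i1, i2, i3, i4⟩
      have j1 : υ.mem (tmp (s + 1)) = foldVal p f k := (i3.tmp _ (by omega)).trans g5
      have j2 : υ.mem (tmp s) = vb := (i3.tmp _ (by omega)).trans g4
      have j3 : υ.mem (vreg d) = k := (i3.var _ (by omega)).trans g6
      refine Does.seq (.store ?_ (.store ?_ ⟨?_, ?_, ?_, ?_, ?_, ?_⟩))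
      · have e1 := hacc k (by omega)
        have e2 := hacc (k + 1) (by omega)
        have e3 := bitLen_le (hve k hk)
        rw [foldVal_succ] at e2
        simp only [rg, Expr.eval, Expr.cost, BinOp.cost_expr, BinOp.eval_expr, j1, i4]
        simp only [hf] at e2 e1 ⊢
        omega
      · have e1 := hkk k (by omega)
        have e2 := hkk (k + 1) (by omega)
        push_cast at e2
        simp only [rg, Expr.eval, Expr.cost, hl1]
        rw [Function.update_of_ne (vreg_ne_tmp _ _), j3]
        omega
      · exact i1.trans g1
      · exact i2.trans g2
      · exact g3.trans ((i3.mono (by omega) (by omega)).trans ((Same.update_tmp (by omega) _ _).trans (.update_vreg le_rfl _ _)))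
      · simp only [Expr.eval]
        rw [Function.update_of_ne (vreg_ne_tmp _ _).symm, Function.update_of_ne (by rw [Ne, tmp_inj]; omega), j2]
      · simp only [Expr.eval]
        rw [Function.update_of_ne (vreg_ne_tmp _ _).symm, Function.update_self, foldVal_succ]
        simp [BinOp.eval_expr, rg, Expr.eval, j1, i4, hf]
      · simp only [Expr.eval, rg, Function.update_self]
        rw [Function.update_of_ne (vreg_ne_tmp _ _), j3]; push_cast; rfl
  · rintro σ' ⟨g1, g2, g3, g4, g5, g6⟩
    have e1 := hkk vb.toNat (by omega)
    have e2 : |vb - vb.toNat| ≤ 2 ^ qb := by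
      refine le_trans ?_ hvb
      rw [abs_le]
      constructor <;> rcases abs_cases vb with ⟨h, h'⟩ | ⟨h, h'⟩ <;> omega
    have e3 := bitLen_le e2
    simp only [rg, Expr.eval, Expr.cost, g4, g6]
    constructor <;> omega

lemma PE.compiles (e : PE) : e.Compiles := by
  induction e with
  | lit z => exact .lit z
  | var k => exact .var k
  | get a i ih => exact .get a ih
  | bin o a b iha ihb => exact .bin o iha ihb
  | pos c a b ihc iha ihb => exact .pos ihc iha ihb
  | size a ih => exact .size ih
  | fold p b e ihb ihe => exact .fold p ihb ihe

end Ram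

namespace Ram

/-! ## Statements -/

/-- State of a structured program: arrays, rest of the input, output. -/
structure HState : Type where
  mem : Mem
  inp : List ℤ
  out : List ℤ

inductive Stm : Type
  | set (a : Fin 30) (i e : PE)
  | read (a : Fin 30) (i : PE)
  | write (e : PE)
  | seq (s t : Stm)
  | pos (c : PE) (s t : Stm)
  | loop (b : PE) (s : Stm)

/-- Write `x` into entry `i` of the array `a`. -/
def Mem.put (μ : Mem) (a : Fin 30) (i x : ℤ) : Mem :=
  Function.update μ a (Function.update (μ a) i x)

def iter (f : ℕ → HState → HState) : ℕ → HState → HState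
  | 0, σ => σ
  | k + 1, σ => f k (iter f k σ)

namespace Stm

/-- The bound of a loop is evaluated once, before the first round, so every statement terminates. -/
def run : Stm → List ℤ → HState → HState
  | set a i e, env, σ => ⟨σ.mem.put a (i.eval σ.mem env) (e.eval σ.mem env), σ.inp, σ.out⟩
  | read a i, env, σ => ⟨σ.mem.put a (i.eval σ.mem env) (σ.inp.headD 0), σ.inp.tail, σ.out⟩
  | write e, env, σ => ⟨σ.mem, σ.inp, σ.out ++ [e.eval σ.mem env]⟩
  | seq s t, env, σ => t.run env (s.run env σ)
  | pos c s t, env, σ => if 0 < c.eval σ.mem env then s.run env σ else t.run env σ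
  | loop b s, env, σ => iter (fun k => s.run ((k : ℤ) :: env)) (b.eval σ.mem env).toNat σ

/-- All loop bounds are at most `l`, and all numbers are at most `2 ^ l` in absolute value. -/
def Ok (l : ℕ) : Stm → List ℤ → HState → Prop
  | set _ i e, env, σ => MemLe l σ.mem ∧ i.Ok l σ.mem env ∧ e.Ok l σ.mem env
  | read _ i, env, σ => MemLe l σ.mem ∧ i.Ok l σ.mem env ∧ |σ.inp.headD 0| ≤ 2 ^ l
  | write e, env, σ => MemLe l σ.mem ∧ e.Ok l σ.mem env
  | seq s t, env, σ => s.Ok l env σ ∧ t.Ok l env (s.run env σ)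
  | pos c s t, env, σ => MemLe l σ.mem ∧ c.Ok l σ.mem env ∧
      if 0 < c.eval σ.mem env then s.Ok l env σ else t.Ok l env σ
  | loop b s, env, σ => MemLe l σ.mem ∧ b.Ok l σ.mem env ∧ b.eval σ.mem env ≤ l ∧
      ∀ k : ℕ, (k : ℤ) < b.eval σ.mem env →
        s.Ok l ((k : ℤ) :: env) (iter (fun k => s.run ((k : ℤ) :: env)) k σ)

/-- Translation of a statement below `d` loops, with the temporaries from `s` on. -/
def comp : Stm → ℕ → ℕ → Cmd
  | set a i e, d, s => .seq (i.comp d s) (.seq (e.comp d (s + 1))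
      (.store (cell a (tmp s)) (rg (tmp (s + 1)))))
  | read a i, d, s => .seq (i.comp d s) (.read (cell a (tmp s)))
  | write e, d, s => .seq (e.comp d s) (.write (rg (tmp s)))
  | seq s t, d, r => .seq (s.comp d r) (t.comp d r)
  | pos c s t, d, r => .seq (c.comp d r) (.ite (rg (tmp r)) (s.comp d r) (t.comp d r))
  | loop b t, d, s => .seq (b.comp d s) (.seq (.store (.lit (vreg d)) (.lit 0))
      (.loop (.minus (rg (tmp s)) (rg (vreg d)))
        (.seq (t.comp (d + 1) (s + 1))
          (.store (.lit (vreg d)) (.plus (rg (vreg d)) (.lit 1))))))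

end Stm

/-- The machine state `σ` represents the state `θ` of a structured program. -/
structure Sim (env : List ℤ) (θ : HState) (σ : State) : Prop where
  rel : Rel θ.mem env σ.mem
  inp : σ.inp = θ.inp
  out : σ.out = θ.out

/-- Temporaries below `s` and loop variables below `d` are unchanged. -/
structure Keep (d s : ℕ) (m m' : ℤ → ℤ) : Prop where
  tmp : ∀ k < s, m' (tmp k) = m (tmp k)
  var : ∀ k < d, m' (vreg k) = m (vreg k)

lemma Keep.trans {d s : ℕ} {m m' m'' : ℤ → ℤ} (h : Keep d s m m') (h' : Keep d s m' m'') :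
    Keep d s m m'' :=
  ⟨fun k hk => (h'.tmp k hk).trans (h.tmp k hk), fun k hk => (h'.var k hk).trans (h.var k hk)⟩

lemma Keep.mono {d s d' s' : ℕ} {m m' : ℤ → ℤ} (h : Keep d s m m') (hd : d' ≤ d) (hs : s' ≤ s) :
    Keep d' s' m m' :=
  ⟨fun k hk => h.tmp k (by omega), fun k hk => h.var k (by omega)⟩

lemma Same.keep {d s : ℕ} {m m' : ℤ → ℤ} (h : Same d s m m') : Keep d s m m' := ⟨h.tmp, h.var⟩

lemma cell_inj {a b : Fin 30} {i j : ℤ} :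
    32 * i + ((a.val : ℤ) + 2) = 32 * j + (b.val + 2) ↔ a = b ∧ i = j := by
  rw [Fin.ext_iff]; omega

lemma Rel.put {μ : Mem} {env : List ℤ} {m : ℤ → ℤ} (h : Rel μ env m) (a : Fin 30) (i x : ℤ) :
    Rel (μ.put a i x) env (Function.update m (32 * i + (a.val + 2)) x) := by
  refine ⟨fun b j => ?_, fun k hk => ?_⟩
  · rcases eq_or_ne b a with rfl | hb
    · rcases eq_or_ne j i with rfl | hj
      · simp [Mem.put]
      · rw [Function.update_of_ne (by rw [Ne, cell_inj]; tauto)]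
        simp [Mem.put, hj, h.arr]
    · rw [Function.update_of_ne (by rw [Ne, cell_inj]; tauto)]
      simp [Mem.put, hb, h.arr]
  · rw [Function.update_of_ne (vreg_ne_arr _ _ _).symm]
    exact h.var k hk

lemma Keep.put (d s : ℕ) (m : ℤ → ℤ) (a : Fin 30) (i x : ℤ) :
    Keep d s m (Function.update m (32 * i + (a.val + 2)) x) :=
  ⟨fun k _ => by rw [Function.update_of_ne (tmp_ne_arr _ _ _).symm],
    fun k _ => by rw [Function.update_of_ne (vreg_ne_arr _ _ _).symm]⟩

/-- The translation of `s` simulates it in polynomial time. -/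
def Stm.Compiles (t : Stm) : Prop :=
  ∀ d s : ℕ, ∃ T : ℕ[X], ∀ (l : ℕ) (θ : HState) (env : List ℤ) (σ : State),
    env.length = d → Sim env θ σ → EnvLe l env → t.Ok l env θ →
    Does (t.comp d s) σ (T.eval l) fun τ => Sim env (t.run env θ) τ ∧ Keep d s σ.mem τ.mem

lemma cost_cell (a : Fin 30) {x : ℤ} {m : ℤ → ℤ} {b : ℕ} (h : |m x| ≤ 2 ^ b) :
    (cell a x).eval m = 32 * m x + (a.val + 2) ∧
    (cell a x).cost m + bitLen (32 * m x + (a.val + 2)) ≤ 2 * bitLen x + 10 * b + 100 := by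
  refine ⟨by simp [cell, Expr.eval, rg], ?_⟩
  have b1 := bitLen_le h
  have e32 : |(32 : ℤ)| ≤ 2 ^ 5 := by norm_num
  have b3 : |32 * m x| ≤ 2 ^ (5 + b + 1) := BinOp.abs_eval_le .mul e32 h
  have ea : |((a.val : ℤ) + 2)| ≤ 2 ^ 5 := by
    have := a.isLt
    rw [abs_of_nonneg (by positivity)]; norm_num; omega
  have b4 : |32 * m x + (a.val + 2)| ≤ 2 ^ ((5 + b + 1) + 5 + 1) :=
    BinOp.abs_eval_le (a := 5 + b + 1) .add b3 ea
  have b3' := bitLen_le b3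
  have b4' := bitLen_le b4
  have b5 := bitLen_le e32
  have b6 := bitLen_le ea
  simp only [cell, Expr.eval, rg, Expr.cost]
  omega

namespace Stm.Compiles

lemma set (a : Fin 30) (i e : PE) : (Stm.set a i e).Compiles := by
  intro d s
  obtain ⟨Ti, hTi⟩ := i.compiles d s
  obtain ⟨Te, hTe⟩ := e.compiles d (s + 1)
  refine ⟨Ti + (Te + (C (2 * bitLen (tmp s) + 2 * bitLen (tmp (s + 1)) + 200) + 10 * i.bits +
    4 * e.bits)), fun l θ env σ hd hS henv hok => ?_⟩
  obtain ⟨hμ, hi, he⟩ := hok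
  simp only [eval_add, eval_mul, eval_C, eval_ofNat]
  refine Does.seq (Does.mono (hTi l _ env σ hd hS.rel hμ henv hi) le_rfl ?_)
  rintro τ ⟨h1, h2, h3, h4⟩
  refine Does.seq (Does.mono (hTe l _ env τ hd (hS.rel.same h3 hd.le) hμ henv he) le_rfl ?_)
  rintro υ ⟨h1', h2', h3', h4'⟩
  have h5 : υ.mem (tmp s) = i.eval θ.mem env := (h3'.tmp s (by omega)).trans h4
  have hvi := i.abs_eval_le hμ henv hi
  have hve := e.abs_eval_le hμ henv he
  obtain ⟨k1, k2⟩ := cost_cell a (h5 ▸ hvi)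
  rw [h5] at k1 k2
  have hSame : Same d s σ.mem υ.mem := h3.trans (h3'.mono le_rfl (by omega))
  refine .store ?_ ⟨⟨?_, h1'.trans (h1.trans hS.inp), h2'.trans (h2.trans hS.out)⟩, ?_⟩
  · have b2 := bitLen_le hve
    rw [k1]
    simp only [Expr.eval, Expr.cost, rg, h4']
    omega
  · rw [k1]
    simp only [Expr.eval, rg, h4', run]
    exact (hS.rel.same hSame hd.le).put _ _ _
  · rw [k1]
    exact hSame.keep.trans (.put _ _ _ _ _ _)

lemma read (a : Fin 30) (i : PE) : (Stm.read a i).Compiles := by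
  intro d s
  obtain ⟨Ti, hTi⟩ := i.compiles d s
  refine ⟨Ti + (C (2 * bitLen (tmp s) + 200) + 10 * i.bits + X),
    fun l θ env σ hd hS henv hok => ?_⟩
  obtain ⟨hμ, hi, he⟩ := hok
  simp only [eval_add, eval_mul, eval_C, eval_ofNat, eval_X]
  refine Does.seq (Does.mono (hTi l _ env σ hd hS.rel hμ henv hi) le_rfl ?_)
  rintro τ ⟨h1, h2, h3, h4⟩
  have hvi := i.abs_eval_le hμ henv hi
  obtain ⟨k1, k2⟩ := cost_cell a (h4 ▸ hvi)
  rw [h4] at k1 k2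
  have hinp : τ.inp = θ.inp := h1.trans hS.inp
  refine .read ?_ ⟨⟨?_, ?_, h2.trans hS.out⟩, ?_⟩
  · have b2 := bitLen_le he
    rw [k1, hinp]
    omega
  · rw [k1]
    simp only [hinp, run]
    exact (hS.rel.same h3 hd.le).put _ _ _
  · simp [hinp, run]
  · rw [k1]
    exact h3.keep.trans (.put _ _ _ _ _ _)

lemma write (e : PE) : (Stm.write e).Compiles := by
  intro d s
  obtain ⟨Te, hTe⟩ := e.compiles d s
  refine ⟨Te + (C (2 * bitLen (tmp s) + 20) + 4 * e.bits), fun l θ env σ hd hS henv hok => ?_⟩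
  obtain ⟨hμ, he⟩ := hok
  simp only [eval_add, eval_mul, eval_C, eval_ofNat]
  refine Does.seq (Does.mono (hTe l _ env σ hd hS.rel hμ henv he) le_rfl ?_)
  rintro τ ⟨h1, h2, h3, h4⟩
  have b := bitLen_le (e.abs_eval_le hμ henv he)
  refine .write ?_ ⟨⟨hS.rel.same h3 hd.le, h1.trans hS.inp, ?_⟩, h3.keep⟩
  · simp only [Expr.eval, Expr.cost, rg, h4]
    omega
  · simp [Expr.eval, rg, h4, run, h2, hS.out]

lemma seq {t u : Stm} (ht : t.Compiles) (hu : u.Compiles) : (Stm.seq t u).Compiles := by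
  intro d s
  obtain ⟨T, hT⟩ := ht d s
  obtain ⟨U, hU⟩ := hu d s
  refine ⟨T + U, fun l θ env σ hd hS henv hok => ?_⟩
  rw [eval_add]
  refine Does.seq (Does.mono (hT l θ env σ hd hS henv hok.1) le_rfl ?_)
  rintro τ ⟨h1, h2⟩
  refine Does.mono (hU l _ env τ hd h1 henv hok.2) le_rfl ?_
  rintro υ ⟨h1', h2'⟩
  exact ⟨h1', h2.trans h2'⟩

lemma pos (c : PE) {t u : Stm} (ht : t.Compiles) (hu : u.Compiles) :
    (Stm.pos c t u).Compiles := by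
  intro d s
  obtain ⟨Tc, hTc⟩ := c.compiles d s
  obtain ⟨T, hT⟩ := ht d s
  obtain ⟨U, hU⟩ := hu d s
  refine ⟨Tc + ((C (2 * bitLen (tmp s) + 10) + 2 * c.bits) + (T + U)),
    fun l θ env σ hd hS henv hok => ?_⟩
  obtain ⟨hμ, hc, h5⟩ := hok
  simp only [eval_add]
  refine Does.seq (Does.mono (hTc l _ env σ hd hS.rel hμ henv hc) le_rfl ?_)
  rintro τ ⟨h1, h2, h3, h4⟩
  have hS' : Sim env θ τ := ⟨hS.rel.same h3 hd.le, h1.trans hS.inp, h2.trans hS.out⟩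
  have b1 := bitLen_le (c.abs_eval_le hμ henv hc)
  refine .ite ?_ ?_
  · simp only [Expr.eval, Expr.cost, rg, h4, eval_mul, eval_C, eval_ofNat]
    omega
  · simp only [Expr.eval, rg, h4, run]
    split_ifs at h5 ⊢ with h0
    · refine Does.mono (hT l θ env τ hd hS' henv h5) (by omega) ?_
      rintro υ ⟨h1', h2'⟩
      exact ⟨h1', h3.keep.trans h2'⟩
    · refine Does.mono (hU l θ env τ hd hS' henv h5) (by omega) ?_
      rintro υ ⟨h1', h2'⟩
      exact ⟨h1', h3.keep.trans h2'⟩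

/-- The bound stays in temporary `s`, which the body cannot reach because it works from `s + 1` on.
The counter register is at the same time the newest loop variable of the body. -/
lemma loop (b : PE) {t : Stm} (ht : t.Compiles) : (Stm.loop b t).Compiles := by
  intro d s
  obtain ⟨Tb, hTb⟩ := b.compiles d s
  obtain ⟨T, hT⟩ := ht (d + 1) (s + 1)
  set c0 := bitLen (tmp s) with hc0
  set cv := bitLen (vreg d) with hcv
  have hl0 : bitLen 0 = 1 := by simp [bitLen]
  have hl1 : bitLen 1 = 2 := by simp [bitLen]
  refine ⟨Tb + (C (2 * cv + 4) +
      (X * ((C (2 * c0 + 2 * cv + 20) + 4 * b.bits + 4 * X) + (T + (C (4 * cv + 20) + 4 * X))) +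
        (C (2 * c0 + 2 * cv + 20) + 4 * b.bits + 4 * X))),
      fun l θ env σ hd hS henv hok => ?_⟩
  obtain ⟨hμ, ok1, ok2, ok3⟩ := hok
  have hvb := b.abs_eval_le hμ henv ok1
  have bvb := bitLen_le hvb
  set vb := b.eval θ.mem env with hvbdef
  set qb := b.bits.eval l with hqb
  have hNl : vb.toNat ≤ l := by omega
  have hkk : ∀ k ≤ l + 1, bitLen (k : ℤ) ≤ l + 3 := by
    intro j hj
    apply bitLen_le
    rw [Nat.abs_cast]
    exact_mod_cast hj.trans Nat.lt_two_pow_self.le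
  simp only [eval_add, eval_mul, eval_C, eval_ofNat, eval_X]
  refine (Does.mono (hTb l _ env σ hd hS.rel hμ henv ok1) le_rfl ?_).seq
  rintro τ ⟨h1, h2, h3, h4⟩
  refine Does.seq (.store ?_ ?_)
  · simp only [Expr.eval, Expr.cost, hl0]; omega
  simp only [Expr.eval]
  set E := 2 * c0 + 2 * cv + 20 + 4 * qb + 4 * l with hE
  have hloop := Does.loop (σ := ⟨Function.update τ.mem (vreg d) 0, τ.inp, τ.out⟩)
      (e := .minus (rg (tmp s)) (rg (vreg d)))
      (c := (.seq (t.comp (d + 1) (s + 1))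
          (.store (.lit (vreg d)) (.plus (rg (vreg d)) (.lit 1)))))
      (E := E) (B := T.eval l + (4 * cv + 20 + 4 * l))
      (vb.toNat) (fun k τ' => Sim env (iter (fun k => t.run ((k : ℤ) :: env)) k θ) τ' ∧
        Keep d s σ.mem τ'.mem ∧ τ'.mem (tmp s) = vb ∧ τ'.mem (vreg d) = k) ?_ ?_ ?_
  · refine Does.mono hloop (Nat.add_le_add_right (Nat.mul_le_mul_right _ hNl) _) ?_
    · rintro υ ⟨g1, g2, g3, g4⟩
      exact ⟨g1, g2⟩
  · have hSame := h3.trans (Same.update_vreg (k := d) le_rfl _ 0)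
    refine ⟨⟨hS.rel.same hSame hd.le, h1.trans hS.inp, h2.trans hS.out⟩, hSame.keep, ?_, ?_⟩
    · simp only
      rw [Function.update_of_ne (vreg_ne_tmp _ _).symm, h4]
    · simp
  · rintro k σ' hk ⟨g1, g2, g4, g6⟩
    refine ⟨?_, ?_, ?_⟩
    · simp only [rg, Expr.eval, g4, g6]; omega
    · have e1 := hkk k (by omega)
      have e2 : |vb - k| ≤ 2 ^ qb := by
        rw [abs_of_nonneg (by omega)]
        exact le_trans (by omega) ((le_abs_self vb).trans hvb)
      have e3 := bitLen_le e2
      simp only [rg, Expr.eval, Expr.cost, g4, g6]; omega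
    · have hS' : Sim ((k : ℤ) :: env) (iter (fun k => t.run ((k : ℤ) :: env)) k θ) σ' :=
        ⟨g1.rel.cons (by rw [hd]; exact g6), g1.inp, g1.out⟩
      refine Does.seq ((hT l _ ((k : ℤ) :: env) σ' (by simp [hd]) hS' (henv.cons (by omega))
        (ok3 k (by omega))).mono le_rfl ?_)
      rintro υ ⟨i1, i2⟩
      have j2 : υ.mem (tmp s) = vb := (i2.tmp _ (by omega)).trans g4
      have j3 : υ.mem (vreg d) = k := (i2.var _ (by omega)).trans g6
      -- After the body the newest loop variable leaves the environment. As variables are numbered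
      -- from the outside, the older ones keep their registers.
      have hrel : Rel (iter (fun k => t.run ((k : ℤ) :: env)) (k + 1) θ).mem env υ.mem := by
        refine ⟨i1.rel.arr, fun j hj => ?_⟩
        have := i1.rel.var (j + 1) (by simpa using hj)
        simp only [List.length_cons, List.getD_cons_succ] at this
        rw [← this]
        congr 2
        omega
      refine .store ?_ ⟨⟨?_, i1.inp, i1.out⟩, ?_, ?_, ?_⟩
      · have e1 := hkk k (by omega)
        have e2 := hkk (k + 1) (by omega)
        push_cast at e2
        simp only [rg, Expr.eval, Expr.cost, hl1, j3]
        omega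
      · exact hrel.same (.update_vreg (s := s) (le_refl d) _ _) hd.le
      · exact g2.trans ((i2.mono (by omega) (by omega)).trans
          (Same.update_vreg (s := s) (le_refl d) _ _).keep)
      · simp only [Expr.eval]
        rw [Function.update_of_ne (vreg_ne_tmp _ _).symm, j2]
      · simp only [Expr.eval, rg, Function.update_self]
        rw [j3]; push_cast; rfl
  · rintro σ' ⟨g1, g2, g4, g6⟩
    have e1 := hkk vb.toNat (by omega)
    have e2 : |vb - vb.toNat| ≤ 2 ^ qb := by
      refine le_trans ?_ hvb
      rw [abs_le]
      constructor <;> rcases abs_cases vb with ⟨h, h'⟩ | ⟨h, h'⟩ <;> omega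
    have e3 := bitLen_le e2
    simp only [rg, Expr.eval, Expr.cost, g4, g6]
    constructor <;> omega

end Stm.Compiles

lemma Stm.compiles (t : Stm) : t.Compiles := by
  induction t with
  | set a i e => exact .set a i e
  | read a i => exact .read a i
  | write e => exact .write e
  | seq t u iht ihu => exact .seq iht ihu
  | pos c t u iht ihu => exact .pos c iht ihu
  | loop b t iht => exact .loop b iht

def HState.init (x : List ℤ) : HState := ⟨fun _ _ => 0, x, []⟩

lemma eval_mono (p : ℕ[X]) {a b : ℕ} (h : a ≤ b) : p.eval a ≤ p.eval b := by
  rw [eval_eq_sum, eval_eq_sum, Polynomial.sum, Polynomial.sum]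
  exact Finset.sum_le_sum fun i _ => by gcongr

/-- A structured program with polynomial bounds computes a function in polynomial time. -/
lemma polyTimeComputable_of_stm {α : Type} {β : α → Type} {encIn : α → List ℤ}
    {encOut : ∀ a, β a → List ℤ} {f : ∀ a, β a} (t : Stm) (p : ℕ[X])
    (h : ∀ a, ∃ l ≤ p.eval (tapeSize (encIn a)), t.Ok l [] (.init (encIn a)) ∧
      (t.run [] (.init (encIn a))).out = encOut a (f a)) :
    PolyTimeComputable encIn encOut f := by
  obtain ⟨T, hT⟩ := t.compiles 0 0
  refine ⟨t.comp 0 0, T.comp p, fun a => ?_⟩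
  obtain ⟨l, hl, hok, hout⟩ := h a
  obtain ⟨τ, n, h1, h2, h3, -⟩ := hT l (.init (encIn a)) [] ⟨fun _ => 0, encIn a, []⟩ rfl
    ⟨⟨fun _ _ => rfl, by simp⟩, rfl, rfl⟩ (by simp [EnvLe]) hok
  refine ⟨n, ⟨τ, h1, h3.out.trans hout⟩, h2.trans ?_⟩
  rw [eval_comp]
  exact eval_mono T hl

end Ram

namespace ParamMC

/-! ## The division-free Faddeev–LeVerrier algorithm -/

section FaddeevLeVerrier

/-- `k` rounds of the Faddeev–LeVerrier algorithm for the `m × m` matrix `A`, scaled such that no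
divisions are needed. -/
def fl {R : Type*} [CommRing R] (A : ℕ → ℕ → R) (m : ℕ) : ℕ → (ℕ → ℕ → R) × R
  | 0 => (fun _ _ => 0, 1)
  | k + 1 =>
    let M : ℕ → ℕ → R := fun x y => (k : R) * ∑ l ∈ Finset.range m, A x l * (fl A m k).1 l y +
      if x = y then (fl A m k).2 else 0
    (M, -∑ x ∈ Finset.range m, ∑ l ∈ Finset.range m, A x l * M l x)

/-- Only ring operations occur, so the computation commutes with every ring homomorphism. The same
recursion can therefore be read over `ℤ[X]`, over `ℤ` after substituting the base, and over `ℝ`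
after substituting the parameter. -/
lemma fl_map {R S : Type*} [CommRing R] [CommRing S] (φ : R →+* S) (A : ℕ → ℕ → R) (m k : ℕ) :
    fl (fun x y => φ (A x y)) m k = (fun x y => φ ((fl A m k).1 x y), φ (fl A m k).2) := by
  induction k with
  | zero => simp [fl]
  | succ k ih => simp [fl, ih, apply_ite φ]

variable {K : Type*} [Field K]

/-- Jacobi's formula. It suffices to compare values at the infinitely many `x` that are not
eigenvalues, where the characteristic matrix is invertible and the determinant can be expanded
around `x`. -/
lemma derivative_charpoly [Infinite K] {m : ℕ} (A : Matrix (Fin m) (Fin m) K) :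
    derivative A.charpoly = (A.charmatrix).adjugate.trace := by
  have hmono := A.charpoly_monic
  refine Polynomial.eq_of_infinite_eval_eq _ _ ?_
  refine Set.Infinite.mono (s := {x | A.charpoly.IsRoot x}ᶜ) ?_
    (Polynomial.finite_setOfPred_isRoot hmono.ne_zero).infinite_compl
  intro x hx
  simp only [Set.mem_compl_iff, Set.mem_ofPred_eq, IsRoot.def] at hx ⊢
  set U : Matrix (Fin m) (Fin m) K := Matrix.scalar (Fin m) x - A with hU
  have hdet : U.det = A.charpoly.eval x := by
    rw [Matrix.eval_charpoly]
  have hunit : IsUnit U.det := by rw [hdet]; exact isUnit_iff_ne_zero.2 hx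
  have hcm : (A.charmatrix).map (Polynomial.eval x) = U := by
    ext i j
    by_cases h : i = j <;> simp [Matrix.charmatrix, hU, h]
  have hadj : ((A.charmatrix).adjugate.trace).eval x = U.adjugate.trace := by
    have := (Polynomial.evalRingHom x).map_adjugate A.charmatrix
    simp only [RingHom.mapMatrix_apply, coe_evalRingHom, hcm] at this
    rw [← this]
    simp [Matrix.trace, eval_finsetSum]
  -- With `U` the matrix `x - A`, factor `X + x - A` as `U (1 + X U⁻¹)`. The derivative at `0` of
  -- the determinant is then `det U` times the trace of `U⁻¹`, which is the trace of the adjugate of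
  -- `U`.
  have hcomp : A.charpoly.comp (X + C x) = C U.det * (1 + (X : K[X]) • (U⁻¹).map C).det := by
    have h1 : (U.map C) * (1 + (X : K[X]) • (U⁻¹).map C) =
        (A.charmatrix).map (fun p => p.comp (X + C x)) := by
      rw [mul_add, mul_one, Matrix.mul_smul, ← Matrix.map_mul, Matrix.mul_nonsing_inv _ hunit]
      refine Matrix.ext fun i j => ?_
      rcases eq_or_ne i j with rfl | h
      · simp [Matrix.charmatrix, hU]; ring
      · simp [Matrix.charmatrix, hU, h]
    have h2 := congrArg Matrix.det h1
    rw [Matrix.det_mul] at h2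
    rw [show (U.map C).det = C U.det from (RingHom.map_det C U).symm] at h2
    rw [h2, Matrix.charpoly]
    exact (RingHom.map_det (Polynomial.compRingHom (X + C x)) A.charmatrix)
  have h3 := congrArg (fun p => (derivative p).eval 0) hcomp
  simp only [derivative_comp, derivative_mul, derivative_C, zero_mul, zero_add, eval_mul, eval_C,
    Matrix.derivative_det_one_add_X_smul, eval_comp] at h3
  simp only [derivative_add, derivative_X, derivative_C, add_zero, eval_one, one_mul, eval_add, eval_X,
    eval_C, zero_add] at h3
  rw [h3, hadj, ← smul_eq_mul, ← Matrix.trace_smul, Matrix.inv_def, smul_smul,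
    Ring.mul_inverse_cancel _ hunit, one_smul]

/-- Coefficients of the adjugate of the characteristic matrix. -/
noncomputable def adjCoeff {m : ℕ} (A : Matrix (Fin m) (Fin m) K) (j : ℕ) :
    Matrix (Fin m) (Fin m) K :=
  Matrix.of fun x y => ((A.charmatrix).adjugate x y).coeff j

/-- The identity `(X - A) adj(X - A) = χ`, entry by entry. Comparing coefficients of the powers of
`X` yields the recursion for the coefficient matrices of the adjugate. -/
lemma charmatrix_mul_coeff {m : ℕ} (A : Matrix (Fin m) (Fin m) K) (x y : Fin m) :
    X * (A.charmatrix).adjugate x y - ∑ l, C (A x l) * (A.charmatrix).adjugate l y =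
      if x = y then A.charpoly else 0 := by
  have h := congrFun (congrFun (Matrix.mul_adjugate A.charmatrix) x) y
  rw [Matrix.mul_apply] at h
  simp only [Matrix.charmatrix, Matrix.sub_apply, sub_mul, Finset.sum_sub_distrib] at h
  simpa [Matrix.diagonal_apply, Matrix.one_apply, Matrix.charpoly, Matrix.charmatrix] using h

lemma adjCoeff_succ {m : ℕ} (A : Matrix (Fin m) (Fin m) K) (j : ℕ) :
    adjCoeff A j = A * adjCoeff A (j + 1) + A.charpoly.coeff (j + 1) • (1 : Matrix _ _ K) := by
  ext x y
  have h := congrArg (fun p => p.coeff (j + 1)) (charmatrix_mul_coeff A x y)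
  simp only [coeff_sub, coeff_X_mul, finsetSum_coeff, coeff_C_mul] at h
  simp only [adjCoeff, Matrix.of_apply, Matrix.add_apply, Matrix.mul_apply, Matrix.smul_apply,
    Matrix.one_apply, smul_eq_mul]
  rw [sub_eq_iff_eq_add.1 h, add_comm]
  split_ifs <;> simp

lemma mul_adjCoeff_zero {m : ℕ} (A : Matrix (Fin m) (Fin m) K) :
    A * adjCoeff A 0 + A.charpoly.coeff 0 • (1 : Matrix _ _ K) = 0 := by
  ext x y
  have h := congrArg (fun p => p.coeff 0) (charmatrix_mul_coeff A x y)
  simp only [coeff_sub, coeff_X_mul_zero, finsetSum_coeff, coeff_C_mul] at h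
  simp only [adjCoeff, Matrix.of_apply, Matrix.add_apply, Matrix.mul_apply, Matrix.smul_apply,
    Matrix.one_apply, smul_eq_mul, Matrix.zero_apply]
  split_ifs at h ⊢ with hxy
  · linear_combination -h
  · rw [coeff_zero] at h; linear_combination -h

/-- Descend from an index beyond all degrees of the entries: for indices from `m` on, the recursion
adds only coefficients of the characteristic polynomial beyond its degree, so every step gives zero.
-/
lemma adjCoeff_eq_zero {m : ℕ} (A : Matrix (Fin m) (Fin m) K) {j : ℕ} (hj : m ≤ j) :
    adjCoeff A j = 0 := by
  obtain ⟨N, hN⟩ : ∃ N, ∀ i ≥ N, adjCoeff A i = 0 := by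
    refine ⟨(∑ x, ∑ y, ((A.charmatrix).adjugate x y).natDegree) + 1, fun i hi => ?_⟩
    ext x y
    refine coeff_eq_zero_of_natDegree_lt (p := A.charmatrix.adjugate x y) ?_
    have h1 : ((A.charmatrix).adjugate x y).natDegree ≤
        ∑ y, ((A.charmatrix).adjugate x y).natDegree :=
      Finset.single_le_sum (f := fun y => ((A.charmatrix).adjugate x y).natDegree)
        (fun _ _ => Nat.zero_le _) (Finset.mem_univ y)
    have h2 : (∑ y, ((A.charmatrix).adjugate x y).natDegree) ≤
        ∑ x, ∑ y, ((A.charmatrix).adjugate x y).natDegree :=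
      Finset.single_le_sum (f := fun x => ∑ y, ((A.charmatrix).adjugate x y).natDegree)
        (fun _ _ => Nat.zero_le _) (Finset.mem_univ x)
    omega
  have key : ∀ r i, m ≤ i → N ≤ i + r → adjCoeff A i = 0 := by
    intro r
    induction r with
    | zero => exact fun i _ hi => hN i hi
    | succ r ih =>
      intro i hi hir
      rw [adjCoeff_succ, ih (i + 1) (by omega) (by omega), coeff_eq_zero_of_natDegree_lt]
      · simp
      · rw [Matrix.charpoly_natDegree_eq_dim, Fintype.card_fin]; omega
  exact key N j hj (by omega)

lemma trace_adjCoeff [Infinite K] {m : ℕ} (A : Matrix (Fin m) (Fin m) K) (j : ℕ) :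
    (adjCoeff A j).trace = (j + 1) * A.charpoly.coeff (j + 1) := by
  have h := congrArg (fun p => p.coeff j) (derivative_charpoly A)
  simp only [coeff_derivative, Matrix.trace, finsetSum_coeff, Matrix.diag_apply] at h
  simp only [Matrix.trace, Matrix.diag_apply, adjCoeff, Matrix.of_apply]
  rw [← h, mul_comm]

/-- The classical recursion divides the trace by `k` in round `k`. Here the divisors are collected
in factorials: the scalar carries the factor `k!` and, for `k ≥ 1`, the matrix carries `(k - 1)!`.
The matrix statement is multiplied by `k` so that it also covers the zero matrix at the start. -/
lemma fl_eq [CharZero K] (A : ℕ → ℕ → K) (m : ℕ) :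
    let B : Matrix (Fin m) (Fin m) K := Matrix.of fun x y => A x y
    ∀ k ≤ m, (fl A m k).2 = (k.factorial : K) * B.charpoly.coeff (m - k) ∧
      ∀ x y : Fin m, (k : K) * (fl A m k).1 x y = (k.factorial : K) * adjCoeff B (m - k) x y := by
  intro B k
  induction k with
  | zero =>
    intro _
    refine ⟨?_, fun x y => ?_⟩
    · have := B.charpoly_monic
      rw [Monic, leadingCoeff, Matrix.charpoly_natDegree_eq_dim, Fintype.card_fin] at this
      simp [fl, this]
    · rw [Nat.sub_zero, adjCoeff_eq_zero B le_rfl]; simp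
  | succ k ih =>
    intro hk
    obtain ⟨h1, h2⟩ := ih (by omega)
    obtain ⟨j, hj⟩ : ∃ j, m = j + (k + 1) := ⟨m - (k + 1), by omega⟩
    have e1 : m - k = j + 1 := by omega
    have e2 : m - (k + 1) = j := by omega
    rw [e1] at h1 h2
    rw [e2]
    have hM : ∀ x y : Fin m, (fl A m (k + 1)).1 x y = (k.factorial : K) * adjCoeff B j x y := by
      intro x y
      have h3 : (k : K) * ∑ l ∈ Finset.range m, A x l * (fl A m k).1 l y =
          (k.factorial : K) * (B * adjCoeff B (j + 1)) x y := by
        rw [Finset.sum_range, Matrix.mul_apply, Finset.mul_sum, Finset.mul_sum]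
        refine Finset.sum_congr rfl fun l _ => ?_
        simp only [B, Matrix.of_apply]
        linear_combination A x l * h2 l y
      simp only [fl]
      rw [h3, h1, adjCoeff_succ B j, Matrix.add_apply, mul_add]
      congr 1
      simp only [Matrix.smul_apply, Matrix.one_apply, smul_eq_mul, Fin.val_inj]
      split_ifs <;> simp
    refine ⟨?_, fun x y => ?_⟩
    · have h4 : (fl A m (k + 1)).2 =
          -∑ x ∈ Finset.range m, ∑ l ∈ Finset.range m, A x l * (fl A m (k + 1)).1 l x := rfl
      -- For positive `j`, take traces in the recursion for the coefficient of index `j - 1`: its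
      -- trace is `j` times the `j`-th coefficient of the characteristic polynomial, and the
      -- identity matrix contributes `m` times that coefficient. The difference `j - m` equals `-(k
      -- + 1)`. For `j = 0`, the relation that ends the recursion is used.
      have h5 : (B * adjCoeff B j).trace = -((k + 1 : ℕ) : K) * B.charpoly.coeff j := by
        have h7 : (m : K) = (j : K) + 1 + k := by rw [hj]; push_cast; ring
        rcases j with _ | j
        · rw [eq_neg_of_add_eq_zero_left (mul_adjCoeff_zero B), Matrix.trace_neg,
            Matrix.trace_smul, Matrix.trace_one, Fintype.card_fin, smul_eq_mul, h7]
          push_cast; ring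
        · have h6 := congrArg Matrix.trace (adjCoeff_succ B j)
          rw [trace_adjCoeff, Matrix.trace_add, Matrix.trace_smul, Matrix.trace_one,
            Fintype.card_fin, smul_eq_mul] at h6
          rw [h7] at h6
          push_cast at h6 ⊢
          linear_combination -h6
      rw [h4, Finset.sum_range]
      have h8 : ∑ x : Fin m, ∑ l ∈ Finset.range m, A x l * (fl A m (k + 1)).1 l x =
          (k.factorial : K) * (B * adjCoeff B j).trace := by
        simp only [Matrix.trace, Matrix.diag_apply, Matrix.mul_apply, Finset.mul_sum]
        refine Finset.sum_congr rfl fun x _ => ?_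
        rw [Finset.sum_range]
        refine Finset.sum_congr rfl fun l _ => ?_
        rw [hM]
        simp only [B, Matrix.of_apply]
        ring
      rw [h8, h5, Nat.factorial_succ]
      push_cast; ring
    · rw [hM, Nat.factorial_succ]
      push_cast; ring

/-- The algorithm solves linear systems with invertible matrix. -/
theorem fl_solve [CharZero K] (A : ℕ → ℕ → K) (m : ℕ)
    (hA : ∀ x : ℕ → K, (∀ i < m, ∑ j ∈ Finset.range m, A i j * x j = 0) → ∀ j < m, x j = 0) :
    (fl A m m).2 ≠ 0 ∧ ∀ b : ℕ → K, ∀ i < m,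
      ∑ j ∈ Finset.range m, A i j * ((m : K) * ∑ l ∈ Finset.range m, (fl A m m).1 j l * b l) =
        -(fl A m m).2 * b i := by
  set B : Matrix (Fin m) (Fin m) K := Matrix.of fun x y => A x y with hB
  obtain ⟨h1, h2⟩ := fl_eq A m m le_rfl
  rw [← hB, Nat.sub_self] at h1 h2
  constructor
  · rw [h1]
    have hdet : B.det ≠ 0 := by
      intro h0
      obtain ⟨v, hv, hv0⟩ := Matrix.exists_mulVec_eq_zero_iff.2 h0
      refine hv (funext fun j => ?_)
      have := hA (fun j => if h : j < m then v ⟨j, h⟩ else 0) (fun i hi => ?_) j j.isLt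
      · simpa using this
      · have := congrFun hv0 ⟨i, hi⟩
        rw [Finset.sum_range]
        simpa [Matrix.mulVec, dotProduct, hB] using this
    rw [Matrix.det_eq_sign_charpoly_coeff] at hdet
    exact mul_ne_zero (by exact_mod_cast m.factorial_ne_zero) (right_ne_zero_of_mul hdet)
  · intro b i hi
    -- The factor `m` completes the `(m - 1)!` of the last matrix to the `m!` carried by the
    -- determinant.
    have h3 : ∀ j : Fin m, (m : K) * ∑ l ∈ Finset.range m, (fl A m m).1 j l * b l =
        (m.factorial : K) * ∑ l : Fin m, adjCoeff B 0 j l * b l := by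
      intro j
      rw [Finset.sum_range, Finset.mul_sum, Finset.mul_sum]
      exact Finset.sum_congr rfl fun l _ => by linear_combination b l * h2 j l
    rw [Finset.sum_range]
    simp only [h3, h1]
    have h4 := congrArg (fun M : Matrix (Fin m) (Fin m) K => (M.mulVec fun l => b l) ⟨i, hi⟩)
      (mul_adjCoeff_zero B)
    simp only [Matrix.add_mulVec, Matrix.smul_mulVec, Matrix.one_mulVec, Pi.add_apply,
      Pi.smul_apply, smul_eq_mul, Matrix.zero_mulVec, Pi.zero_apply, ← Matrix.mulVec_mulVec] at h4
    have h5 : ((B.mulVec ((adjCoeff B 0).mulVec fun l : Fin m => b l)) ⟨i, hi⟩) =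
        ∑ j : Fin m, A i j * ∑ l : Fin m, adjCoeff B 0 j l * b l := by
      simp [Matrix.mulVec, dotProduct, hB]
    rw [h5] at h4
    have h6 : ∑ j : Fin m, A i j * ((m.factorial : K) * ∑ l : Fin m, adjCoeff B 0 j l * b l) =
        (m.factorial : K) * ∑ j : Fin m, A i j * ∑ l : Fin m, adjCoeff B 0 j l * b l := by
      rw [Finset.mul_sum]
      exact Finset.sum_congr rfl fun j _ => by ring
    rw [h6]
    linear_combination (m.factorial : K) * h4

end FaddeevLeVerrier

/-! ## Sizes of integer polynomials -/

/-- A subadditive and submultiplicative size function. -/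
structure IsSize {R : Type*} [CommRing R] (ν : R → ℕ) : Prop where
  zero : ν 0 = 0
  one : ν 1 ≤ 1
  neg : ∀ a, ν (-a) = ν a
  add : ∀ a b, ν (a + b) ≤ ν a + ν b
  mul : ∀ a b, ν (a * b) ≤ ν a * ν b

namespace IsSize

variable {R : Type*} [CommRing R] {ν : R → ℕ} (h : IsSize ν)
include h

lemma sum {α : Type*} (s : Finset α) (f : α → R) : ν (∑ i ∈ s, f i) ≤ ∑ i ∈ s, ν (f i) := by
  classical
  induction s using Finset.induction_on with
  | empty => simp [h.zero]
  | insert a s ha ih =>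
    rw [Finset.sum_insert ha, Finset.sum_insert ha]
    exact (h.add _ _).trans (by omega)

lemma prod {α : Type*} (s : Finset α) (f : α → R) : ν (∏ i ∈ s, f i) ≤ ∏ i ∈ s, ν (f i) := by
  classical
  induction s using Finset.induction_on with
  | empty => simpa using h.one
  | insert a s ha ih =>
    rw [Finset.prod_insert ha, Finset.prod_insert ha]
    exact (h.mul _ _).trans (Nat.mul_le_mul_left _ ih)

lemma natCast (n : ℕ) : ν (n : R) ≤ n := by
  induction n with
  | zero => simp [h.zero]
  | succ n ih =>
    rw [Nat.cast_succ]
    exact (h.add _ _).trans (Nat.add_le_add ih h.one)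

lemma intCast (z : ℤ) : ν (z : R) ≤ z.natAbs := by
  obtain ⟨n, rfl | rfl⟩ := z.eq_nat_or_neg
  · simpa using h.natCast n
  · simpa [h.neg] using h.natCast n

lemma sum_range_le {n b : ℕ} {f : ℕ → R} (hf : ∀ i < n, ν (f i) ≤ b) :
    ν (∑ i ∈ Finset.range n, f i) ≤ n * b := by
  refine (h.sum _ _).trans ?_
  refine (Finset.sum_le_card_nsmul _ _ b fun i hi => hf i (Finset.mem_range.1 hi)).trans ?_
  simp

lemma prod_range_le {n b : ℕ} {f : ℕ → R} (hf : ∀ i < n, ν (f i) ≤ b) :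
    ν (∏ i ∈ Finset.range n, f i) ≤ b ^ n := by
  refine (h.prod _ _).trans ?_
  refine (Finset.prod_le_pow_card _ _ b fun i hi => hf i (Finset.mem_range.1 hi)).trans ?_
  simp

/-- A round multiplies the bound by `2 * m ^ 2 * c`: a factor `m` for the round number, `m` for the
number of summands, `c` for the entries, and `2` for the added diagonal. The scalar costs one more
double sum. Over all rounds the number of bits is thus polynomial in `m` and the bit length of `c`.
-/
lemma fl_le {A : ℕ → ℕ → R} {m c : ℕ} (hm : 1 ≤ m) (hc : 1 ≤ c)
    (hA : ∀ x < m, ∀ y < m, ν (A x y) ≤ c) : ∀ k ≤ m,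
    (∀ x < m, ∀ y < m, ν ((fl A m k).1 x y) ≤ (2 * m ^ 2 * c) ^ k) ∧
      ν (fl A m k).2 ≤ m ^ 2 * c * (2 * m ^ 2 * c) ^ k := by
  intro k
  induction k with
  | zero =>
    intro _
    refine ⟨fun x _ y _ => by simp [fl, h.zero], ?_⟩
    have : 1 ≤ m ^ 2 * c := Nat.one_le_iff_ne_zero.2 (by positivity)
    simpa [fl] using h.one.trans this
  | succ k ih =>
    intro hk
    obtain ⟨h1, h2⟩ := ih (by omega)
    set L := (2 * m ^ 2 * c) ^ k with hL
    have hM : ∀ x < m, ∀ y < m, ν ((fl A m (k + 1)).1 x y) ≤ (2 * m ^ 2 * c) ^ (k + 1) := by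
      intro x hx y hy
      simp only [fl]
      have e1 : ν (if x = y then (fl A m k).2 else 0) ≤ m ^ 2 * c * L := by
        split_ifs
        · exact h2
        · simp [h.zero]
      have e2 : ν (∑ l ∈ Finset.range m, A x l * (fl A m k).1 l y) ≤ m * (c * L) :=
        h.sum_range_le fun l hl => (h.mul _ _).trans (Nat.mul_le_mul (hA x hx l hl) (h1 l hl y hy))
      have e3 := h.natCast k
      calc _ ≤ k * (m * (c * L)) + m ^ 2 * c * L :=
            (h.add _ _).trans (Nat.add_le_add ((h.mul _ _).trans (Nat.mul_le_mul e3 e2)) e1)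
        _ ≤ m * (m * (c * L)) + m ^ 2 * c * L := by gcongr; omega
        _ = _ := by rw [pow_succ (2 * m ^ 2 * c) k, ← hL]; ring
    refine ⟨hM, ?_⟩
    have h4 : (fl A m (k + 1)).2 =
        -∑ x ∈ Finset.range m, ∑ l ∈ Finset.range m, A x l * (fl A m (k + 1)).1 l x := rfl
    rw [h4, h.neg]
    refine (h.sum_range_le fun x hx => h.sum_range_le (b := c * (2 * m ^ 2 * c) ^ (k + 1))
      fun l hl => (h.mul _ _).trans (Nat.mul_le_mul (hA x hx l hl) (hM l hl x hx))).trans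
      (le_of_eq (by ring))

end IsSize

lemma isSize_natAbs : IsSize Int.natAbs :=
  ⟨rfl, le_rfl, Int.natAbs_neg, Int.natAbs_add_le, fun a b => (Int.natAbs_mul a b).le⟩

/-- Weighted sum of the absolute values of the coefficients. -/
noncomputable def nu (p : ℤ[X]) : ℕ := p.sum fun i c => c.natAbs * 2 ^ i

lemma nu_eq (p : ℤ[X]) {N : ℕ} (hN : p.natDegree < N) :
    nu p = ∑ i ∈ Finset.range N, (p.coeff i).natAbs * 2 ^ i :=
  Polynomial.sum_over_range' p (by simp) N hN

lemma nu_monomial (i : ℕ) (c : ℤ) : nu (monomial i c) = c.natAbs * 2 ^ i :=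
  Polynomial.sum_monomial_index _ _ (by simp)

lemma nu_add_le (p q : ℤ[X]) : nu (p + q) ≤ nu p + nu q := by
  set N := max (p + q).natDegree (max p.natDegree q.natDegree) + 1
  rw [nu_eq (p + q) (N := N) (by omega), nu_eq p (N := N) (by omega), nu_eq q (N := N) (by omega),
    ← Finset.sum_add_distrib]
  refine Finset.sum_le_sum fun i _ => ?_
  rw [coeff_add, ← add_mul]
  exact Nat.mul_le_mul_right _ (Int.natAbs_add_le _ _)

lemma nu_sum_le {α : Type*} (s : Finset α) (f : α → ℤ[X]) :
    nu (∑ i ∈ s, f i) ≤ ∑ i ∈ s, nu (f i) := by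
  classical
  induction s using Finset.induction_on with
  | empty => simp [nu]
  | insert a s ha ih =>
    rw [Finset.sum_insert ha, Finset.sum_insert ha]
    exact (nu_add_le _ _).trans (by omega)

/-- The size is the value at `2` of the polynomial with absolute values as coefficients, hence
submultiplicative. Evaluating at `2` rather than at `1` makes it bound the degree as well as the
coefficients. -/
lemma isSize_nu : IsSize nu where
  zero := by simp [nu]
  one := by simpa using (nu_monomial 0 1).le
  neg p := by
    rw [nu_eq (-p) (N := p.natDegree + 1) (by simp), nu_eq p (N := p.natDegree + 1) (by omega)]
    simp
  add := nu_add_le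
  mul p q := by
    have h1 : ∀ i c, nu (monomial i c * q) ≤ (c.natAbs * 2 ^ i) * nu q := by
      intro i c
      conv_lhs => rw [q.as_sum_range_C_mul_X_pow, Finset.mul_sum]
      refine (nu_sum_le _ _).trans ?_
      rw [nu_eq q (Nat.lt_succ_self _), Finset.mul_sum]
      refine Finset.sum_le_sum fun j _ => le_of_eq ?_
      rw [C_mul_X_pow_eq_monomial, monomial_mul_monomial, nu_monomial, Int.natAbs_mul]
      ring
    calc nu (p * q) = nu (∑ i ∈ Finset.range (p.natDegree + 1), monomial i (p.coeff i) * q) := by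
          rw [← Finset.sum_mul]
          congr 2
          conv_lhs => rw [p.as_sum_range]
      _ ≤ ∑ i ∈ Finset.range (p.natDegree + 1), ((p.coeff i).natAbs * 2 ^ i) * nu q :=
          (nu_sum_le _ _).trans (Finset.sum_le_sum fun i _ => h1 i _)
      _ = nu p * nu q := by rw [← Finset.sum_mul, nu_eq p (Nat.lt_succ_self _)]

lemma natAbs_coeff_le_nu (p : ℤ[X]) (i : ℕ) : (p.coeff i).natAbs * 2 ^ i ≤ nu p := by
  rw [nu_eq p (N := p.natDegree + i + 1) (by omega)]
  exact Finset.single_le_sum (f := fun i => (p.coeff i).natAbs * 2 ^ i)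
    (fun _ _ => Nat.zero_le _) (Finset.mem_range.2 (by omega))

/-! ## Reading off the coefficients from one value -/

section Decode

variable {p : ℤ[X]} {B : ℤ} (hB : ((2 * nu p + 1 : ℕ) : ℤ) ≤ B)

lemma coeff_iterate_divX (p : ℤ[X]) (k i : ℕ) : (divX^[k] p).coeff i = p.coeff (i + k) := by
  induction k generalizing i with
  | zero => rfl
  | succ k ih => rw [Function.iterate_succ_apply', coeff_divX, ih]; congr 1; omega

/-- One Horner step. Conversely, two consecutive quotients determine the coefficient between them,
which is how the output is produced. -/
lemma eval_iterate_divX (p : ℤ[X]) (B : ℤ) (k : ℕ) :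
    (divX^[k] p).eval B = B * (divX^[k + 1] p).eval B + p.coeff k := by
  conv_lhs => rw [← divX_mul_X_add (divX^[k] p)]
  rw [Function.iterate_succ_apply', eval_add, eval_mul, eval_X, eval_C, coeff_iterate_divX]
  simp [mul_comm]

include hB

/-- The coefficients are balanced digits in base `B`: each is less than `B / 2` in absolute value,
so they can be recovered from the value at `B`. -/
lemma two_mul_coeff_lt (k : ℕ) : 2 * |p.coeff k| + 1 ≤ B := by
  have h1 := natAbs_coeff_le_nu p k
  have h2 : (p.coeff k).natAbs ≤ nu p :=
    (Nat.le_mul_of_pos_right _ (by positivity)).trans h1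
  rw [← Int.natCast_natAbs]
  push_cast at hB
  omega

/-- The quotient of the value by a power of the base, rounded. -/
lemma rounded_quotient (k : ℕ) :
    (2 * p.eval B + B ^ k) / (2 * B ^ k) = (divX^[k] p).eval B := by
  have hB1 : 0 < B := by have := two_mul_coeff_lt hB 0; have := abs_nonneg (p.coeff 0); omega
  -- The digits below position `k` contribute less than half of `B ^ k` in absolute value, so
  -- rounding to the nearest integer removes exactly their contribution.
  have key : |2 * (p.eval B - B ^ k * (divX^[k] p).eval B)| < B ^ k := by
    induction k with
    | zero => simp
    | succ k ih =>
      have h1 := two_mul_coeff_lt hB k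
      have h2 := eval_iterate_divX p B k
      have h3 : 2 * (p.eval B - B ^ (k + 1) * (divX^[k + 1] p).eval B) =
          2 * (p.eval B - B ^ k * (divX^[k] p).eval B) + 2 * p.coeff k * B ^ k := by
        rw [h2]; ring
      rw [h3]
      refine (abs_add_le _ _).trans_lt ?_
      have h4 : |2 * p.coeff k * B ^ k| = 2 * |p.coeff k| * B ^ k := by
        rw [abs_mul, abs_mul, abs_of_pos (pow_pos hB1 k)]; simp
      rw [h4, pow_succ]
      have := pow_pos hB1 k
      nlinarith
  have hpos := pow_pos hB1 k
  rw [abs_lt] at key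
  rw [Int.ediv_eq_iff_of_pos (by positivity)]
  constructor <;> nlinarith

/-- If a quotient vanishes, then `B` divides the next digit, which is smaller than `B` in absolute
value and hence zero; the following quotient then vanishes too. -/
lemma quotient_eq_zero_iff (k : ℕ) :
    (divX^[k] p).eval B = 0 ↔ ∀ j, k ≤ j → p.coeff j = 0 := by
  constructor
  · intro h
    have step : ∀ k, (divX^[k] p).eval B = 0 → p.coeff k = 0 ∧ (divX^[k + 1] p).eval B = 0 := by
      intro k hk
      have h1 := two_mul_coeff_lt hB k
      have h2 := eval_iterate_divX p B k
      rw [hk] at h2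
      have h3 : p.coeff k = 0 := by
        refine Int.eq_zero_of_abs_lt_dvd (m := B) ⟨-(divX^[k + 1] p).eval B, by linarith⟩ ?_
        have := abs_nonneg (p.coeff k)
        omega
      refine ⟨h3, ?_⟩
      rw [h3, add_zero] at h2
      have hB1 : B ≠ 0 := by have := abs_nonneg (p.coeff k); omega
      exact (mul_eq_zero.1 h2.symm).resolve_left hB1
    have all : ∀ i, (divX^[k + i] p).eval B = 0 := by
      intro i
      induction i with
      | zero => exact h
      | succ i ih => exact (step _ ih).2
    intro j hj
    obtain ⟨i, rfl⟩ := Nat.exists_eq_add_of_le hj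
    exact (step _ (all i)).1
  · intro h
    have : divX^[k] p = 0 := by
      ext i
      rw [coeff_iterate_divX, coeff_zero]
      exact h _ (by omega)
    simp [this]

lemma eval_eq_zero_iff_of_small : p.eval B = 0 ↔ p = 0 := by
  have := quotient_eq_zero_iff hB 0
  simp only [Function.iterate_zero, id] at this
  rw [this]
  exact ⟨fun h => by ext i; simpa using h i (Nat.zero_le _), fun h => by simp [h]⟩

/-- The degree is the number of nonzero quotients after the initial one. Since `nu p` bounds `2 ^
natDegree`, testing `K` of them suffices. The test squares the quotient because programs can only
ask whether a number is positive. -/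
lemma natDegree_eq_sum {K : ℕ} (hK : nu p < 2 ^ K) :
    (p.natDegree : ℤ) = ∑ k ∈ Finset.range K,
      if 0 < (divX^[k + 1] p).eval B * (divX^[k + 1] p).eval B then 1 else 0 := by
  have hle : p.natDegree ≤ K := by
    rcases eq_or_ne p 0 with rfl | hp
    · simp
    have h1 := natAbs_coeff_le_nu p p.natDegree
    have h2 : 1 ≤ (p.coeff p.natDegree).natAbs := by
      rw [Nat.one_le_iff_ne_zero, Int.natAbs_ne_zero]
      exact leadingCoeff_ne_zero.2 hp
    have h3 : 2 ^ p.natDegree < 2 ^ K :=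
      lt_of_le_of_lt ((Nat.le_mul_of_pos_left _ h2).trans h1) hK
    exact ((Nat.pow_lt_pow_iff_right (by norm_num)).1 h3).le
  have hiff : ∀ k, (0 < (divX^[k + 1] p).eval B * (divX^[k + 1] p).eval B) ↔ k < p.natDegree := by
    intro k
    rw [mul_self_pos, Ne, quotient_eq_zero_iff hB, ← not_le, not_iff_not]
    constructor
    · intro h
      by_contra! hlt
      have h0 := h p.natDegree (by omega)
      have : p = 0 := leadingCoeff_eq_zero.1 h0
      simp [this] at hlt
    · intro h j hj
      exact coeff_eq_zero_of_natDegree_lt (by omega)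
  simp only [hiff]
  rw [Finset.sum_ite, Finset.sum_const_zero, add_zero, Finset.sum_const, nsmul_eq_mul, mul_one]
  congr 1
  have : (Finset.range K).filter (· < p.natDegree) = Finset.range p.natDegree := by
    ext i; simp; omega
  rw [this, Finset.card_range]

end Decode

end ParamMC

namespace ParamMC

open Filter Topology

/-! ## Stochastic matrices -/

/-- Row-stochastic matrices. -/
structure IsStoch {n : ℕ} (P : Matrix (Fin n) (Fin n) ℝ) : Prop where
  nonneg : ∀ s t, 0 ≤ P s t
  sum : ∀ s, ∑ t, P s t = 1

lemma IsStoch.abs_mulVec_le {n : ℕ} {P : Matrix (Fin n) (Fin n) ℝ} (hP : IsStoch P)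
    {f : Fin n → ℝ} {c : ℝ} (hf : ∀ s, |f s| ≤ c) (s : Fin n) : |P.mulVec f s| ≤ c := by
  calc |∑ t, P s t * f t| ≤ ∑ t, |P s t * f t| := Finset.abs_sum_le_sum_abs _ _
    _ ≤ ∑ t, P s t * c := by
        refine Finset.sum_le_sum fun t _ => ?_
        rw [abs_mul, abs_of_nonneg (hP.nonneg s t)]
        exact mul_le_mul_of_nonneg_left (hf t) (hP.nonneg s t)
    _ = c := by rw [← Finset.sum_mul, hP.sum, one_mul]

lemma exists_abs_le {n : ℕ} (f : Fin n → ℝ) : ∃ c, ∀ s, |f s| ≤ c :=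
  ⟨∑ t, |f t|, fun s => Finset.single_le_sum (f := fun t => |f t|)
    (fun _ _ => abs_nonneg _) (Finset.mem_univ s)⟩

lemma IsStoch.abs_pow_mulVec_le {n : ℕ} {P : Matrix (Fin n) (Fin n) ℝ} (hP : IsStoch P)
    {f : Fin n → ℝ} {c : ℝ} (hf : ∀ s, |f s| ≤ c) (m : ℕ) (s : Fin n) :
    |(P ^ m).mulVec f s| ≤ c := by
  induction m generalizing s with
  | zero => simpa using hf s
  | succ m ih =>
    rw [pow_succ', ← Matrix.mulVec_mulVec]
    exact hP.abs_mulVec_le ih s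

lemma pow_mulVec_of_mulVec_eq {n : ℕ} {P : Matrix (Fin n) (Fin n) ℝ} {g : Fin n → ℝ}
    (hg : P.mulVec g = g) (m : ℕ) : (P ^ m).mulVec g = g := by
  induction m with
  | zero => simp
  | succ m ih => rw [pow_succ, ← Matrix.mulVec_mulVec, hg, ih]

/-- Telescoping sum for a solution of the Poisson equation. -/
lemma sum_pow_mulVec {n : ℕ} {P : Matrix (Fin n) (Fin n) ℝ} {w g h : Fin n → ℝ}
    (hg : P.mulVec g = g) (hw : w = g + (h - P.mulVec h)) (m : ℕ) (s : Fin n) :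
    ∑ i ∈ Finset.range m, (P ^ i).mulVec w s = m * g s + (h s - (P ^ m).mulVec h s) := by
  induction m with
  | zero => simp
  | succ m ih =>
    have h1 : (P ^ m).mulVec w = g + ((P ^ m).mulVec h - (P ^ (m + 1)).mulVec h) := by
      rw [hw, Matrix.mulVec_add, Matrix.mulVec_sub, pow_mulVec_of_mulVec_eq hg, pow_succ,
        Matrix.mulVec_mulVec]
    rw [Finset.sum_range_succ, ih, h1]
    simp only [Pi.add_apply, Pi.sub_apply]
    push_cast; ring

/-- The telescoped sum differs from `m g` by `h - P ^ m h`, which is bounded because `P` is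
stochastic. In particular the weights determine the gain. -/
lemma tendsto_average {n : ℕ} {P : Matrix (Fin n) (Fin n) ℝ} (hP : IsStoch P) {w g h : Fin n → ℝ}
    (hg : P.mulVec g = g) (hw : w = g + (h - P.mulVec h)) (s : Fin n) :
    Tendsto (fun m : ℕ => (m : ℝ)⁻¹ * ∑ i ∈ Finset.range m, (P ^ i).mulVec w s) atTop
      (𝓝 (g s)) := by
  obtain ⟨c, hc⟩ := exists_abs_le h
  have h1 : Tendsto (fun m : ℕ => (m : ℝ)⁻¹ * (h s - (P ^ m).mulVec h s)) atTop (𝓝 0) := by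
    refine squeeze_zero_norm (a := fun m : ℕ => (m : ℝ)⁻¹ * (c + c)) (fun m => ?_) ?_
    · rw [norm_mul, Real.norm_eq_abs, Real.norm_eq_abs, abs_of_nonneg (by positivity)]
      refine mul_le_mul_of_nonneg_left ?_ (by positivity)
      exact (abs_sub _ _).trans (add_le_add (hc s) (hP.abs_pow_mulVec_le hc m s))
    · simpa using tendsto_inv_atTop_nhds_zero_nat.mul_const (c + c)
  have h2 : Tendsto (fun m : ℕ => g s + (m : ℝ)⁻¹ * (h s - (P ^ m).mulVec h s)) atTop
      (𝓝 (g s)) := by simpa using h1.const_add (g s)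
  refine h2.congr' ?_
  filter_upwards [eventually_gt_atTop 0] with m hm
  rw [sum_pow_mulVec hg hw, mul_add]
  field_simp

namespace MarkovChain

variable {n : ℕ} (C : MarkovChain n)

/-- Transition matrix of the stuttering extension. -/
noncomputable def trans : Matrix (Fin n) (Fin n) ℝ := Matrix.of C.stepProb

lemma isStoch_trans : IsStoch C.trans := ⟨C.stepProb_nonneg, C.sum_stepProb⟩

instance (s : Fin n) : IsProbabilityMeasure (C.pathMeasure s) := by
  unfold pathMeasure; infer_instance

lemma integral_stepMeasure (f : Fin n → ℝ) (s : Fin n) :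
    ∫ t, f t ∂(C.stepMeasure s) = C.trans.mulVec f s := by
  rw [stepMeasure, integral_finsetSum_measure (fun t _ => Integrable.of_finite.smul_measure ENNReal.ofReal_ne_top)]
  refine Finset.sum_congr rfl fun t _ => ?_
  rw [integral_smul_measure, integral_dirac, ENNReal.toReal_ofReal (C.stepProb_nonneg s t)]
  rfl

/-- The natural filtration of the path space. -/
abbrev paths (n : ℕ) : Filtration ℕ (inferInstance : MeasurableSpace (ℕ → Fin n)) :=
  Filtration.piLE (X := fun _ : ℕ => Fin n)

lemma measurable_coord {m k : ℕ} (hk : k ≤ m) :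
    Measurable[paths n m] (fun ω : ℕ → Fin n => ω k) := by
  rw [paths, Filtration.piLE_eq_comap_frestrictLe]
  have : (fun ω : ℕ → Fin n => ω k) = (fun x : (Finset.Iic m → Fin n) =>
      x ⟨k, Finset.mem_Iic.2 hk⟩) ∘ Preorder.frestrictLe (π := fun _ : ℕ => Fin n) m := rfl
  rw [this]
  exact (measurable_pi_apply _).comp (comap_measurable _)

lemma measurable_fun_coord {m k : ℕ} (hk : k ≤ m) (f : Fin n → ℝ) :
    Measurable[paths n m] (fun ω : ℕ → Fin n => f (ω k)) :=
  (measurable_of_finite f).comp (measurable_coord hk)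

lemma integrable_of_bounded {s : Fin n} {φ : (ℕ → Fin n) → ℝ} (hφ : Measurable φ) {c : ℝ}
    (hc : ∀ ω, |φ ω| ≤ c) : Integrable φ (C.pathMeasure s) :=
  Integrable.of_bound hφ.aestronglyMeasurable c (Eventually.of_forall hc)

lemma integrable_coord (s : Fin n) (f : Fin n → ℝ) (k : ℕ) :
    Integrable (fun ω => f (ω k)) (C.pathMeasure s) := by
  obtain ⟨c, hc⟩ := exists_abs_le f
  exact C.integrable_of_bounded ((measurable_of_finite f).comp (measurable_pi_apply k))
    fun ω => hc _

/-- Given the history up to time `m`, the conditional expectation is the integral over the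
trajectory continued from that history, and its next coordinate is distributed according to the step
kernel. -/
lemma condExp_coord (s : Fin n) (f : Fin n → ℝ) (m : ℕ) :
    (C.pathMeasure s)[fun ω => f (ω (m + 1)) | paths n m] =ᵐ[C.pathMeasure s]
      fun ω => C.trans.mulVec f (ω m) := by
  have h1 := Kernel.condExp_traj (X := fun _ : ℕ => Fin n) (κ := C.histKernel) (a := 0) (b := m)
    (Nat.zero_le m) (x₀ := fun _ => s) (f := fun ω => f (ω (m + 1))) (C.integrable_coord s f (m + 1))
  refine h1.trans (Eventually.of_forall fun ω => ?_)
  have h2 := Kernel.map_traj_succ_self (X := fun _ : ℕ => Fin n) (κ := C.histKernel) (a := m)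
  have h3 := congrArg (fun k => k (Preorder.frestrictLe m ω)) h2
  rw [Kernel.map_apply _ (measurable_pi_apply _)] at h3
  have h4 : ∫ y, f (y (m + 1)) ∂(Kernel.traj C.histKernel m (Preorder.frestrictLe m ω)) =
      ∫ t, f t ∂((Kernel.traj C.histKernel m (Preorder.frestrictLe m ω)).map
        (fun x => x (m + 1))) := by
    exact (integral_map (φ := fun x : ℕ → Fin n => x (m + 1))
      (measurable_pi_apply (m + 1)).aemeasurable
      (measurable_of_finite f).aestronglyMeasurable).symm
  refine h4.trans ?_
  rw [h3]
  exact C.integral_stepMeasure f (ω m)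

/-- Markov property in integrated form. -/
lemma integral_mul_coord_succ (s : Fin n) (f : Fin n → ℝ) (m : ℕ) {φ : (ℕ → Fin n) → ℝ}
    (hφ : Measurable[paths n m] φ) {c : ℝ} (hc : ∀ ω, |φ ω| ≤ c) :
    ∫ ω, φ ω * f (ω (m + 1)) ∂(C.pathMeasure s) =
      ∫ ω, φ ω * C.trans.mulVec f (ω m) ∂(C.pathMeasure s) := by
  have hle := (paths n).le m
  have hint : Integrable (φ * fun ω => f (ω (m + 1))) (C.pathMeasure s) := by
    obtain ⟨d, hd⟩ := exists_abs_le f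
    refine C.integrable_of_bounded (c := c * d) ((hφ.mono hle le_rfl).mul
      ((measurable_of_finite f).comp (measurable_pi_apply _))) fun ω => ?_
    simp only [Pi.mul_apply, abs_mul]
    exact mul_le_mul (hc ω) (hd _) (abs_nonneg _) ((abs_nonneg _).trans (hc ω))
  have h1 := condExp_mul_of_stronglyMeasurable_left (m := paths n m) hφ.stronglyMeasurable hint
    (C.integrable_coord s f (m + 1))
  have h2 := integral_condExp (μ := C.pathMeasure s) (f := φ * fun ω => f (ω (m + 1))) hle
  calc _ = ∫ ω, (φ * fun ω : ℕ → Fin n => f (ω (m + 1))) ω ∂(C.pathMeasure s) := rfl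
    _ = _ := h2.symm
    _ = _ := by
      refine integral_congr_ae ?_
      filter_upwards [h1, C.condExp_coord s f m] with ω e1 e2
      rw [e1, Pi.mul_apply, e2]

lemma coord_zero (s : Fin n) : ∀ᵐ ω ∂(C.pathMeasure s), ω 0 = s := by
  have h1 := Kernel.traj_map_frestrictLe_apply (X := fun _ : ℕ => Fin n) (κ := C.histKernel)
    0 0 (fun _ => s)
  rw [Kernel.partialTraj_self, Kernel.id_apply] at h1
  have h2 : ∀ᵐ x ∂(Measure.dirac (fun _ : Finset.Iic 0 => s)),
      x ⟨0, Finset.mem_Iic.2 le_rfl⟩ = s := by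
    rw [ae_dirac_eq]
    rfl
  rw [← h1] at h2
  exact ae_of_ae_map (Preorder.measurable_frestrictLe _).aemeasurable h2

lemma integral_coord_of_harmonic (s : Fin n) {g : Fin n → ℝ} (hg : C.trans.mulVec g = g) (m : ℕ) :
    ∫ ω, g (ω m) ∂(C.pathMeasure s) = g s := by
  induction m with
  | zero =>
    rw [integral_congr_ae (g := fun _ => g s)]
    · simp
    · filter_upwards [C.coord_zero s] with ω hω
      rw [hω]
  | succ m ih =>
    have := C.integral_mul_coord_succ s g m (φ := fun _ => 1) measurable_const (c := 1) (by simp)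
    simp only [one_mul, hg] at this
    rw [this, ih]

/-! ## Mean payoff -/

/-- Weighted sum of the martingale differences of `h` along the path. -/
noncomputable def weightedNoise (h : Fin n → ℝ) (m : ℕ) (ω : ℕ → Fin n) : ℝ :=
  ∑ i ∈ Finset.range m, (h (ω (i + 1)) - C.trans.mulVec h (ω i)) / ((i : ℝ) + 1)

lemma measurable_weightedNoise (h : Fin n → ℝ) (m : ℕ) :
    Measurable[paths n m] (C.weightedNoise h m) := by
  refine Finset.measurable_fun_sum _ fun i hi => ?_
  have hi := Finset.mem_range.1 hi
  exact ((measurable_fun_coord (by omega) h).sub (measurable_fun_coord (by omega) _)).div_const _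

lemma abs_noise_le {h : Fin n → ℝ} {c : ℝ} (hc : ∀ s, |h s| ≤ c) (ω : ℕ → Fin n) (i : ℕ) :
    |h (ω (i + 1)) - C.trans.mulVec h (ω i)| ≤ c + c :=
  (abs_sub _ _).trans (add_le_add (hc _) (C.isStoch_trans.abs_mulVec_le hc _))

lemma abs_weightedNoise_le {h : Fin n → ℝ} {c : ℝ} (hc : ∀ s, |h s| ≤ c) (m : ℕ)
    (ω : ℕ → Fin n) : |C.weightedNoise h m ω| ≤ m * (c + c) := by
  refine (Finset.abs_sum_le_sum_abs _ _).trans ?_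
  refine (Finset.sum_le_card_nsmul _ _ (c + c) fun i _ => ?_).trans
    (le_of_eq (by rw [Finset.card_range, nsmul_eq_mul]))
  have hc0 := (abs_nonneg _).trans (C.abs_noise_le hc ω i)
  have hi : (1 : ℝ) ≤ (i : ℝ) + 1 := by have : (0 : ℝ) ≤ i := by positivity
                                        linarith
  rw [abs_div, abs_of_pos (by positivity : (0 : ℝ) < (i : ℝ) + 1), div_le_iff₀ (by positivity)]
  refine (C.abs_noise_le hc ω i).trans ?_
  nlinarith

lemma integrable_weightedNoise (s : Fin n) (h : Fin n → ℝ) (m : ℕ) :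
    Integrable (C.weightedNoise h m) (C.pathMeasure s) := by
  obtain ⟨c, hc⟩ := exists_abs_le h
  exact C.integrable_of_bounded ((C.measurable_weightedNoise h m).mono ((paths n).le m) le_rfl)
    (C.abs_weightedNoise_le hc m)

lemma martingale_weightedNoise (s : Fin n) (h : Fin n → ℝ) :
    Martingale (C.weightedNoise h) (paths n) (C.pathMeasure s) := by
  refine martingale_of_condExp_sub_eq_zero_nat
    (fun m => (C.measurable_weightedNoise h m).stronglyMeasurable)
    (fun m => C.integrable_weightedNoise s h m) fun m => ?_
  have h1 : C.weightedNoise h (m + 1) - C.weightedNoise h m =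
      ((m : ℝ) + 1)⁻¹ • ((fun ω => h (ω (m + 1))) - fun ω => C.trans.mulVec h (ω m)) := by
    ext ω
    simp only [weightedNoise, Finset.sum_range_succ, Pi.sub_apply, Pi.smul_apply, smul_eq_mul]
    ring
  rw [h1]
  refine (condExp_smul _ _ _).trans ?_
  have h2 := condExp_sub (C.integrable_coord s h (m + 1))
    (C.integrable_coord s (C.trans.mulVec h) m) (paths n m)
  have h3 := condExp_of_stronglyMeasurable (μ := C.pathMeasure s) ((paths n).le m)
    (measurable_fun_coord (m := m) le_rfl (C.trans.mulVec h)).stronglyMeasurable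
    (C.integrable_coord s (C.trans.mulVec h) m)
  filter_upwards [h2, C.condExp_coord s h m] with ω e2 e3
  rw [Pi.smul_apply, e2, Pi.sub_apply, e3, h3]
  simp

/-- Martingale differences are orthogonal, so second moments add up. The weights `1 / (i + 1)` make
the resulting bounds summable. -/
lemma integral_weightedNoise_sq_le (s : Fin n) {h : Fin n → ℝ} {c : ℝ} (hc : ∀ s, |h s| ≤ c)
    (m : ℕ) : ∫ ω, (C.weightedNoise h m ω) ^ 2 ∂(C.pathMeasure s) ≤
      ∑ i ∈ Finset.range m, ((c + c) / ((i : ℝ) + 1)) ^ 2 := by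
  induction m with
  | zero => simp [weightedNoise]
  | succ m ih =>
    have hm := (C.measurable_weightedNoise h m).mono ((paths n).le m) le_rfl
    have hS := C.abs_weightedNoise_le hc m
    set S := C.weightedNoise h m with hSdef
    set ξ : (ℕ → Fin n) → ℝ := fun ω => h (ω (m + 1)) - C.trans.mulVec h (ω m) with hξ
    have hξb : ∀ ω, |ξ ω| ≤ c + c := fun ω => C.abs_noise_le hc ω m
    have hmul : ∀ {f g : (ℕ → Fin n) → ℝ} {a b : ℝ}, Measurable f → Measurable g →
        (∀ ω, |f ω| ≤ a) → (∀ ω, |g ω| ≤ b) →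
        Integrable (fun ω => f ω * g ω) (C.pathMeasure s) := by
      intro f g a b hf hg ha hb
      refine C.integrable_of_bounded (c := a * b) (hf.mul hg) fun ω => ?_
      rw [abs_mul]
      exact mul_le_mul (ha ω) (hb ω) (abs_nonneg _) ((abs_nonneg _).trans (ha ω))
    have hQm : Measurable fun ω : ℕ → Fin n => C.trans.mulVec h (ω m) :=
      (measurable_of_finite (C.trans.mulVec h)).comp (measurable_pi_apply _)
    have hHm : Measurable fun ω : ℕ → Fin n => h (ω (m + 1)) :=
      (measurable_of_finite h).comp (measurable_pi_apply _)
    have hξm : Measurable ξ := hHm.sub hQm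
    -- The partial sum is determined by the history up to time `m`, given which the next difference
    -- has mean zero.
    have hzero : ∫ ω, S ω * ξ ω ∂(C.pathMeasure s) = 0 := by
      have e := C.integral_mul_coord_succ s h m (C.measurable_weightedNoise h m) hS
      simp only [hξ, mul_sub]
      rw [integral_sub (hmul hm hHm hS fun ω => hc _)
        (hmul hm hQm hS fun ω => C.isStoch_trans.abs_mulVec_le hc _), e, sub_self]
    have hexp : ∀ ω, (C.weightedNoise h (m + 1) ω) ^ 2 =
        S ω * S ω + (2 / ((m : ℝ) + 1)) * (S ω * ξ ω) + (((m : ℝ) + 1) ^ 2)⁻¹ * (ξ ω * ξ ω) := by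
      intro ω
      have : C.weightedNoise h (m + 1) ω = S ω + ξ ω / ((m : ℝ) + 1) := by
        rw [weightedNoise, Finset.sum_range_succ]
        rfl
      rw [this]
      field_simp
      ring
    have hSS := hmul hm hm hS hS
    have hSξ := hmul hm hξm hS hξb
    have hξξ := hmul hξm hξm hξb hξb
    simp only [hexp]
    rw [integral_add (f := fun ω => S ω * S ω + 2 / ((m : ℝ) + 1) * (S ω * ξ ω))
        (g := fun ω => (((m : ℝ) + 1) ^ 2)⁻¹ * (ξ ω * ξ ω))
        (hSS.add (hSξ.const_mul _)) (hξξ.const_mul _),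
      integral_add hSS (hSξ.const_mul _), integral_const_mul, integral_const_mul, hzero, mul_zero,
      add_zero, Finset.sum_range_succ]
    have hle : ∫ ω, ξ ω * ξ ω ∂(C.pathMeasure s) ≤ (c + c) ^ 2 := by
      calc _ ≤ ∫ _, (c + c) ^ 2 ∂(C.pathMeasure s) := by
            refine integral_mono hξξ (integrable_const _) fun ω => ?_
            simp only
            rw [← abs_mul_abs_self, sq]
            exact mul_self_le_mul_self (abs_nonneg _) (hξb ω)
        _ = (c + c) ^ 2 := by simp
    have ih' : ∫ ω, S ω * S ω ∂(C.pathMeasure s) ≤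
        ∑ i ∈ Finset.range m, ((c + c) / ((i : ℝ) + 1)) ^ 2 := by
      refine le_trans (le_of_eq ?_) ih
      exact integral_congr_ae (Eventually.of_forall fun ω => by simp only; ring)
    refine add_le_add ih' ?_
    rw [div_pow, div_eq_inv_mul]
    exact mul_le_mul_of_nonneg_left hle (by positivity)

lemma ae_tendsto_of_martingale {f : ℕ → (ℕ → Fin n) → ℝ} {s : Fin n}
    (hf : Martingale f (paths n) (C.pathMeasure s)) {c : ℝ}
    (hc : ∀ m, ∫ ω, |f m ω| ∂(C.pathMeasure s) ≤ c) :
    ∃ G : (ℕ → Fin n) → ℝ, ∀ᵐ ω ∂(C.pathMeasure s), Tendsto (fun m => f m ω) atTop (𝓝 (G ω)) := by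
  refine ⟨_, hf.submartingale.ae_tendsto_limitProcess (R := c.toNNReal) fun m => ?_⟩
  rw [eLpNorm_one_eq_lintegral_enorm, ← ofReal_integral_norm_eq_lintegral_enorm (hf.integrable m)]
  exact ENNReal.ofReal_le_ofReal (hc m)

/-- The second moments are bounded by a convergent series. By `|x| ≤ 1 + x ^ 2` the martingale is
bounded in `L¹` and converges almost surely. -/
lemma ae_tendsto_weightedNoise (s : Fin n) (h : Fin n → ℝ) :
    ∃ G : (ℕ → Fin n) → ℝ, ∀ᵐ ω ∂(C.pathMeasure s),
      Tendsto (fun m => C.weightedNoise h m ω) atTop (𝓝 (G ω)) := by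
  obtain ⟨c, hc⟩ := exists_abs_le h
  have hsum : Summable fun i : ℕ => ((c + c) / ((i : ℝ) + 1)) ^ 2 := by
    have h1 : Summable fun i : ℕ => (1 : ℝ) / (i : ℝ) ^ 2 :=
      Real.summable_one_div_nat_pow.2 (by norm_num)
    have h2 := ((summable_nat_add_iff 1).2 h1).mul_left ((c + c) ^ 2)
    refine h2.congr fun i => ?_
    push_cast
    rw [div_pow]; ring
  refine C.ae_tendsto_of_martingale (C.martingale_weightedNoise s h)
    (c := 1 + ∑' i : ℕ, ((c + c) / ((i : ℝ) + 1)) ^ 2) fun m => ?_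
  have hm := (C.measurable_weightedNoise h m).mono ((paths n).le m) le_rfl
  have hsq : Integrable (fun ω => (C.weightedNoise h m ω) ^ 2) (C.pathMeasure s) := by
    refine C.integrable_of_bounded (c := (m * (c + c)) ^ 2) (hm.pow_const 2) fun ω => ?_
    rw [abs_pow]
    exact pow_le_pow_left₀ (abs_nonneg _) (C.abs_weightedNoise_le hc m ω) 2
  calc _ ≤ ∫ ω, (1 + (C.weightedNoise h m ω) ^ 2) ∂(C.pathMeasure s) := by
        refine integral_mono (C.integrable_weightedNoise s h m).abs
          ((integrable_const _).add hsq) fun ω => ?_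
        simp only
        rw [← sq_abs]
        nlinarith [sq_nonneg (|C.weightedNoise h m ω| - 1)]
    _ = 1 + ∫ ω, (C.weightedNoise h m ω) ^ 2 ∂(C.pathMeasure s) := by
        rw [integral_add (integrable_const _) hsq]; simp
    _ ≤ _ := by
        gcongr
        exact (C.integral_weightedNoise_sq_le s hc m).trans
          (hsum.sum_le_tsum _ fun _ _ => sq_nonneg _)

/-- Abel summation, the core of Kronecker's lemma: divided by `m`, the right side is a sequence
minus its Cesàro mean, which tends to zero once the sequence converges. -/
lemma sum_noise_eq (h : Fin n → ℝ) (m : ℕ) (ω : ℕ → Fin n) :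
    ∑ i ∈ Finset.range m, (h (ω (i + 1)) - C.trans.mulVec h (ω i)) =
      m * C.weightedNoise h m ω - ∑ i ∈ Finset.range m, C.weightedNoise h i ω := by
  induction m with
  | zero => simp
  | succ m ih =>
    have : C.weightedNoise h (m + 1) ω = C.weightedNoise h m ω +
        (h (ω (m + 1)) - C.trans.mulVec h (ω m)) / ((m : ℝ) + 1) := by
      rw [weightedNoise, Finset.sum_range_succ]
      rfl
    rw [Finset.sum_range_succ, ih, Finset.sum_range_succ, this]
    push_cast
    field_simp
    ring

/-- Strong law of large numbers for the weights, by means of the Poisson equation. -/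
lemma ae_tendsto_average (s : Fin n) {w g h : Fin n → ℝ} (hg : C.trans.mulVec g = g)
    (hw : w = g + (h - C.trans.mulVec h)) :
    ∃ G : (ℕ → Fin n) → ℝ, ∀ᵐ ω ∂(C.pathMeasure s),
      Tendsto (fun m => g (ω m)) atTop (𝓝 (G ω)) ∧
      Tendsto (fun m : ℕ => (m : ℝ)⁻¹ * ∑ i ∈ Finset.range m, w (ω i)) atTop (𝓝 (G ω)) := by
  obtain ⟨cg, hcg⟩ := exists_abs_le g
  obtain ⟨ch, hch⟩ := exists_abs_le h
  obtain ⟨N, hN⟩ := C.ae_tendsto_weightedNoise s h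
  have hmart : Martingale (fun m ω => g (ω m)) (paths n) (C.pathMeasure s) := by
    refine martingale_nat (fun m => (measurable_fun_coord le_rfl g).stronglyMeasurable)
      (fun m => C.integrable_coord s g m) fun m => ?_
    have := C.condExp_coord s g m
    rw [hg] at this
    exact this.symm
  obtain ⟨G, hG⟩ := C.ae_tendsto_of_martingale hmart (c := cg) fun m => by
    calc _ ≤ ∫ _, cg ∂(C.pathMeasure s) :=
          integral_mono (C.integrable_coord s g m).abs (integrable_const _) fun ω => hcg _
      _ = cg := by simp
  refine ⟨G, ?_⟩
  filter_upwards [hN, hG] with ω h1 h2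
  refine ⟨h2, ?_⟩
  have h3 : Tendsto (fun m : ℕ => (m : ℝ)⁻¹ * (h (ω 0) - h (ω m))) atTop (𝓝 0) := by
    refine squeeze_zero_norm (a := fun m : ℕ => (m : ℝ)⁻¹ * (ch + ch)) (fun m => ?_) ?_
    · rw [norm_mul, Real.norm_eq_abs, Real.norm_eq_abs, abs_of_nonneg (by positivity)]
      exact mul_le_mul_of_nonneg_left ((abs_sub _ _).trans (add_le_add (hch _) (hch _)))
        (by positivity)
    · simpa using tendsto_inv_atTop_nhds_zero_nat.mul_const (ch + ch)
  have h4 := (h2.cesaro.add h3).add (h1.sub h1.cesaro)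
  simp only [add_zero, sub_self] at h4
  refine h4.congr' ?_
  filter_upwards [eventually_gt_atTop 0] with m hm
  -- Along the path, `h - P h` at time `i` is the telescoping difference of `h` between times `i`
  -- and `i + 1` plus the martingale difference.
  have h5 : ∑ i ∈ Finset.range m, w (ω i) = ∑ i ∈ Finset.range m, g (ω i) + (h (ω 0) - h (ω m)) +
      (m * C.weightedNoise h m ω - ∑ i ∈ Finset.range m, C.weightedNoise h i ω) := by
    rw [← C.sum_noise_eq, ← Finset.sum_range_sub' (fun i => h (ω i)), ← Finset.sum_add_distrib,
      ← Finset.sum_add_distrib]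
    refine Finset.sum_congr rfl fun i _ => ?_
    rw [hw]
    simp only [Pi.add_apply, Pi.sub_apply]
    ring
  rw [h5]
  have : (m : ℝ) ≠ 0 := by positivity
  field_simp

/-- The mean payoff is almost surely the limit of the bounded martingale `g (ω m)`. This gives
measurability and a bound, hence integrability, and dominated convergence carries the constant
expectation `g s` to the limit. -/
theorem meanPayoff_eq (s : Fin n) (T : Finset (Fin n)) {w g h : Fin n → ℝ}
    (hg : C.trans.mulVec g = g)
    (hw : (fun t => if t ∈ T then w t else 0) = g + (h - C.trans.mulVec h)) :
    Integrable (meanPayoff w T) (C.pathMeasure s) ∧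
      ∫ ω, meanPayoff w T ω ∂(C.pathMeasure s) = g s := by
  obtain ⟨cg, hcg⟩ := exists_abs_le g
  obtain ⟨G, hG⟩ := C.ae_tendsto_average s hg hw
  have hlim : ∀ᵐ ω ∂(C.pathMeasure s), Tendsto (fun m => g (ω m)) atTop (𝓝 (meanPayoff w T ω)) := by
    filter_upwards [hG] with ω hω
    -- The mean payoff averages over the `m + 1` times up to `m`, hence the shift.
    have h1 := (tendsto_add_atTop_iff_nat 1).2 hω.2
    have h2 : meanPayoff w T ω = G ω := by
      unfold meanPayoff
      refine Tendsto.limsup_eq (h1.congr fun m => ?_)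
      push_cast
      rw [div_eq_inv_mul]
    rw [h2]
    exact hω.1
  have hmeas : AEStronglyMeasurable (meanPayoff w T) (C.pathMeasure s) :=
    aestronglyMeasurable_of_tendsto_ae atTop
      (fun m => (C.integrable_coord s g m).aestronglyMeasurable) hlim
  have hbound : ∀ᵐ ω ∂(C.pathMeasure s), ‖meanPayoff w T ω‖ ≤ cg := by
    filter_upwards [hlim] with ω hω
    exact le_of_tendsto hω.norm (Eventually.of_forall fun m => hcg _)
  refine ⟨Integrable.of_bound hmeas cg hbound, ?_⟩
  have h3 := tendsto_integral_of_dominated_convergence (μ := C.pathMeasure s) (fun _ => cg)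
    (F := fun m ω => g (ω m)) (fun m => (C.integrable_coord s g m).aestronglyMeasurable)
    (integrable_const _) (fun m => Eventually.of_forall fun ω => hcg _) hlim
  simp only [C.integral_coord_of_harmonic s hg] at h3
  exact (tendsto_nhds_unique h3 tendsto_const_nhds)

end MarkovChain

end ParamMC

namespace ParamMC

open Filter Topology

namespace MarkovChain

variable {n : ℕ} (C : MarkovChain n)

/-! ## Reachability and accumulated weights -/

/-- Transition matrix after making the states in `T` absorbing. -/
noncomputable def absorb (T : Finset (Fin n)) : Matrix (Fin n) (Fin n) ℝ :=
  Matrix.of fun s t => if s ∈ T then (if s = t then 1 else 0) else C.stepProb s t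

lemma isStoch_absorb (T : Finset (Fin n)) : IsStoch (C.absorb T) := by
  constructor
  · intro s t
    simp only [absorb, Matrix.of_apply]
    split_ifs
    · exact zero_le_one
    · exact le_rfl
    · exact C.stepProb_nonneg s t
  · intro s
    simp only [absorb, Matrix.of_apply]
    split_ifs
    · simp
    · exact C.sum_stepProb s

lemma absorb_mulVec_of_mem {T : Finset (Fin n)} {s : Fin n} (hs : s ∈ T) (f : Fin n → ℝ) :
    (C.absorb T).mulVec f s = f s := by
  simp [absorb, Matrix.mulVec, dotProduct, hs]

lemma absorb_mulVec_of_notMem {T : Finset (Fin n)} {s : Fin n} (hs : s ∉ T) (f : Fin n → ℝ) :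
    (C.absorb T).mulVec f s = C.trans.mulVec f s := by
  simp [absorb, Matrix.mulVec, dotProduct, hs, trans]

/-- The function `f` outside of `T`, and `0` on `T`. -/
def off (T : Finset (Fin n)) (f : Fin n → ℝ) (s : Fin n) : ℝ := if s ∈ T then 0 else f s

/-- Indicator function of the paths that avoid `T` up to time `m`. -/
noncomputable def avoid (T : Finset (Fin n)) (m : ℕ) (ω : ℕ → Fin n) : ℝ :=
  ∏ i ∈ Finset.range (m + 1), off T (fun _ => 1) (ω i)

lemma avoid_eq (T : Finset (Fin n)) (m : ℕ) (ω : ℕ → Fin n) :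
    avoid T m ω = if ∀ i ≤ m, ω i ∉ T then 1 else 0 := by
  unfold avoid off
  split_ifs with h
  · exact Finset.prod_eq_one fun i hi => if_neg (h i (by simpa [Nat.lt_succ_iff] using hi))
  · push Not at h
    obtain ⟨i, hi, hiT⟩ := h
    exact Finset.prod_eq_zero (i := i) (by simpa [Nat.lt_succ_iff] using hi) (if_pos hiT)

lemma abs_avoid_le (T : Finset (Fin n)) (m : ℕ) (ω : ℕ → Fin n) : |avoid T m ω| ≤ 1 := by
  rw [avoid_eq]; split_ifs <;> simp

lemma avoid_nonneg (T : Finset (Fin n)) (m : ℕ) (ω : ℕ → Fin n) : 0 ≤ avoid T m ω := by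
  rw [avoid_eq]; split_ifs <;> simp

lemma measurable_avoid (T : Finset (Fin n)) (m : ℕ) : Measurable[paths n m] (avoid T m) :=
  Finset.measurable_fun_prod _ fun i hi =>
    measurable_fun_coord (by have := Finset.mem_range.1 hi; omega) _

lemma avoid_mul_off (T : Finset (Fin n)) (m : ℕ) (ω : ℕ → Fin n) (f : Fin n → ℝ) :
    avoid T m ω * off T f (ω m) = avoid T m ω * f (ω m) := by
  rw [avoid_eq]
  split_ifs with h
  · simp [off, h m le_rfl]
  · simp

lemma integrable_avoid_mul (s : Fin n) (T : Finset (Fin n)) (m : ℕ) (f : Fin n → ℝ) :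
    Integrable (fun ω => avoid T m ω * f (ω m)) (C.pathMeasure s) := by
  obtain ⟨c, hc⟩ := exists_abs_le f
  refine C.integrable_of_bounded (c := c) (((measurable_avoid T m).mono ((paths n).le m) le_rfl).mul
    ((measurable_of_finite f).comp (measurable_pi_apply _))) fun ω => ?_
  rw [abs_mul]
  exact (mul_le_of_le_one_left (abs_nonneg _) (abs_avoid_le T m ω)).trans (hc _)

/-- Once absorbed in `T`, the chain stays there, where `off T f` vanishes. Powers of the absorbing
matrix therefore see exactly the paths that have avoided `T` so far. -/
lemma integral_avoid_mul (s : Fin n) (T : Finset (Fin n)) (m : ℕ) (f : Fin n → ℝ) :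
    ∫ ω, avoid T m ω * f (ω m) ∂(C.pathMeasure s) = ((C.absorb T) ^ m).mulVec (off T f) s := by
  induction m generalizing f with
  | zero =>
    rw [integral_congr_ae (g := fun _ => off T f s)]
    · simp
    · filter_upwards [C.coord_zero s] with ω hω
      simp [avoid, off, hω]
  | succ m ih =>
    have h1 : ∀ ω : ℕ → Fin n, avoid T (m + 1) ω * f (ω (m + 1)) =
        avoid T m ω * off T f (ω (m + 1)) := by
      intro ω
      rw [avoid, Finset.prod_range_succ, ← avoid, mul_assoc]
      congr 1
      simp [off]
    simp only [h1]
    rw [C.integral_mul_coord_succ s _ m (measurable_avoid T m) (abs_avoid_le T m)]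
    -- Where the factor `avoid` is nonzero, the current state lies outside `T`, and there the two
    -- matrices have the same row.
    have h2 : ∀ ω : ℕ → Fin n, avoid T m ω * C.trans.mulVec (off T f) (ω m) =
        avoid T m ω * (C.absorb T).mulVec (off T f) (ω m) := by
      intro ω
      rw [← avoid_mul_off, ← avoid_mul_off (f := (C.absorb T).mulVec (off T f))]
      congr 1
      unfold off
      split_ifs with hm
      · rfl
      · exact (C.absorb_mulVec_of_notMem hm _).symm
    simp only [h2]
    rw [ih, pow_succ, ← Matrix.mulVec_mulVec]
    congr 1
    ext x
    simp only [off]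
    split_ifs with hx
    · simp [C.absorb_mulVec_of_mem hx, off, hx]
    · rfl

lemma integral_avoid (s : Fin n) (T : Finset (Fin n)) (m : ℕ) :
    ∫ ω, avoid T m ω ∂(C.pathMeasure s) = ((C.absorb T) ^ m).mulVec (off T fun _ => 1) s := by
  rw [← C.integral_avoid_mul]
  simp

lemma tendsto_integral_avoid (s : Fin n) (T : Finset (Fin n)) :
    Tendsto (fun m => ∫ ω, avoid T m ω ∂(C.pathMeasure s)) atTop (𝓝 (1 - C.reachProb s T)) := by
  have hmeas : ∀ i, MeasurableSet {ω : ℕ → Fin n | ω i ∈ T} := fun i =>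
    measurable_pi_apply i (Set.toFinite (T : Set (Fin n))).measurableSet
  have hreach : MeasurableSet {ω : ℕ → Fin n | ∃ i, ω i ∈ T} := by
    have : {ω : ℕ → Fin n | ∃ i, ω i ∈ T} = ⋃ i, {ω : ℕ → Fin n | ω i ∈ T} := by
      ext ω; simp
    rw [this]
    exact MeasurableSet.iUnion hmeas
  have h1 : 1 - C.reachProb s T =
      ∫ ω, ({ω : ℕ → Fin n | ∃ i, ω i ∈ T}ᶜ).indicator (fun _ => (1 : ℝ)) ω ∂(C.pathMeasure s) := by
    rw [integral_indicator hreach.compl, reachProb, setIntegral_const, smul_eq_mul, mul_one,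
      measureReal_compl hreach, probReal_univ]
  rw [h1]
  refine tendsto_integral_of_dominated_convergence (fun _ => 1)
    (fun m => ((measurable_avoid T m).mono ((paths n).le m) le_rfl).aestronglyMeasurable)
    (integrable_const _) (fun m => Eventually.of_forall fun ω => abs_avoid_le T m ω)
    (Eventually.of_forall fun ω => ?_)
  by_cases h : ∃ i, ω i ∈ T
  · obtain ⟨i, hi⟩ := h
    rw [Set.indicator_of_notMem (by simpa using ⟨i, hi⟩)]
    refine tendsto_const_nhds.congr' ?_
    filter_upwards [eventually_ge_atTop i] with m hm
    rw [avoid_eq, if_neg]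
    push Not
    exact ⟨i, hm, hi⟩
  · rw [Set.indicator_of_mem (by simpa using h)]
    push Not at h
    refine tendsto_const_nhds.congr fun m => ?_
    rw [avoid_eq, if_pos fun i _ => h i]

/-- Reachability probabilities by means of the Poisson equation. -/
theorem reachProb_eq (s : Fin n) (T : Finset (Fin n)) {g h : Fin n → ℝ}
    (hg : (C.absorb T).mulVec g = g)
    (hw : (fun t => if t ∈ T then (1 : ℝ) else 0) = g + (h - (C.absorb T).mulVec h)) :
    C.reachProb s T = g s := by
  have h1 := tendsto_average (C.isStoch_absorb T) hg hw s
  have hone : ∀ i, ((C.absorb T) ^ i).mulVec (fun _ => (1 : ℝ)) = fun _ => 1 := by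
    refine fun i => pow_mulVec_of_mulVec_eq ?_ i
    ext x
    simp only [Matrix.mulVec, dotProduct, mul_one]
    exact (C.isStoch_absorb T).sum x
  -- Both sides are the probability of having visited `T` by time `i`. These converge to the
  -- reachability probability, hence so do their averages, whose limit is the gain.
  have h2 : ∀ i, ((C.absorb T) ^ i).mulVec (fun t => if t ∈ T then (1 : ℝ) else 0) s =
      1 - ∫ ω, avoid T i ω ∂(C.pathMeasure s) := by
    intro i
    have : (fun t => if t ∈ T then (1 : ℝ) else 0) = (fun _ => 1) - off T fun _ => 1 := by
      ext t; simp only [off, Pi.sub_apply]; split_ifs <;> simp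
    rw [this, Matrix.mulVec_sub, hone, C.integral_avoid, Pi.sub_apply]
  have h3 := ((C.tendsto_integral_avoid s T).const_sub 1).cesaro
  simp only [h2] at h1
  have := tendsto_nhds_unique h3 h1
  linarith

/-- Expected accumulated weights by means of the Poisson equation. -/
theorem accWeight_eq (s : Fin n) (T : Finset (Fin n)) {w g h g' h' : Fin n → ℝ}
    (hs : C.reachProb s T = 1) (hT : ∀ t ∈ T, h t = 0)
    (hg : (C.absorb T).mulVec g = g) (hw : off T w = g + (h - (C.absorb T).mulVec h))
    (hg' : (C.absorb T).mulVec g' = g')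
    (hw' : (off T fun _ => 1) = g' + (h' - (C.absorb T).mulVec h')) :
    Integrable (accWeight w T) (C.pathMeasure s) ∧
      ∫ ω, accWeight w T ω ∂(C.pathMeasure s) = h s := by
  have hstoch := C.isStoch_absorb T
  have hav := C.tendsto_integral_avoid s T
  rw [hs, sub_self] at hav
  -- A bounded function restricted to the surviving paths is dominated by a multiple of the survival
  -- probability, which tends to zero because `T` is reached almost surely. Consequently the gain at
  -- `s` of any weight supported off `T` is zero.
  have hzero : ∀ (f : Fin n → ℝ), Tendsto (fun m => ((C.absorb T) ^ m).mulVec (off T f) s) atTop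
      (𝓝 0) := by
    intro f
    obtain ⟨c, hc⟩ := exists_abs_le f
    refine squeeze_zero_norm (a := fun m => c * ∫ ω, avoid T m ω ∂(C.pathMeasure s))
      (fun m => ?_) (by simpa using hav.const_mul c)
    rw [← C.integral_avoid_mul, ← integral_const_mul]
    refine (norm_integral_le_integral_norm _).trans ?_
    have hint := C.integrable_avoid_mul s T m fun _ => c
    refine integral_mono (C.integrable_avoid_mul s T m f).norm (by simpa [mul_comm] using hint) ?_
    intro ω
    simp only [norm_mul, Real.norm_eq_abs]
    rw [abs_of_nonneg (avoid_nonneg T m ω), mul_comm]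
    exact mul_le_mul_of_nonneg_right (hc _) (avoid_nonneg T m ω)
  have hgs : ∀ {f g h : Fin n → ℝ}, (C.absorb T).mulVec g = g →
      off T f = g + (h - (C.absorb T).mulVec h) → g s = 0 := fun h1 h2 =>
    tendsto_nhds_unique (tendsto_average hstoch h1 h2 s) (hzero _).cesaro
  -- The second Poisson equation has weight one off `T`. Its telescoping sum bounds the sum of the
  -- survival probabilities, which is the expected hitting time.
  have hsumav : Summable fun m => ∫ ω, avoid T m ω ∂(C.pathMeasure s) := by
    obtain ⟨c, hc⟩ := exists_abs_le h'
    refine summable_of_sum_range_le (c := c + c) (fun m => integral_nonneg (avoid_nonneg T m))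
      fun m => ?_
    simp only [C.integral_avoid]
    rw [sum_pow_mulVec hg' hw', hgs hg' hw', mul_zero, zero_add]
    exact (le_abs_self _).trans ((abs_sub _ _).trans
      (add_le_add (hc s) (hstoch.abs_pow_mulVec_le hc m s)))
  obtain ⟨c, hc⟩ := exists_abs_le w
  -- The accumulated weight becomes a series over all times, cut off by the survival indicator, so
  -- that sum and integral can be exchanged.
  set F : ℕ → (ℕ → Fin n) → ℝ := fun i ω => avoid T i ω * w (ω i) with hF
  have hFint : ∀ i, Integrable (F i) (C.pathMeasure s) := fun i => C.integrable_avoid_mul s T i w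
  have hFle : ∀ i ω, ‖F i ω‖ ≤ c * avoid T i ω := by
    intro i ω
    simp only [hF, norm_mul, Real.norm_eq_abs]
    rw [abs_of_nonneg (avoid_nonneg T i ω), mul_comm]
    exact mul_le_mul_of_nonneg_right (hc _) (avoid_nonneg T i ω)
  have havint : ∀ i, Integrable (avoid T i) (C.pathMeasure s) := fun i => by
    simpa using C.integrable_avoid_mul s T i fun _ => 1
  have hFsum : Summable fun i => ∫ ω, ‖F i ω‖ ∂(C.pathMeasure s) := by
    refine Summable.of_nonneg_of_le (fun i => integral_nonneg fun _ => norm_nonneg _)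
      (fun i => ?_) (hsumav.mul_left c)
    rw [← integral_const_mul]
    exact integral_mono (hFint i).norm ((havint i).const_mul c) (hFle i)
  have hae : ∀ᵐ ω ∂(C.pathMeasure s), ∃ i, ω i ∈ T := by
    have hreach : MeasurableSet {ω : ℕ → Fin n | ∃ i, ω i ∈ T} := by
      have : {ω : ℕ → Fin n | ∃ i, ω i ∈ T} = ⋃ i, {ω : ℕ → Fin n | ω i ∈ T} := by
        ext ω; simp
      rw [this]
      exact MeasurableSet.iUnion fun i =>
        measurable_pi_apply i (Set.toFinite (T : Set (Fin n))).measurableSet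
    have h0 : (C.pathMeasure s).real {ω | ∃ i, ω i ∈ T}ᶜ = 0 := by
      rw [measureReal_compl hreach, probReal_univ, ← reachProb, hs, sub_self]
    exact (measureReal_eq_zero_iff).1 h0
  have hpt : ∀ᵐ ω ∂(C.pathMeasure s), HasSum (fun i => F i ω) (accWeight w T ω) := by
    filter_upwards [hae] with ω hω
    have hne : {i | ω i ∈ T}.Nonempty := hω
    have h1 : accWeight w T ω = ∑ i ∈ Finset.range (sInf {i | ω i ∈ T}), F i ω := by
      refine Finset.sum_congr rfl fun i hi => ?_
      rw [hF]
      simp only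
      rw [avoid_eq, if_pos, one_mul]
      intro j hj hjT
      have := Nat.sInf_le (s := {i | ω i ∈ T}) hjT
      have := Finset.mem_range.1 hi
      omega
    rw [h1]
    refine hasSum_sum_of_ne_finset_zero fun i hi => ?_
    rw [Finset.mem_range, not_lt] at hi
    rw [hF]
    simp only
    rw [avoid_eq, if_neg, zero_mul]
    push Not
    exact ⟨_, hi, Nat.sInf_mem hne⟩
  have hmeas : AEStronglyMeasurable (accWeight w T) (C.pathMeasure s) :=
    aestronglyMeasurable_of_tendsto_ae atTop
      (f := fun m ω => ∑ i ∈ Finset.range m, F i ω)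
      (fun m => Finset.aestronglyMeasurable_fun_sum _ fun i _ => (hFint i).aestronglyMeasurable)
      (hpt.mono fun ω hω => hω.tendsto_sum_nat)
  constructor
  · refine ⟨hmeas, ?_⟩
    have h1 : ∫⁻ ω, ‖accWeight w T ω‖ₑ ∂(C.pathMeasure s) ≤
        ∫⁻ ω, ∑' i, ‖F i ω‖ₑ ∂(C.pathMeasure s) := by
      refine lintegral_mono_ae ?_
      filter_upwards [hpt] with ω hω
      rw [← hω.tsum_eq]
      exact enorm_tsum_le_tsum_enorm
    refine lt_of_le_of_lt h1 ?_
    rw [lintegral_tsum fun i => (hFint i).aestronglyMeasurable.enorm]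
    have h2 : ∀ i, ∫⁻ ω, ‖F i ω‖ₑ ∂(C.pathMeasure s) =
        ENNReal.ofReal (∫ ω, ‖F i ω‖ ∂(C.pathMeasure s)) := fun i =>
      (ofReal_integral_norm_eq_lintegral_enorm (hFint i)).symm
    simp only [h2]
    exact hFsum.tsum_ofReal_lt_top
  · have h1 := hasSum_integral_of_summable_integral_norm hFint hFsum
    rw [integral_congr_ae (hpt.mono fun ω hω => hω.tsum_eq)] at h1
    have h2 := h1.tendsto_sum_nat
    have h3 : ∀ i, ∫ ω, F i ω ∂(C.pathMeasure s) = ((C.absorb T) ^ i).mulVec (off T w) s :=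
      fun i => C.integral_avoid_mul s T i w
    simp only [h3, sum_pow_mulVec hg hw, hgs hg hw, mul_zero, zero_add] at h2
    -- As the bias vanishes on `T`, the remainder `P ^ m h` involves surviving paths only and tends
    -- to zero, leaving `h s`.
    have hoff : off T h = h := by
      ext x
      simp only [off]
      split_ifs with hx
      · exact (hT x hx).symm
      · rfl
    have h4 := (hzero h).const_sub (h s)
    rw [hoff, sub_zero] at h4
    exact tendsto_nhds_unique h2 h4

end MarkovChain

end ParamMC

namespace ParamMC

open Filter Topology

/-! ## Bottom strongly connected components -/

section Graph

variable {n : ℕ} (P : Matrix (Fin n) (Fin n) ℝ)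

/-- `t` is reachable from `s`. -/
def Reaches : Fin n → Fin n → Prop := Relation.ReflTransGen fun s t => 0 < P s t

/-- `b` is the smallest state of a bottom strongly connected component. -/
def IsRep (b : Fin n) : Prop := ∀ t, Reaches P b t → Reaches P t b ∧ b ≤ t

/-- A reachable state that itself reaches as few states as possible lies in a bottom component; take
the smallest state of that component. -/
lemma exists_isRep (s : Fin n) : ∃ b, Reaches P s b ∧ IsRep P b := by
  classical
  obtain ⟨t, ht, hmin⟩ := Finset.exists_min_image
    (Finset.univ.filter fun t => Reaches P s t)
    (fun t => (Finset.univ.filter fun u => Reaches P t u).card) ⟨s, Finset.mem_filter.2 ⟨Finset.mem_univ _, .refl⟩⟩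
  simp only [Finset.mem_filter, Finset.mem_univ, true_and] at ht hmin
  have hback : ∀ u, Reaches P t u → Reaches P u t := by
    intro u hu
    have h1 : (Finset.univ.filter fun v => Reaches P u v) ⊆
        (Finset.univ.filter fun v => Reaches P t v) := by
      intro v hv
      simp only [Finset.mem_filter, Finset.mem_univ, true_and] at hv ⊢
      exact hu.trans hv
    have h2 := Finset.eq_of_subset_of_card_le h1 (hmin u (ht.trans hu))
    have h3 : t ∈ Finset.univ.filter fun v => Reaches P t v :=
      Finset.mem_filter.2 ⟨Finset.mem_univ _, .refl⟩
    rw [← h2] at h3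
    simpa using h3
  obtain ⟨b, hb, hbmin⟩ := Finset.exists_min_image (Finset.univ.filter fun u => Reaches P t u) id
    ⟨t, Finset.mem_filter.2 ⟨Finset.mem_univ _, .refl⟩⟩
  simp only [Finset.mem_filter, Finset.mem_univ, true_and, id] at hb hbmin
  refine ⟨b, ht.trans hb, fun u hu => ⟨?_, hbmin u (hb.trans hu)⟩⟩
  exact (hback u (hb.trans hu)).trans hb

variable {P} (hP : IsStoch P)

lemma exists_min_reach (P : Matrix (Fin n) (Fin n) ℝ) (f : Fin n → ℝ) (s : Fin n) :
    ∃ m, Reaches P s m ∧ ∀ t, Reaches P s t → f m ≤ f t := by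
  classical
  obtain ⟨m, hm, hmin⟩ := Finset.exists_min_image (Finset.univ.filter fun t => Reaches P s t) f
    ⟨s, Finset.mem_filter.2 ⟨Finset.mem_univ _, .refl⟩⟩
  simp only [Finset.mem_filter, Finset.mem_univ, true_and] at hm hmin
  exact ⟨m, hm, hmin⟩

include hP

/-- Minimum principle for superharmonic functions. -/
lemma eq_of_min {f : Fin n → ℝ} {m : Fin n} (hf : ∀ t, Reaches P m t → P.mulVec f t ≤ f t)
    (hmin : ∀ t, Reaches P m t → f m ≤ f t) {t : Fin n} (ht : Reaches P m t) : f t = f m := by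
  induction ht with
  | refl => rfl
  | @tail u v hu huv ih =>
    have h1 : ∑ x, P u x * (f x - f m) ≤ 0 := by
      have h2 : ∑ x, P u x * (f x - f m) = P.mulVec f u - f m := by
        simp only [mul_sub, Finset.sum_sub_distrib, ← Finset.sum_mul, hP.sum, one_mul]
        rfl
      rw [h2]
      have := hf u hu
      linarith
    have hnn : ∀ x ∈ Finset.univ, 0 ≤ P u x * (f x - f m) := by
      intro x _
      rcases (hP.nonneg u x).eq_or_lt with h0 | h0
      · rw [← h0, zero_mul]
      · exact mul_nonneg h0.le (sub_nonneg.2 (hmin x (hu.tail h0)))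
    have h3 := (Finset.sum_eq_zero_iff_of_nonneg hnn).1
      (le_antisymm h1 (Finset.sum_nonneg hnn)) v (Finset.mem_univ v)
    have h4 := (mul_eq_zero.1 h3).resolve_left huv.ne'
    linarith

/-- Otherwise `g` is superharmonic on the whole component of `b` and strictly so at `b`. By the
minimum principle it is constant on the component, hence harmonic at `b`, a contradiction. -/
lemma mulVec_ge_of_isRep {b : Fin n} (hb : IsRep P b) {g : Fin n → ℝ}
    (hg : ∀ s, ¬ IsRep P s → P.mulVec g s = g s) : g b ≤ P.mulVec g b := by
  by_contra! hlt
  have hsup : ∀ t, Reaches P b t → P.mulVec g t ≤ g t := by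
    intro t ht
    by_cases htr : IsRep P t
    · have h1 := hb t ht
      -- Two representatives of the same component are each at most the other, so they coincide.
      have h2 := htr b h1.1
      obtain rfl : t = b := le_antisymm h2.2 h1.2
      exact hlt.le
    · exact (hg t htr).le
  obtain ⟨m, hm, hmin⟩ := exists_min_reach P g b
  have hconst : ∀ t, Reaches P m t → g t = g m := fun t ht =>
    eq_of_min hP (fun u hu => hsup u (hm.trans hu)) (fun u hu => hmin u (hm.trans hu)) ht
  have hmb := (hb m hm).1
  have : P.mulVec g b = g b := by
    have h1 : ∀ x, P b x * g x = P b x * g b := by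
      intro x
      rcases (hP.nonneg b x).eq_or_lt with h0 | h0
      · rw [← h0, zero_mul, zero_mul]
      · rw [hconst b hmb, hconst x (hmb.tail h0)]
    simp only [Matrix.mulVec, dotProduct, h1]
    rw [← Finset.sum_mul, hP.sum, one_mul]
  linarith

/-- A function that is harmonic outside of the representatives is harmonic. -/
lemma mulVec_eq_of_nonrep {g : Fin n → ℝ} (hg : ∀ s, ¬ IsRep P s → P.mulVec g s = g s) :
    P.mulVec g = g := by
  ext b
  by_cases hb : IsRep P b
  · refine le_antisymm ?_ (mulVec_ge_of_isRep hP hb hg)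
    have := mulVec_ge_of_isRep hP hb (g := -g) fun s hs => by
      rw [Matrix.mulVec_neg, Pi.neg_apply, hg s hs, Pi.neg_apply]
    rw [Matrix.mulVec_neg, Pi.neg_apply, Pi.neg_apply] at this
    linarith
  · exact hg b hb

/-- The minimum is attained at every state reachable from a minimizer, and a representative, where
the value is zero, is among them. -/
lemma nonneg_of_harmonic {h : Fin n → ℝ} (hh : P.mulVec h = h) (h0 : ∀ b, IsRep P b → h b = 0)
    (s : Fin n) : 0 ≤ h s := by
  have : Nonempty (Fin n) := ⟨s⟩
  obtain ⟨m, hm⟩ := Finite.exists_min h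
  obtain ⟨b, hmb, hb⟩ := exists_isRep P m
  have := eq_of_min hP (f := h) (fun t _ => (congrFun hh t).le) (fun t _ => hm t) hmb
  rw [h0 b hb] at this
  rw [this]
  exact hm s

/-- Injectivity of the linear system. -/
lemma system_injective {g h : Fin n → ℝ} (hg : ∀ s, ¬ IsRep P s → P.mulVec g s = g s)
    (hh : ∀ b, IsRep P b → h b = 0) (hw : 0 = g + (h - P.mulVec h)) : g = 0 ∧ h = 0 := by
  have hg' := mulVec_eq_of_nonrep hP hg
  -- The gain is the limit of the averages of the weights, and here the weights are zero.
  have hg0 : g = 0 := by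
    ext s
    have h1 := tendsto_average hP hg' hw s
    simp only [Matrix.mulVec_zero, Pi.zero_apply, Finset.sum_const_zero, mul_zero] at h1
    exact (tendsto_nhds_unique h1 tendsto_const_nhds)
  refine ⟨hg0, ?_⟩
  rw [hg0, zero_add] at hw
  have hPh : P.mulVec h = h := (sub_eq_zero.1 hw.symm).symm
  ext s
  refine le_antisymm ?_ (nonneg_of_harmonic hP hPh hh s)
  have := nonneg_of_harmonic hP (h := -h) (by rw [Matrix.mulVec_neg, hPh])
    (fun b hb => by simp [hh b hb]) s
  simpa using this

lemma pow_mulVec_eq_zero {f : Fin n → ℝ} (i : ℕ) {b : Fin n}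
    (hf : ∀ t, Reaches P b t → f t = 0) : (P ^ i).mulVec f b = 0 := by
  induction i generalizing b with
  | zero => simpa using hf b .refl
  | succ i ih =>
    rw [pow_succ', ← Matrix.mulVec_mulVec]
    change ∑ x, P b x * (P ^ i).mulVec f x = 0
    refine Finset.sum_eq_zero fun x _ => ?_
    rcases (hP.nonneg b x).eq_or_lt with h0 | h0
    · rw [← h0, zero_mul]
    · rw [ih fun t ht => hf t (Relation.ReflTransGen.head h0 ht), mul_zero]

end Graph

namespace MarkovChain

variable {n : ℕ} (C : MarkovChain n)

lemma reachProb_le_one (s : Fin n) (T : Finset (Fin n)) : C.reachProb s T ≤ 1 := measureReal_le_one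

/-- An absorbing target forms a bottom component by itself, so it is its own representative. -/
lemma isRep_of_mem {T : Finset (Fin n)} {t u : Fin n} (ht : t ∈ T) :
    Reaches (C.absorb T) t u ↔ u = t := by
  constructor
  · intro h
    induction h with
    | refl => rfl
    | @tail v w hv hvw ih =>
      subst ih
      by_contra hne
      simp [absorb, ht, Ne.symm hne] at hvw
  · rintro rfl
    exact .refl

/-- `T` is reached almost surely iff it contains all bottom components that can be reached. -/
lemma reachProb_eq_one_iff (s : Fin n) (T : Finset (Fin n)) {g h : Fin n → ℝ}
    (hg : (C.absorb T).mulVec g = g)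
    (hw : (fun t => if t ∈ T then (1 : ℝ) else 0) = g + (h - (C.absorb T).mulVec h)) :
    C.reachProb s T = 1 ↔
      ∀ b, Reaches (C.absorb T) s b → IsRep (C.absorb T) b → b ∈ T := by
  have hP := C.isStoch_absorb T
  have hgr : ∀ t, C.reachProb t T = g t := fun t => C.reachProb_eq t T hg hw
  have hle : ∀ t, g t ≤ 1 := fun t => hgr t ▸ C.reachProb_le_one t T
  constructor
  · intro hs b hsb hb
    by_contra hbT
    -- A target reachable from a representative would have to lead back to it, but targets are
    -- absorbing. So the component avoids `T` and its gain is zero.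
    have hnr : ∀ t, Reaches (C.absorb T) b t → t ∉ T := by
      intro t ht htT
      have := (C.isRep_of_mem htT).1 (hb t ht).1
      exact hbT (this ▸ htT)
    have hgb : g b = 0 := by
      have h1 := tendsto_average hP hg hw b
      have h2 : ∀ i, ((C.absorb T) ^ i).mulVec (fun t => if t ∈ T then (1 : ℝ) else 0) b = 0 :=
        fun i => pow_mulVec_eq_zero hP i fun t ht => if_neg (hnr t ht)
      simp only [h2, Finset.sum_const_zero, mul_zero] at h1
      exact (tendsto_nhds_unique h1 tendsto_const_nhds)
    -- The gain attains its maximal value one at `s`, so it is one at every state reachable from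
    -- `s`.
    have h3 := eq_of_min hP (f := -g) (m := s)
      (fun t _ => by rw [Matrix.mulVec_neg, hg]) (fun t _ => by
        have := hle t
        rw [hgr] at hs
        simp only [Pi.neg_apply, hs]
        linarith) hsb
    rw [hgr] at hs
    simp only [Pi.neg_apply, hs, hgb] at h3
    norm_num at h3
  · intro hT
    obtain ⟨m, hsm, hmin⟩ := exists_min_reach (C.absorb T) g s
    obtain ⟨b, hmb, hb⟩ := exists_isRep (C.absorb T) m
    have hbT := hT b (hsm.trans hmb) hb
    -- In an absorbing state the bias terms cancel, so the gain is the weight itself.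
    have hgb : g b = 1 := by
      have := congrFun hw b
      simp only [hbT, if_true, Pi.add_apply, Pi.sub_apply, C.absorb_mulVec_of_mem hbT,
        sub_self, add_zero] at this
      exact this.symm
    have h1 := eq_of_min hP (fun t _ => (congrFun hg t).le) (fun t ht => hmin t (hsm.trans ht)) hmb
    rw [hgr]
    refine le_antisymm (hle s) ?_
    rw [← hgb, h1]
    exact hmin s .refl

end MarkovChain

end ParamMC

namespace ParamMC

/-! ## Reachability by iteration -/

/-- Indicator of reachability in at most `k` steps along edges `E`. -/
def reachI (E : ℕ → ℕ → ℤ) (n : ℕ) : ℕ → ℕ → ℕ → ℤ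
  | 0, s, t => if s = t then 1 else 0
  | k + 1, s, t =>
    if 0 < reachI E n k s t + ∑ l ∈ Finset.range n, reachI E n k s l * E l t then 1 else 0

lemma reachI_nonneg (E : ℕ → ℕ → ℤ) (n k s t : ℕ) : 0 ≤ reachI E n k s t := by
  cases k <;> simp only [reachI] <;> split_ifs <;> simp

lemma reachI_le_one (E : ℕ → ℕ → ℤ) (n k s t : ℕ) : reachI E n k s t ≤ 1 := by
  cases k <;> simp only [reachI] <;> split_ifs <;> simp

lemma reachI_succ_pos_iff {E : ℕ → ℕ → ℤ} (hE : ∀ s t, 0 ≤ E s t) (n k s t : ℕ) :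
    0 < reachI E n (k + 1) s t ↔
      0 < reachI E n k s t ∨ ∃ l < n, 0 < reachI E n k s l ∧ 0 < E l t := by
  have h0 : ∀ l ∈ Finset.range n, 0 ≤ reachI E n k s l * E l t :=
    fun l _ => mul_nonneg (reachI_nonneg ..) (hE _ _)
  have h1 : 0 < reachI E n (k + 1) s t ↔
      0 < reachI E n k s t + ∑ l ∈ Finset.range n, reachI E n k s l * E l t := by
    simp only [reachI]
    split_ifs with h <;> simp [h]
  have h2 := reachI_nonneg E n k s t
  have h3 := Finset.sum_nonneg h0
  rw [h1]
  constructor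
  · intro h
    by_contra! hcon
    obtain ⟨c1, c2⟩ := hcon
    have : ∑ l ∈ Finset.range n, reachI E n k s l * E l t = 0 := by
      refine Finset.sum_eq_zero fun l hl => ?_
      rcases (reachI_nonneg E n k s l).eq_or_lt with h4 | h4
      · rw [← h4, zero_mul]
      · rw [le_antisymm (c2 l (Finset.mem_range.1 hl) h4) (hE l t), mul_zero]
    omega
  · rintro (h | ⟨l, hl, h4, h5⟩)
    · omega
    · have := Finset.single_le_sum h0 (Finset.mem_range.2 hl)
      have := mul_pos h4 h5
      omega

/-- The sets of states reached in at most `k` steps increase with `k`. They cannot grow strictly `n`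
times inside a set of `n` states, and once they repeat they are closed under edges. -/
lemma reachI_pos_iff {E : ℕ → ℕ → ℤ} (hE : ∀ s t, 0 ≤ E s t) {n : ℕ} (s t : Fin n) :
    0 < reachI E n n s t ↔ Relation.ReflTransGen (fun a b : Fin n => 0 < E a b) s t := by
  classical
  set S : ℕ → Finset (Fin n) := fun k => Finset.univ.filter fun t => 0 < reachI E n k s t with hS
  have hmem : ∀ k t, t ∈ S k ↔ 0 < reachI E n k s t := fun k t => by simp [hS]
  have hstep : ∀ k t, t ∈ S (k + 1) ↔ t ∈ S k ∨ ∃ l ∈ S k, 0 < E l t := by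
    intro k t
    simp only [hmem]
    rw [reachI_succ_pos_iff hE]
    refine or_congr_right ⟨?_, ?_⟩
    · rintro ⟨l, hl, h⟩
      exact ⟨⟨l, hl⟩, h⟩
    · rintro ⟨l, h⟩
      exact ⟨l, l.isLt, h⟩
  have hsub : ∀ k, S k ⊆ S (k + 1) := fun k t ht => (hstep k t).2 (.inl ht)
  have hs0 : s ∈ S 0 := (hmem 0 s).2 (by simp [reachI])
  have hmono : ∀ k, s ∈ S k := fun k => by
    induction k with
    | zero => exact hs0
    | succ k ih => exact hsub k ih
  have hstable : ∃ k < n, S (k + 1) = S k := by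
    by_contra! hcon
    have hcard : ∀ k ≤ n, k + 1 ≤ (S k).card := by
      intro k
      induction k with
      | zero => exact fun _ => Finset.card_pos.2 ⟨s, hs0⟩
      | succ k ih =>
        intro hk
        have h1 := ih (by omega)
        have h2 := Finset.card_lt_card
          (Finset.ssubset_iff_subset_ne.2 ⟨hsub k, (hcon k (by omega)).symm⟩)
        omega
    have h1 := hcard n le_rfl
    have h2 := Finset.card_le_univ (S n)
    rw [Fintype.card_fin] at h2
    omega
  obtain ⟨k, hk, hkS⟩ := hstable
  have hall : ∀ j, S (k + j) = S k := by
    intro j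
    induction j with
    | zero => rfl
    | succ j ih =>
      rw [← hkS]
      ext t
      rw [← add_assoc, hstep, hstep, ih]
  have hn : S n = S k := by
    have := hall (n - k)
    rwa [Nat.add_sub_cancel' hk.le] at this
  have hclosed : ∀ a ∈ S n, ∀ b : Fin n, 0 < E a b → b ∈ S n := by
    intro a ha b hab
    rw [hn] at ha ⊢
    rw [← hkS]
    exact (hstep k b).2 (.inr ⟨a, ha, hab⟩)
  have hsound : ∀ k t, t ∈ S k → Relation.ReflTransGen (fun a b : Fin n => 0 < E a b) s t := by
    intro k
    induction k with
    | zero =>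
      intro t ht
      rw [hmem] at ht
      simp only [reachI] at ht
      split_ifs at ht with h
      · rw [Fin.val_inj] at h
        exact h ▸ .refl
      · exact absurd ht (lt_irrefl _)
    | succ k ih =>
      intro t ht
      rcases (hstep k t).1 ht with h | ⟨l, h1, h2⟩
      · exact ih t h
      · exact (ih l h1).tail h2
  rw [← hmem]
  refine ⟨hsound n t, fun h => ?_⟩
  induction h with
  | refl => exact hmono n
  | tail _ hab ih => exact hclosed _ ih _ hab

/-! ## The parametric linear system -/

/-- All polynomials of an instance: row `s` consists of the transitions from `s`, followed by the
numerator and the denominator of the weight. -/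
noncomputable def WeightedInstance.poly (I : WeightedInstance) (s t : ℕ) : ℚ[X] :=
  if hs : s < I.n then
    if ht : t < I.n then I.M.P ⟨s, hs⟩ ⟨t, ht⟩
    else if t = I.n then (I.wgt ⟨s, hs⟩).num
    else if t = I.n + 1 then (I.wgt ⟨s, hs⟩).den else 0
  else 0

namespace WeightedInstance

variable (I : WeightedInstance) (ab neg : Bool)

/-- Indicator of the target set. -/
def tgt (s : ℕ) : ℤ := if h : s < I.n then (if (⟨s, h⟩ : Fin I.n) ∈ I.T then 1 else 0) else 0

open Classical in
/-- Indicator of the edges; the target states are absorbing if `ab` is set. -/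
noncomputable def edge (s t : ℕ) : ℤ :=
  if 0 < (if ab then I.tgt s else 0) then 0 else if I.poly s t = 0 then 0 else 1

/-- Indicator of the states with an outgoing edge. -/
noncomputable def live (s : ℕ) : ℤ := if 0 < ∑ t ∈ Finset.range I.n, I.edge ab s t then 1 else 0

noncomputable def reach (s t : ℕ) : ℤ := reachI (I.edge ab) I.n I.n s t

/-- Indicator of the representatives of the bottom components. -/
noncomputable def rep (b : ℕ) : ℤ :=
  if (0 : ℤ) < ∑ t ∈ Finset.range I.n, (if 0 < I.reach ab b t then
    (if 0 < I.reach ab t b then (if 0 < (b : ℤ) - t then 1 else 0) else 1) else 0) then 0 else 1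

/-- Product of all denominators. -/
noncomputable def denProd : ℤ :=
  ∏ s ∈ Finset.range I.n, ∏ t ∈ Finset.range (I.n + 2),
    ∏ k ∈ Finset.range ((I.poly s t).natDegree + 1), (((I.poly s t).coeff k).den : ℤ)

/-- The polynomials, scaled by the product of all denominators. -/
noncomputable def hat (s t : ℕ) : ℤ[X] :=
  ∑ k ∈ Finset.range ((I.poly s t).natDegree + 1),
    C (((I.poly s t).coeff k).num * (I.denProd / ((I.poly s t).coeff k).den)) * X ^ k

/-- Selected weights. -/
def sel (s : ℕ) : ℤ := if neg then 1 - I.tgt s else I.tgt s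

end WeightedInstance

/-- Matrix of the linear system for gain and bias. -/
def sysMat {R : Type*} [CommRing R] (n : ℕ) (rep live : ℕ → ℤ) (D : R) (p : ℕ → ℕ → R)
    (x y : ℕ) : R :=
  -- Columns below `n` stand for the gain, the others for the bias. A row below `n` is harmonicity
  -- of the gain, or vanishing of the bias if the state is a representative; a row from `n` on is
  -- the Poisson equation. States that are not live have identity rows in the stochastic matrix, so
  -- the entry of `1 - P` is zero.
  if x < n then
    if y < n then
      if 0 < rep x then 0 else if 0 < live x then (if x = y then D else 0) - p x y else 0
    else if 0 < rep x then (if y = x + n then 1 else 0) else 0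
  else
    if y < n then (if x = y + n then D else 0)
    else if 0 < live (x - n) then (if x = y then D else 0) - p (x - n) (y - n) else 0

/-- All case distinctions depend on the graph only, so the matrix is compatible with every change of
ring. -/
lemma sysMat_map {R S : Type*} [CommRing R] [CommRing S] (φ : R →+* S) (n : ℕ)
    (rep live : ℕ → ℤ) (D : R) (p : ℕ → ℕ → R) (x y : ℕ) :
    φ (sysMat n rep live D p x y) = sysMat n rep live (φ D) (fun s t => φ (p s t)) x y := by
  simp only [sysMat, apply_ite φ, map_sub, map_zero, map_one]

/-- Right hand side of the linear system, scaled. -/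
def sysRhs {R : Type*} [CommRing R] (n : ℕ) (sel : ℕ → ℤ) (D : R) (p : ℕ → ℕ → R) (s : ℕ) : R :=
  D * (sel s : R) * ∏ t ∈ Finset.range n, if t = s then p t n else p t (n + 1)

/-- Scaled solution of the linear system. -/
def sysSol {R : Type*} [CommRing R] (n : ℕ) (rep live sel : ℕ → ℤ) (D : R) (p : ℕ → ℕ → R)
    (x : ℕ) : R :=
  ((2 * n : ℕ) : R) * ∑ l ∈ Finset.range n,
    (fl (sysMat n rep live D p) (2 * n) (2 * n)).1 x (n + l) * sysRhs n sel D p l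

/-- Common denominator of the solution. -/
def sysDen {R : Type*} [CommRing R] (n : ℕ) (rep live : ℕ → ℤ) (D : R) (p : ℕ → ℕ → R) : R :=
  -(fl (sysMat n rep live D p) (2 * n) (2 * n)).2 * ∏ t ∈ Finset.range n, p t (n + 1)

lemma sysRhs_map {R S : Type*} [CommRing R] [CommRing S] (φ : R →+* S) (n : ℕ) (sel : ℕ → ℤ)
    (D : R) (p : ℕ → ℕ → R) (s : ℕ) :
    φ (sysRhs n sel D p s) = sysRhs n sel (φ D) (fun s t => φ (p s t)) s := by
  simp only [sysRhs, map_mul, map_prod, apply_ite φ, map_intCast]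

lemma sysSol_map {R S : Type*} [CommRing R] [CommRing S] (φ : R →+* S) (n : ℕ)
    (rep live sel : ℕ → ℤ) (D : R) (p : ℕ → ℕ → R) (x : ℕ) :
    φ (sysSol n rep live sel D p x) =
      sysSol n rep live sel (φ D) (fun s t => φ (p s t)) x := by
  have h := fl_map φ (sysMat n rep live D p) (2 * n) (2 * n)
  simp only [sysMat_map] at h
  have h1 := congrArg Prod.fst h
  simp only at h1
  simp only [sysSol, map_mul, map_sum, map_natCast, sysRhs_map]
  congr 1
  refine Finset.sum_congr rfl fun l _ => ?_
  rw [← congrFun (congrFun h1 x) (n + l)]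

lemma sysDen_map {R S : Type*} [CommRing R] [CommRing S] (φ : R →+* S) (n : ℕ)
    (rep live : ℕ → ℤ) (D : R) (p : ℕ → ℕ → R) :
    φ (sysDen n rep live D p) = sysDen n rep live (φ D) (fun s t => φ (p s t)) := by
  have h := fl_map φ (sysMat n rep live D p) (2 * n) (2 * n)
  simp only [sysMat_map] at h
  have h1 := congrArg Prod.snd h
  simp only at h1
  simp only [sysDen, map_mul, map_neg, map_prod]
  rw [← h1]

/-- The system matrix in terms of a stochastic matrix. -/
lemma sum_sysMat_mul {n : ℕ} {P : Matrix (Fin n) (Fin n) ℝ} {rep live : ℕ → ℤ} {D : ℝ}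
    {p : ℕ → ℕ → ℝ}
    (hp : ∀ s t : Fin n, (if 0 < live s then (if s = t then D else 0) - p s t else 0) =
      D * ((if s = t then 1 else 0) - P s t)) (x : ℕ → ℝ) (s : Fin n) :
    let g : Fin n → ℝ := fun t => x t
    let h : Fin n → ℝ := fun t => x (n + t)
    (∑ j ∈ Finset.range (2 * n), sysMat n rep live D p s j * x j =
      if 0 < rep s then h s else D * (g s - P.mulVec g s)) ∧
    ∑ j ∈ Finset.range (2 * n), sysMat n rep live D p (n + s) j * x j =
      D * (g s + (h s - P.mulVec h s)) := by
  intro g h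
  have hA : ∀ f : Fin n → ℝ, ∑ t : Fin n, D * ((if s = t then 1 else 0) - P s t) * f t =
      D * (f s - P.mulVec f s) := by
    intro f
    simp only [mul_assoc, ← Finset.mul_sum, sub_mul, Finset.sum_sub_distrib, ite_mul, one_mul,
      zero_mul, Finset.sum_ite_eq, Finset.mem_univ, if_true]
    rfl
  have hval : ∀ a b : Fin n, ((a : ℕ) = b) = (a = b) := fun a b => by rw [Fin.val_inj]
  rw [two_mul, Finset.sum_range_add, Finset.sum_range_add, Finset.sum_range, Finset.sum_range,
    Finset.sum_range, Finset.sum_range]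
  constructor
  · have h1 : ∀ t : Fin n, sysMat n rep live D p s t =
        if 0 < rep s then 0 else D * ((if s = t then 1 else 0) - P s t) := by
      intro t
      rw [← hp]
      simp [sysMat, s.isLt, t.isLt, hval]
    have h2 : ∀ t : Fin n, sysMat n rep live D p s (n + t) =
        if 0 < rep s then (if s = t then 1 else 0) else 0 := by
      intro t
      have : (n + (t : ℕ) = s + n) = (s = t) := by
        rw [← Fin.val_inj, eq_iff_iff]; omega
      simp [sysMat, s.isLt, this]
    simp only [h1, h2]
    split_ifs with hr
    · simp [h]
    · simp only [zero_mul, Finset.sum_const_zero, add_zero]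
      exact hA g
  · have h1 : ∀ t : Fin n, sysMat n rep live D p (n + s) t = if s = t then D else 0 := by
      intro t
      have : (n + (s : ℕ) = t + n) = (s = t) := by
        rw [← Fin.val_inj, eq_iff_iff]; omega
      simp [sysMat, t.isLt, this]
    have h2 : ∀ t : Fin n, sysMat n rep live D p (n + s) (n + t) =
        D * ((if s = t then 1 else 0) - P s t) := by
      intro t
      rw [← hp]
      simp [sysMat, hval]
    simp only [h1, h2]
    have := hA h
    simp only [h] at this ⊢
    rw [this, mul_add]
    simp [g]

/-- The solution of the system consists of the gain and the bias. -/
theorem sysSol_spec {n : ℕ} {P : Matrix (Fin n) (Fin n) ℝ} (hP : IsStoch P)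
    {rep live sel : ℕ → ℤ} {D : ℝ} {p : ℕ → ℕ → ℝ} (hD : D ≠ 0)
    (hrep : ∀ b : Fin n, 0 < rep b ↔ IsRep P b)
    (hp : ∀ s t : Fin n, (if 0 < live s then (if s = t then D else 0) - p s t else 0) =
      D * ((if s = t then 1 else 0) - P s t)) (hden : ∀ s : Fin n, p s (n + 1) ≠ 0) :
    let γ := sysDen n rep live D p
    let g : Fin n → ℝ := fun s => sysSol n rep live sel D p s / γ
    let h : Fin n → ℝ := fun s => sysSol n rep live sel D p (n + s) / γ
    γ ≠ 0 ∧ P.mulVec g = g ∧ (∀ b, IsRep P b → h b = 0) ∧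
      (fun s : Fin n => (sel s : ℝ) * (p s n / p s (n + 1))) = g + (h - P.mulVec h) := by
  intro γ g h
  -- A vector of length `2 * n` is split into gain and bias, which turns a zero of the matrix into a
  -- homogeneous gain and bias system.
  have hinj : ∀ x : ℕ → ℝ,
      (∀ i < 2 * n, ∑ j ∈ Finset.range (2 * n), sysMat n rep live D p i j * x j = 0) →
      ∀ j < 2 * n, x j = 0 := by
    intro x hx
    have e : (fun t : Fin n => x t) = 0 ∧ (fun t : Fin n => x (n + t)) = 0 := by
      refine system_injective hP ?_ ?_ ?_
      · intro s hs
        have h1 := (sum_sysMat_mul (rep := rep) hp x s).1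
        rw [hx s (by omega), if_neg (by rwa [hrep])] at h1
        have := (mul_eq_zero.1 h1.symm).resolve_left hD
        linarith
      · intro b hb
        have h1 := (sum_sysMat_mul (rep := rep) hp x b).1
        rw [hx b (by omega), if_pos ((hrep b).2 hb)] at h1
        exact h1.symm
      · ext s
        have h1 := (sum_sysMat_mul (rep := rep) hp x s).2
        rw [hx (n + s) (by omega)] at h1
        exact ((mul_eq_zero.1 h1.symm).resolve_left hD).symm
    intro j hj
    rcases lt_or_ge j n with hjn | hjn
    · exact congrFun e.1 ⟨j, hjn⟩
    · have := congrFun e.2 ⟨j - n, by omega⟩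
      simpa [Nat.add_sub_cancel' hjn] using this
  obtain ⟨he, hsol⟩ := fl_solve (sysMat n rep live D p) (2 * n) hinj
  set W := ∏ t ∈ Finset.range n, p t (n + 1) with hW
  have hW0 : W ≠ 0 := Finset.prod_ne_zero_iff.2 fun t ht => hden ⟨t, Finset.mem_range.1 ht⟩
  set e := (fl (sysMat n rep live D p) (2 * n) (2 * n)).2 with hedef
  have hγ : γ = -e * W := rfl
  have hγ0 : γ ≠ 0 := by rw [hγ]; exact mul_ne_zero (neg_ne_zero.2 he) hW0
  set b : ℕ → ℝ := fun i => if i < n then 0 else sysRhs n sel D p (i - n) with hb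
  have hx : ∀ j, ((2 * n : ℕ) : ℝ) * ∑ l ∈ Finset.range (2 * n),
      (fl (sysMat n rep live D p) (2 * n) (2 * n)).1 j l * b l = sysSol n rep live sel D p j := by
    intro j
    rw [sysSol]
    congr 1
    conv_lhs => rw [show Finset.range (2 * n) = Finset.range (n + n) by rw [two_mul]]
    rw [Finset.sum_range_add, Finset.sum_eq_zero, zero_add]
    · refine Finset.sum_congr rfl fun l _ => ?_
      simp [hb]
    · intro l hl
      simp [hb, Finset.mem_range.1 hl]
  have hsol' := fun i hi => hsol b i hi
  simp only [hx] at hsol'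
  have hrows : ∀ s : Fin n, (if 0 < rep s then h s else D * (g s - P.mulVec g s)) = 0 ∧
      D * (g s + (h s - P.mulVec h s)) = -e * sysRhs n sel D p s / γ := by
    intro s
    obtain ⟨h1, h2⟩ := sum_sysMat_mul (rep := rep) hp (fun j => sysSol n rep live sel D p j / γ) s
    rw [← h1, ← h2]
    have hdiv : ∀ i, ∑ j ∈ Finset.range (2 * n), sysMat n rep live D p i j *
        (sysSol n rep live sel D p j / γ) =
        (∑ j ∈ Finset.range (2 * n), sysMat n rep live D p i j * sysSol n rep live sel D p j) / γ := by
      intro i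
      rw [Finset.sum_div]
      exact Finset.sum_congr rfl fun j _ => by ring
    rw [hdiv, hdiv, hsol' s (by omega), hsol' (n + s) (by omega)]
    simp [hb]
  refine ⟨hγ0, ?_, ?_, ?_⟩
  · refine mulVec_eq_of_nonrep hP fun s hs => ?_
    have h1 := (hrows s).1
    rw [if_neg (by rwa [hrep])] at h1
    have := (mul_eq_zero.1 h1).resolve_left hD
    linarith
  · intro s hs
    have h1 := (hrows s).1
    rwa [if_pos ((hrep s).2 hs)] at h1
  · ext s
    have h1 := (hrows s).2
    have h2 : sysRhs n sel D p s = D * sel s * (p s n / p s (n + 1)) * W := by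
      rw [sysRhs]
      -- Multiplying the weight of `s` by the denominators of all weights replaces the factor of `s`
      -- by its numerator. This keeps the right hand side polynomial.
      have h3 : (∏ t ∈ Finset.range n, if t = (s : ℕ) then p t n else p t (n + 1)) =
          p s n / p s (n + 1) * W := by
        have hs := Finset.mem_range.2 s.isLt
        rw [hW, ← Finset.mul_prod_erase _ _ hs, ← Finset.mul_prod_erase _ _ hs, if_pos rfl,
          Finset.prod_congr rfl (g := fun t => p t (n + 1)) fun t ht =>
            if_neg (Finset.ne_of_mem_erase ht)]
        have := hden s
        field_simp
      rw [h3]; ring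
    rw [h2, hγ] at h1
    have h4 : D * (g s + (h s - P.mulVec h s)) = D * (sel s * (p s n / p s (n + 1))) := by
      rw [h1]
      field_simp
    exact (mul_left_cancel₀ hD h4).symm

end ParamMC

/-! ### Specialization of the parametric system at an admissible value -/

namespace ParamMC

namespace WeightedInstance

variable (I : WeightedInstance) (ab neg : Bool)

lemma poly_trans (s t : Fin I.n) : I.poly s t = I.M.P s t := by simp [poly]

lemma poly_num (s : Fin I.n) : I.poly s I.n = (I.wgt s).num := by simp [poly]

lemma poly_den (s : Fin I.n) : I.poly s (I.n + 1) = (I.wgt s).den := by simp [poly]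

lemma tgt_pos_iff (s : Fin I.n) : 0 < I.tgt s ↔ s ∈ I.T := by
  simp only [tgt, s.isLt, dif_pos, Fin.eta]; split_ifs <;> simp_all

lemma tgt_eq (s : Fin I.n) : I.tgt s = if s ∈ I.T then 1 else 0 := by
  simp only [tgt, s.isLt, dif_pos, Fin.eta]

lemma edge_nonneg (s t : ℕ) : 0 ≤ I.edge ab s t := by
  unfold edge; split_ifs <;> simp

lemma edge_pos_iff (s t : Fin I.n) :
    0 < I.edge ab s t ↔ ¬ (ab = true ∧ s ∈ I.T) ∧ I.M.P s t ≠ 0 := by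
  unfold edge
  rw [I.poly_trans]
  cases ab
  · simp; split_ifs <;> simp_all
  · simp only [if_true, I.tgt_pos_iff]
    split_ifs <;> simp_all

lemma live_pos_iff (s : Fin I.n) :
    0 < I.live ab s ↔ ¬ (ab = true ∧ s ∈ I.T) ∧ ¬ IsTrap I.M.P s := by
  have h1 : 0 < I.live ab s ↔ 0 < ∑ t : Fin I.n, I.edge ab s t := by
    rw [← Finset.sum_range]
    unfold live; split_ifs <;> simp_all
  rw [h1, Finset.sum_pos_iff_of_nonneg fun (t : Fin I.n) _ => I.edge_nonneg ab s t]
  simp only [edge_pos_iff, IsTrap, Finset.mem_univ, true_and, not_forall]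
  exact exists_and_left

lemma den_dvd_denProd {s t k : ℕ} (hs : s < I.n) (ht : t < I.n + 2)
    (hk : k < (I.poly s t).natDegree + 1) : (((I.poly s t).coeff k).den : ℤ) ∣ I.denProd :=
  ((Finset.dvd_prod_of_mem _ (Finset.mem_range.2 hk)).trans
    (Finset.dvd_prod_of_mem (fun t => ∏ k ∈ Finset.range ((I.poly s t).natDegree + 1),
      (((I.poly s t).coeff k).den : ℤ)) (Finset.mem_range.2 ht))).trans
    (Finset.dvd_prod_of_mem (fun s => ∏ t ∈ Finset.range (I.n + 2),
      ∏ k ∈ Finset.range ((I.poly s t).natDegree + 1), (((I.poly s t).coeff k).den : ℤ))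
      (Finset.mem_range.2 hs))

lemma denProd_pos : 0 < I.denProd :=
  Finset.prod_pos fun _ _ => Finset.prod_pos fun _ _ => Finset.prod_pos fun _ _ => by
    exact_mod_cast Rat.den_pos _

lemma aeval_hat {s t : ℕ} (hs : s < I.n) (ht : t < I.n + 2) (ξ : ℝ) :
    aeval ξ (I.hat s t) = I.denProd * aeval ξ (I.poly s t) := by
  rw [aeval_eq_sum_range (p := I.poly s t), hat, map_sum, Finset.mul_sum]
  refine Finset.sum_congr rfl fun k hk => ?_
  set q := (I.poly s t).coeff k with hq
  obtain ⟨c, hc⟩ := I.den_dvd_denProd hs ht (Finset.mem_range.1 hk)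
  rw [← hq] at hc
  have hq0 : ((q.den : ℤ)) ≠ 0 := by exact_mod_cast q.den_nz
  rw [hc, Int.mul_ediv_cancel_left _ hq0]
  have h1 : (q.num : ℝ) = q * q.den := by
    have := Rat.num_div_den q
    have h2 : (q.num : ℚ) = q * q.den := by
      rw [eq_comm, ← eq_div_iff (by exact_mod_cast q.den_nz)]; exact this.symm
    exact_mod_cast h2
  simp only [map_mul, map_pow, aeval_X, aeval_C, algebraMap_int_eq, Int.coe_castRingHom,
    Rat.smul_def]
  push_cast
  rw [h1]
  ring

/-- The transition matrix of the instantiated chain; the targets are absorbing if `ab` is set. -/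
noncomputable def mat (ξ : ℝ) (hξ : I.M.Admissible ξ) : Matrix (Fin I.n) (Fin I.n) ℝ :=
  if ab then (I.M.inst ξ hξ).absorb I.T else (I.M.inst ξ hξ).trans

variable {ξ : ℝ} (hξ : I.M.Admissible ξ)

/-- No edge polynomial vanishes at an admissible value. Hence the graph of the instantiated chain
can be read off symbolically. -/
lemma isTrap_inst (s : Fin I.n) : IsTrap (I.M.inst ξ hξ).P s ↔ IsTrap I.M.P s := by
  refine forall_congr' fun t => ?_
  change I.M.evalP ξ s t = 0 ↔ _
  refine ⟨fun h => ?_, fun h => by simp [PolyPMC.evalP, h]⟩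
  by_contra h0
  exact ((hξ.2 s t).2 h0).ne' h

lemma isStoch_mat : IsStoch (I.mat ab ξ hξ) := by
  unfold mat
  split_ifs
  · exact MarkovChain.isStoch_absorb _ _
  · exact MarkovChain.isStoch_trans _

-- Traps, and the targets if they are made absorbing, are the states without outgoing edges in the
-- graph; precisely these have identity rows.
open Classical in
lemma mat_apply (s t : Fin I.n) : I.mat ab ξ hξ s t =
    if 0 < I.live ab s then I.M.evalP ξ s t else if s = t then 1 else 0 := by
  have h1 : (I.M.inst ξ hξ).stepProb s t =
      if IsTrap I.M.P s then (if s = t then 1 else 0) else I.M.evalP ξ s t := by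
    simp only [MarkovChain.stepProb, I.isTrap_inst hξ]
    rfl
  simp only [live_pos_iff]
  cases ab
  · simp only [mat]
    by_cases h : IsTrap I.M.P s <;> simp [h, MarkovChain.trans, h1]
  · simp only [mat, MarkovChain.absorb, if_true, Matrix.of_apply, h1]
    by_cases h : IsTrap I.M.P s <;> by_cases h' : s ∈ I.T <;> simp [h, h']

lemma mat_pos_iff (s t : Fin I.n) : 0 < I.mat ab ξ hξ s t ↔
    0 < I.edge ab s t ∨ (¬ 0 < I.live ab s ∧ s = t) := by
  rw [mat_apply, edge_pos_iff]
  by_cases h : 0 < I.live ab s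
  · have := ((I.live_pos_iff ab s).1 h).1
    simp only [h, if_true, hξ.2 s t, this, not_false_eq_true, true_and, not_true_eq_false,
      false_and, or_false]
  · rw [if_neg h]
    have h2 : ¬ (¬ (ab = true ∧ s ∈ I.T) ∧ I.M.P s t ≠ 0) := fun ⟨h3, h4⟩ =>
      h ((I.live_pos_iff ab s).2 ⟨h3, fun htr => h4 (htr t)⟩)
    simp only [h2, h, not_false_eq_true, true_and, false_or]
    split_ifs with h3 <;> simp [h3]

/-- The self-loops of traps and absorbing targets have positive probability without being edges, but
they do not create new reachable states. Only the right side involves the parameter. -/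
lemma reach_pos_iff (s t : Fin I.n) : 0 < I.reach ab s t ↔ Reaches (I.mat ab ξ hξ) s t := by
  rw [reach, reachI_pos_iff (I.edge_nonneg ab)]
  constructor
  · exact Relation.ReflTransGen.mono (fun a b hab => (I.mat_pos_iff ab hξ a b).2 (.inl hab)) _ _
  · intro h
    induction h with
    | refl => exact .refl
    | @tail u v _ huv ih =>
      rcases (I.mat_pos_iff ab hξ u v).1 huv with h1 | ⟨_, rfl⟩
      · exact ih.tail h1
      · exact ih

lemma rep_pos_iff (b : Fin I.n) : 0 < I.rep ab b ↔ IsRep (I.mat ab ξ hξ) b := by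
  set F : ℕ → ℤ := fun t => if 0 < I.reach ab b t then
    (if 0 < I.reach ab t b then (if 0 < ((b : ℕ) : ℤ) - t then 1 else 0) else 1) else 0 with hF
  have h0 : ∀ t : Fin I.n, t ∈ Finset.univ → 0 ≤ F t := by
    intro t _
    simp only [hF]; split_ifs <;> simp
  have h1 : 0 < I.rep ab b ↔ ¬ 0 < ∑ t : Fin I.n, F t := by
    rw [← Finset.sum_range]
    rw [rep]
    split_ifs with h <;> simp only [lt_irrefl, zero_lt_one, false_iff, true_iff, not_not] <;> exact h
  rw [h1, Finset.sum_pos_iff_of_nonneg h0]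
  push Not
  refine forall_congr' fun t => ?_
  rw [← I.reach_pos_iff ab hξ, ← I.reach_pos_iff ab hξ, Fin.le_def]
  simp only [Finset.mem_univ, hF, true_imp_iff]
  split_ifs <;> omega

/-- Scaled solution of the parametric linear system. -/
noncomputable def solNum (x : ℕ) : ℤ[X] :=
  sysSol I.n (I.rep ab) (I.live ab) (I.sel neg) (C I.denProd) I.hat x

/-- Common denominator of the solution of the parametric linear system. -/
noncomputable def solDen : ℤ[X] := sysDen I.n (I.rep ab) (I.live ab) (C I.denProd) I.hat

/-- Component of the solution of the linear system at `ξ`. -/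
noncomputable def sol (ξ : ℝ) (x : ℕ) : ℝ := aeval ξ (I.solNum ab neg x) / aeval ξ (I.solDen ab)

/-- The polynomial solution is specialized along evaluation at `ξ`, under which it becomes the
solution of the real system. Invertibility of that real system makes the common denominator nonzero
at `ξ`. The scaling by `denProd` cancels in the transition probabilities and in the weights. -/
theorem sol_spec (hw : I.WeightsDefinedAt ξ) :
    let P := I.mat ab ξ hξ
    let g : Fin I.n → ℝ := fun s => I.sol ab neg ξ s
    let h : Fin I.n → ℝ := fun s => I.sol ab neg ξ (I.n + s)
    aeval ξ (I.solDen ab) ≠ 0 ∧ P.mulVec g = g ∧ (∀ b, IsRep P b → h b = 0) ∧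
      (fun s : Fin I.n => (I.sel neg s : ℝ) * I.evalWgt ξ s) = g + (h - P.mulVec h) := by
  have hD : (I.denProd : ℝ) ≠ 0 := by exact_mod_cast I.denProd_pos.ne'
  have key := sysSol_spec (P := I.mat ab ξ hξ) (rep := I.rep ab) (live := I.live ab)
    (sel := I.sel neg) (D := (I.denProd : ℝ)) (p := fun s t => aeval ξ (I.hat s t))
    (I.isStoch_mat ab hξ) hD (I.rep_pos_iff ab hξ) ?_ ?_
  · have e1 : ∀ x, sysSol I.n (I.rep ab) (I.live ab) (I.sel neg) (I.denProd : ℝ)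
        (fun s t => aeval ξ (I.hat s t)) x = aeval ξ (I.solNum ab neg x) := by
      intro x
      have := sysSol_map (aeval ξ : ℤ[X] →ₐ[ℤ] ℝ).toRingHom I.n (I.rep ab) (I.live ab) (I.sel neg)
        (C I.denProd) I.hat x
      simp only [AlgHom.toRingHom_eq_coe, RingHom.coe_coe, aeval_C, algebraMap_int_eq,
        Int.coe_castRingHom] at this
      exact this.symm
    have e2 : sysDen I.n (I.rep ab) (I.live ab) (I.denProd : ℝ) (fun s t => aeval ξ (I.hat s t)) =
        aeval ξ (I.solDen ab) := by
      have := sysDen_map (aeval ξ : ℤ[X] →ₐ[ℤ] ℝ).toRingHom I.n (I.rep ab) (I.live ab)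
        (C I.denProd) I.hat
      simp only [AlgHom.toRingHom_eq_coe, RingHom.coe_coe, aeval_C, algebraMap_int_eq,
        Int.coe_castRingHom] at this
      exact this.symm
    simp only [e1, e2] at key
    refine ⟨key.1, key.2.1, key.2.2.1, ?_⟩
    refine Eq.trans ?_ key.2.2.2
    ext s
    rw [I.aeval_hat s.isLt (by omega), I.aeval_hat s.isLt (by omega), poly_num, poly_den,
      mul_div_mul_left _ _ hD]
    rfl
  · intro s t
    rw [mat_apply, I.aeval_hat s.isLt (by omega), poly_trans]
    split_ifs with h1 h2 <;> simp [PolyPMC.evalP] <;> ring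
  · intro s
    rw [I.aeval_hat s.isLt (by omega), poly_den]
    exact mul_ne_zero hD (hw s)

/-- Component of the solution, as a fraction. -/
noncomputable def solFrac (x : ℕ) : Fraction where
  num := (I.solNum ab neg x).map (Int.castRingHom ℚ)
  -- The computed denominator is the zero polynomial only if there is no admissible value at which
  -- all weights are defined. Then nothing has to be shown, and any nonzero default will do.
  den := open Classical in
    (if I.solDen ab = 0 then 1 else I.solDen ab).map (Int.castRingHom ℚ)
  den_ne_zero := by
    rw [Ne, Polynomial.map_eq_zero_iff (RingHom.injective_int _)]
    split_ifs with h
    · exact one_ne_zero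
    · exact h

lemma solFrac_eval (h : aeval ξ (I.solDen ab) ≠ 0) (x : ℕ) :
    (I.solFrac ab neg x).DefinedAt ξ ∧ (I.solFrac ab neg x).eval ξ = I.sol ab neg ξ x := by
  have h0 : I.solDen ab ≠ 0 := by rintro h0; simp [h0] at h
  have e : ∀ p : ℤ[X], aeval ξ (p.map (Int.castRingHom ℚ)) = aeval ξ p := fun p =>
    aeval_map_algebraMap ℚ ξ p
  simp only [Fraction.DefinedAt, Fraction.eval, solFrac, if_neg h0, e, sol]
  exact ⟨h, trivial⟩

/-- Positive if the target set is not reached almost surely (for `ab = true`). -/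
noncomputable def miss (s : ℕ) : ℤ :=
  ∑ b ∈ Finset.range I.n, if 0 < I.reach ab s b then
    (if 0 < I.rep ab b then 1 - I.tgt b else 0) else 0

end WeightedInstance

/-! ### The three quantities as components of the solution -/

/-- The instance with all weights equal to one. -/
noncomputable def Instance.weighted (I : Instance) : WeightedInstance :=
  { I with wgt := fun _ => ⟨1, 1, one_ne_zero⟩ }

lemma Instance.weighted_defined (I : Instance) (ξ : ℝ) : I.weighted.WeightsDefinedAt ξ := by
  intro s; simp [Fraction.DefinedAt, Instance.weighted]

lemma Instance.weighted_evalWgt (I : Instance) (ξ : ℝ) (s : Fin I.n) :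
    I.weighted.evalWgt ξ s = 1 := by
  simp [WeightedInstance.evalWgt, Fraction.eval, Instance.weighted]

lemma Instance.gain_spec (I : Instance) {ξ : ℝ} (hξ : I.M.Admissible ξ) :
    ∃ h : Fin I.n → ℝ,
      let P := (I.M.inst ξ hξ).absorb I.T
      let g : Fin I.n → ℝ := fun s => I.weighted.sol true false ξ s
      aeval ξ (I.weighted.solDen true) ≠ 0 ∧ P.mulVec g = g ∧
      (fun t => if t ∈ I.T then (1 : ℝ) else 0) = g + (h - P.mulVec h) := by
  obtain ⟨h1, h2, _, h4⟩ := I.weighted.sol_spec true false hξ (I.weighted_defined ξ)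
  refine ⟨_, h1, h2, Eq.trans ?_ h4⟩
  ext s
  have h5 := I.weighted_evalWgt ξ s
  have h6 := I.weighted.tgt_eq s
  change _ = ((I.weighted.tgt s : ℤ) : ℝ) * _
  rw [h5, h6, mul_one, Int.cast_ite, Int.cast_one, Int.cast_zero]
  rfl

theorem Instance.reachProb_spec (I : Instance) (s : Fin I.n) {ξ : ℝ} (hξ : I.M.Admissible ξ) :
    (I.weighted.solFrac true false s).DefinedAt ξ ∧
      (I.weighted.solFrac true false s).eval ξ = (I.M.inst ξ hξ).reachProb s I.T := by
  obtain ⟨h, h1, h2, h3⟩ := I.gain_spec hξ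
  refine ⟨(I.weighted.solFrac_eval true false h1 s).1, ?_⟩
  rw [(I.weighted.solFrac_eval true false h1 s).2, (I.M.inst ξ hξ).reachProb_eq s I.T h2 h3]

/-- The left side does not mention `ξ`: reaching `T` almost surely is a property of the graph,
namely that no representative outside `T` can be reached. The answer can therefore be decided once
for all admissible values. -/
theorem WeightedInstance.miss_eq_zero_iff (I : WeightedInstance) (s : Fin I.n) {ξ : ℝ}
    (hξ : I.M.Admissible ξ) : ¬ 0 < I.miss true s ↔ (I.M.inst ξ hξ).reachProb s I.T = 1 := by
  obtain ⟨h, h1, h2, h3⟩ := I.toInstance.gain_spec hξ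
  rw [(I.M.inst ξ hξ).reachProb_eq_one_iff s I.T h2 h3]
  set F : ℕ → ℤ := fun b => if 0 < I.reach true s b then
    (if 0 < I.rep true b then 1 - I.tgt b else 0) else 0 with hF
  have h0 : ∀ b : Fin I.n, b ∈ Finset.univ → 0 ≤ F b := by
    intro b _
    simp only [hF, I.tgt_eq]; split_ifs <;> simp
  have h1 : I.miss true s = ∑ b : Fin I.n, F b := by
    rw [← Finset.sum_range]; rfl
  rw [h1, Finset.sum_pos_iff_of_nonneg h0]
  push Not
  refine forall_congr' fun b => ?_
  have e1 := I.reach_pos_iff true hξ s b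
  have e2 := I.rep_pos_iff true hξ b
  simp only [mat, if_true] at e1 e2
  rw [← e1, ← e2]
  simp only [Finset.mem_univ, hF, true_imp_iff, I.tgt_eq]
  split_ifs <;> simp_all

theorem WeightedInstance.accWeight_spec (I : WeightedInstance) (s : Fin I.n) {ξ : ℝ}
    (hξ : I.M.Admissible ξ) (hw : I.WeightsDefinedAt ξ)
    (hs : (I.M.inst ξ hξ).reachProb s I.T = 1) :
    (I.solFrac true true (I.n + s)).DefinedAt ξ ∧
    Integrable (accWeight (I.evalWgt ξ) I.T) ((I.M.inst ξ hξ).pathMeasure s) ∧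
    (I.solFrac true true (I.n + s)).eval ξ =
      ∫ ω, accWeight (I.evalWgt ξ) I.T ω ∂((I.M.inst ξ hξ).pathMeasure s) := by
  obtain ⟨h1, h2, h3, h4⟩ := I.sol_spec true true hξ hw
  -- The same system with all weights equal to one supplies the Poisson equation for the expected
  -- hitting time, which is needed for integrability.
  obtain ⟨_, h2', _, h4'⟩ := I.toInstance.weighted.sol_spec true true hξ
    (I.toInstance.weighted_defined ξ)
  have hsel : ∀ t : Fin I.n, (I.sel true t : ℝ) = if t ∈ I.T then 0 else 1 := by
    intro t
    simp only [sel, if_true, I.tgt_eq]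
    split_ifs <;> simp
  have key := (I.M.inst ξ hξ).accWeight_eq s I.T (w := I.evalWgt ξ) hs ?_ h2 (Eq.trans ?_ h4) h2'
    (Eq.trans ?_ h4')
  · refine ⟨(I.solFrac_eval true true h1 _).1, key.1, ?_⟩
    rw [(I.solFrac_eval true true h1 _).2, key.2]
  · intro t ht
    -- Targets are their own representatives, so the normalization of the system already sets the
    -- bias to zero on `T`.
    refine h3 t fun u hu => ?_
    rw [mat, if_pos rfl, MarkovChain.isRep_of_mem _ ht] at hu
    rw [hu]
    exact ⟨.refl, le_rfl⟩
  · ext t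
    rw [hsel, MarkovChain.off]
    split_ifs <;> simp
  · ext t
    rw [I.toInstance.weighted_evalWgt]
    change _ = ((I.sel true t : ℤ) : ℝ) * 1
    rw [hsel, MarkovChain.off]
    split_ifs <;> simp

theorem WeightedInstance.meanPayoff_spec (I : WeightedInstance) (s : Fin I.n) {ξ : ℝ}
    (hξ : I.M.Admissible ξ) (hw : I.WeightsDefinedAt ξ) :
    (I.solFrac false false s).DefinedAt ξ ∧
    Integrable (meanPayoff (I.evalWgt ξ) I.T) ((I.M.inst ξ hξ).pathMeasure s) ∧
    (I.solFrac false false s).eval ξ =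
      ∫ ω, meanPayoff (I.evalWgt ξ) I.T ω ∂((I.M.inst ξ hξ).pathMeasure s) := by
  obtain ⟨h1, h2, h3, h4⟩ := I.sol_spec false false hξ hw
  have key := (I.M.inst ξ hξ).meanPayoff_eq s I.T (w := I.evalWgt ξ) h2 (Eq.trans ?_ h4)
  · refine ⟨(I.solFrac_eval false false h1 _).1, key.1, ?_⟩
    rw [(I.solFrac_eval false false h1 _).2, key.2]
  · ext t
    have : (I.sel false t : ℝ) = if t ∈ I.T then 1 else 0 := by
      simp only [sel, Bool.false_eq_true, if_false, I.tgt_eq]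
      split_ifs <;> simp
    rw [this]
    split_ifs <;> simp

end ParamMC

namespace ParamMC

/-! ## Size of the output -/

/-- The extra `1` per summand pays both for the doubling caused by an addition and for the factor `2
^ k`, as at least `k` such units have accumulated by then. -/
lemma sum_two_pow_le (a : ℕ → ℕ) (m : ℕ) :
    ∑ k ∈ Finset.range m, 2 ^ a k * 2 ^ k ≤ 2 ^ ∑ k ∈ Finset.range m, (a k + 1) := by
  induction m with
  | zero => simp
  | succ m ih =>
    rw [Finset.sum_range_succ, Finset.sum_range_succ]
    have h1 : m ≤ ∑ k ∈ Finset.range m, (a k + 1) := by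
      rw [Finset.sum_add_distrib]; simp
    set S := ∑ k ∈ Finset.range m, (a k + 1)
    have h2 : 2 ^ S ≤ 2 ^ (a m + S) := Nat.pow_le_pow_right (by norm_num) (by omega)
    have h3 : 2 ^ a m * 2 ^ m ≤ 2 ^ (a m + S) := by
      rw [← pow_add]; exact Nat.pow_le_pow_right (by norm_num) (by omega)
    calc _ ≤ 2 ^ (a m + S) + 2 ^ (a m + S) := by omega
      _ = 2 ^ (S + (a m + 1)) := by ring

namespace WeightedInstance

variable (I : WeightedInstance) (ab neg : Bool)

/-- Size of the coefficients of one polynomial. -/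
noncomputable def polySize (s t : ℕ) : ℕ := ∑ k ∈ Finset.range ((I.poly s t).natDegree + 1),
  (((I.poly s t).coeff k).num.natAbs.size + ((I.poly s t).coeff k).den.size + 1)

/-- Size of all coefficients. -/
noncomputable def totalSize : ℕ :=
  ∑ s ∈ Finset.range I.n, ∑ t ∈ Finset.range (I.n + 2), I.polySize s t

/-- Bound for the number of bits of the coefficients of the output. -/
noncomputable def precision : ℕ := 16 * ((I.totalSize + I.n + 1) * (I.totalSize + I.n + 1))

lemma polySize_le {s t : ℕ} (hs : s < I.n) (ht : t < I.n + 2) : I.polySize s t ≤ I.totalSize :=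
  (Finset.single_le_sum (f := fun t => I.polySize s t) (fun _ _ => Nat.zero_le _)
    (Finset.mem_range.2 ht)).trans
    (Finset.single_le_sum (f := fun s => ∑ t ∈ Finset.range (I.n + 2), I.polySize s t)
      (fun _ _ => Nat.zero_le _) (Finset.mem_range.2 hs))

lemma natDegree_lt_polySize (s t : ℕ) : (I.poly s t).natDegree < I.polySize s t := by
  rw [polySize, Finset.sum_add_distrib]
  simp only [Finset.sum_const, Finset.card_range, smul_eq_mul, mul_one]
  omega

lemma denProd_le : I.denProd.natAbs ≤ 2 ^ I.totalSize := by
  rw [denProd]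
  simp only [totalSize, polySize, ← Finset.prod_pow_eq_pow_sum]
  refine (isSize_natAbs.prod _ _).trans (Finset.prod_le_prod' fun s _ =>
    (isSize_natAbs.prod _ _).trans (Finset.prod_le_prod' fun t _ =>
      (isSize_natAbs.prod _ _).trans (Finset.prod_le_prod' fun k _ => ?_)))
  rw [Int.natAbs_natCast]
  exact (Nat.lt_size_self _).le.trans (Nat.pow_le_pow_right (by norm_num) (by omega))

/-- One factor `2 ^ totalSize` bounds the part of the common denominator that multiplies a
numerator, the other bounds the numerators together with the powers of two. -/
lemma nu_hat_le {s t : ℕ} (hs : s < I.n) (ht : t < I.n + 2) :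
    nu (I.hat s t) ≤ 2 ^ (2 * I.totalSize) := by
  set D := 2 ^ I.totalSize with hD
  calc nu (I.hat s t) ≤ ∑ k ∈ Finset.range ((I.poly s t).natDegree + 1),
        D * (2 ^ (((I.poly s t).coeff k).num.natAbs.size + ((I.poly s t).coeff k).den.size)
          * 2 ^ k) := by
        refine (nu_sum_le _ _).trans (Finset.sum_le_sum fun k hk => ?_)
        rw [C_mul_X_pow_eq_monomial, nu_monomial, Int.natAbs_mul, ← mul_assoc]
        refine Nat.mul_le_mul_right _ ?_
        rw [mul_comm]
        refine Nat.mul_le_mul ?_ ?_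
        · refine le_trans ?_ I.denProd_le
          rw [Int.natAbs_ediv_of_dvd (I.den_dvd_denProd hs ht (Finset.mem_range.1 hk))]
          exact Nat.div_le_self _ _
        · exact (Nat.lt_size_self _).le.trans (Nat.pow_le_pow_right (by norm_num) (by omega))
    _ ≤ D * 2 ^ I.polySize s t := by
        rw [← Finset.mul_sum]
        exact Nat.mul_le_mul_left _ (sum_two_pow_le _ _)
    _ ≤ D * D := Nat.mul_le_mul_left _ (Nat.pow_le_pow_right (by norm_num) (I.polySize_le hs ht))
    _ = 2 ^ (2 * I.totalSize) := by rw [hD, ← pow_add]; ring_nf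

lemma nu_C_denProd_le : nu (C I.denProd) ≤ 2 ^ I.totalSize := by
  have := nu_monomial 0 I.denProd
  rw [monomial_zero_left, pow_zero, mul_one] at this
  rw [this]
  exact I.denProd_le

/-- The matrix of the parametric linear system. -/
noncomputable def matP : ℕ → ℕ → ℤ[X] :=
  sysMat I.n (I.rep ab) (I.live ab) (C I.denProd) I.hat

lemma nu_matP_le {x y : ℕ} (hx : x < 2 * I.n) (hy : y < 2 * I.n) :
    nu (I.matP ab x y) ≤ 2 ^ (2 * I.totalSize + 1) := by
  have h0 : ∀ p : ℤ[X], nu p ≤ 0 ∨ nu p ≤ 1 ∨ nu p ≤ 2 ^ I.totalSize →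
      nu p ≤ 2 ^ (2 * I.totalSize + 1) := by
    rintro p (h | h | h)
    · exact h.trans (Nat.zero_le _)
    · exact h.trans Nat.one_le_two_pow
    · exact h.trans (Nat.pow_le_pow_right (by norm_num) (by omega))
  have hd : ∀ {s t : ℕ} (q : Prop) [Decidable q], s < I.n → t < I.n →
      nu ((if q then C I.denProd else 0) - I.hat s t) ≤ 2 ^ (2 * I.totalSize + 1) := by
    intro s t q _ hs ht
    have h1 : nu (if q then C I.denProd else 0) ≤ 2 ^ (2 * I.totalSize) := by
      split_ifs
      · exact I.nu_C_denProd_le.trans (Nat.pow_le_pow_right (by norm_num) (by omega))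
      · simp [isSize_nu.zero]
    have h2 := I.nu_hat_le hs (show t < I.n + 2 by omega)
    rw [sub_eq_add_neg]
    refine (nu_add_le _ _).trans ?_
    rw [isSize_nu.neg, pow_succ]
    omega
  unfold matP sysMat
  split_ifs
  all_goals first
    | exact h0 _ (.inl isSize_nu.zero.le)
    | exact h0 _ (.inr (.inl isSize_nu.one))
    | exact h0 _ (.inr (.inr I.nu_C_denProd_le))
    | skip
  · have := hd (x = y) ‹x < I.n› ‹y < I.n›
    simpa [*] using this
  · have := hd (x = y) ‹x < I.n› ‹y < I.n›
    simpa [*] using this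
  · have := hd (x = y) (show x - I.n < I.n by omega) (show y - I.n < I.n by omega)
    simpa [*] using this
  · have := hd (x = y) (show x - I.n < I.n by omega) (show y - I.n < I.n by omega)
    simpa [*] using this

/-- The bound for the recursion with `m = 2 * n` and entries of size at most `2 ^ (2 * totalSize +
1)`, rewritten as a power of two by means of `n ≤ 2 ^ n`. The case `n = 0` is separate, because that
bound assumes a nonempty matrix. -/
lemma nu_fl_le : ∃ H, H ≤ (2 * I.totalSize + 2 * I.n + 4) * (2 * I.n + 1) ∧
    (∀ x < 2 * I.n, ∀ y < 2 * I.n, nu ((fl (I.matP ab) (2 * I.n) (2 * I.n)).1 x y) ≤ 2 ^ H) ∧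
      nu (fl (I.matP ab) (2 * I.n) (2 * I.n)).2 ≤ 2 ^ H := by
  refine ⟨_, le_rfl, ?_⟩
  rcases Nat.eq_zero_or_pos I.n with h0 | hpos
  · rw [h0]
    refine ⟨fun x hx => absurd hx (by omega), ?_⟩
    exact isSize_nu.one.trans Nat.one_le_two_pow
  have key := isSize_nu.fl_le (A := I.matP ab) (m := 2 * I.n) (c := 2 ^ (2 * I.totalSize + 1))
    (by omega) Nat.one_le_two_pow (fun x hx y hy => I.nu_matP_le ab hx hy) _ le_rfl
  have h1 : 2 * (2 * I.n) ^ 2 * 2 ^ (2 * I.totalSize + 1) ≤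
      2 ^ (2 * I.totalSize + 2 * I.n + 4) := by
    have : I.n ≤ 2 ^ I.n := Nat.lt_two_pow_self.le
    calc _ ≤ 2 * (2 * 2 ^ I.n) ^ 2 * 2 ^ (2 * I.totalSize + 1) := by gcongr
      _ = _ := by ring
  have h2 : (2 * (2 * I.n) ^ 2 * 2 ^ (2 * I.totalSize + 1)) ^ (2 * I.n) ≤
      2 ^ ((2 * I.totalSize + 2 * I.n + 4) * (2 * I.n)) := by
    rw [pow_mul _ _ (2 * I.n)]; exact Nat.pow_le_pow_left h1 _
  refine ⟨fun x hx y hy => ((key.1 x hx y hy).trans h2).trans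
    (Nat.pow_le_pow_right (by norm_num) (by gcongr; omega)), key.2.trans ?_⟩
  calc _ ≤ 2 ^ (2 * I.totalSize + 2 * I.n + 4) *
        2 ^ ((2 * I.totalSize + 2 * I.n + 4) * (2 * I.n)) :=
        Nat.mul_le_mul (le_trans (by rw [mul_assoc]; omega) h1) h2
    _ = _ := by rw [← pow_add]; ring_nf

open Classical in
/-- The numerators of the solution, followed by the denominator. -/
noncomputable def outPoly (x : ℕ) : ℤ[X] :=
  if x < 2 * I.n then I.solNum ab neg x else if I.solDen ab = 0 then 1 else I.solDen ab

lemma sel_natAbs_le (s : ℕ) : (I.sel neg s).natAbs ≤ 1 := by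
  unfold sel tgt
  split_ifs <;> simp

lemma nu_solNum_le {x : ℕ} (hx : x < 2 * I.n) : nu (I.solNum ab neg x) ≤
    2 ^ ((2 * I.totalSize + 2 * I.n + 4) * (2 * I.n + 1) + 2 * I.n * I.totalSize + I.totalSize
      + 2 * I.n + 1) := by
  obtain ⟨H, hH, h1, -⟩ := I.nu_fl_le ab
  have hrhs : ∀ l < I.n, nu (sysRhs I.n (I.sel neg) (C I.denProd) I.hat l) ≤
      2 ^ (I.totalSize + 2 * I.totalSize * I.n) := by
    intro l hl
    have e1 : nu (∏ t ∈ Finset.range I.n, if t = l then I.hat t I.n else I.hat t (I.n + 1)) ≤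
        (2 ^ (2 * I.totalSize)) ^ I.n := by
      refine isSize_nu.prod_range_le fun t ht => ?_
      split_ifs
      · exact I.nu_hat_le ht (by omega)
      · exact I.nu_hat_le ht (by omega)
    have e2 : nu ((I.sel neg l : ℤ) : ℤ[X]) ≤ 1 :=
      (isSize_nu.intCast _).trans (I.sel_natAbs_le neg l)
    calc _ ≤ nu (C I.denProd) * nu ((I.sel neg l : ℤ) : ℤ[X]) * _ :=
          (isSize_nu.mul _ _).trans (Nat.mul_le_mul_right _ (isSize_nu.mul _ _))
      _ ≤ 2 ^ I.totalSize * 1 * (2 ^ (2 * I.totalSize)) ^ I.n :=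
          Nat.mul_le_mul (Nat.mul_le_mul I.nu_C_denProd_le e2) e1
      _ = _ := by rw [mul_one, ← pow_mul, ← pow_add]
  have hn : I.n ≤ 2 ^ I.n := Nat.lt_two_pow_self.le
  calc _ ≤ nu ((2 * I.n : ℕ) : ℤ[X]) * nu _ := isSize_nu.mul _ _
    _ ≤ (2 * I.n) * (I.n * (2 ^ H * 2 ^ (I.totalSize + 2 * I.totalSize * I.n))) := by
        refine Nat.mul_le_mul (isSize_nu.natCast _) (isSize_nu.sum_range_le fun l hl => ?_)
        exact (isSize_nu.mul _ _).trans (Nat.mul_le_mul (h1 x hx _ (by omega)) (hrhs l hl))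
    _ ≤ (2 * 2 ^ I.n) * (2 ^ I.n * (2 ^ H * 2 ^ (I.totalSize + 2 * I.totalSize * I.n))) := by
        gcongr
    _ = 2 ^ (H + 2 * I.n * I.totalSize + I.totalSize + 2 * I.n + 1) := by ring
    _ ≤ _ := Nat.pow_le_pow_right (by norm_num) (by omega)

lemma nu_solDen_le : nu (I.solDen ab) ≤
    2 ^ ((2 * I.totalSize + 2 * I.n + 4) * (2 * I.n + 1) + 2 * I.n * I.totalSize) := by
  obtain ⟨H, hH, -, h1⟩ := I.nu_fl_le ab
  calc _ ≤ nu (-(fl (I.matP ab) (2 * I.n) (2 * I.n)).2) * nu _ := isSize_nu.mul _ _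
    _ ≤ 2 ^ H * (2 ^ (2 * I.totalSize)) ^ I.n := by
        rw [isSize_nu.neg]
        exact Nat.mul_le_mul h1 (isSize_nu.prod_range_le fun t ht => I.nu_hat_le ht (by omega))
    _ = 2 ^ (H + 2 * I.n * I.totalSize) := by ring
    _ ≤ _ := Nat.pow_le_pow_right (by norm_num) (by omega)

/-- This fixes the constant `16` in `precision`: the square must dominate all exponents collected so
far. The factor `4` leaves room for the balanced digit condition `2 * nu + 1 ≤ 2 ^ precision`. -/
lemma nu_outPoly_le (x : ℕ) : 4 * nu (I.outPoly ab neg x) ≤ 2 ^ I.precision := by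
  have key : ∀ H p, nu p ≤ 2 ^ H → H ≤ (2 * I.totalSize + 2 * I.n + 4) * (2 * I.n + 1) +
      2 * I.n * I.totalSize + I.totalSize + 2 * I.n + 1 → 4 * nu p ≤ 2 ^ I.precision := by
    intro H p h1 h2
    calc 4 * nu p ≤ 4 * 2 ^ H := by omega
      _ = 2 ^ (H + 2) := by ring
      _ ≤ _ := Nat.pow_le_pow_right (by norm_num) ?_
    unfold precision
    nlinarith [Nat.zero_le (I.totalSize * I.n), Nat.zero_le (I.totalSize * I.totalSize),
      Nat.zero_le (I.n * I.n)]
  unfold outPoly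
  split_ifs with h1
  · exact key _ _ (I.nu_solNum_le ab neg h1) le_rfl
  · exact key 0 _ (by simpa using isSize_nu.one) (Nat.zero_le _)
  · exact key _ _ (I.nu_solDen_le ab) (by omega)

lemma outPoly_small (x : ℕ) :
    ((2 * nu (I.outPoly ab neg x) + 1 : ℕ) : ℤ) ≤ 2 ^ I.precision ∧
      nu (I.outPoly ab neg x) < 2 ^ I.precision := by
  have h1 := I.nu_outPoly_le ab neg x
  have h2 : 4 ≤ 2 ^ I.precision := by
    have : 2 ≤ I.precision := by unfold precision; nlinarith
    calc 4 = 2 ^ 2 := rfl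
      _ ≤ _ := Nat.pow_le_pow_right (by norm_num) this
  constructor
  · exact_mod_cast (by omega : 2 * nu (I.outPoly ab neg x) + 1 ≤ 2 ^ I.precision)
  · omega

lemma le_precision : 16 * (I.totalSize + I.n + 1) ≤ I.precision := by
  unfold precision; nlinarith

end WeightedInstance

end ParamMC

namespace Ram

/-! ## Evaluation of expressions -/

namespace PE

instance : Add PE := ⟨.bin .add⟩
instance : Sub PE := ⟨.bin .sub⟩
instance : Mul PE := ⟨.bin .mul⟩
instance : Div PE := ⟨.bin .div⟩
instance (k : ℕ) : OfNat PE k := ⟨.lit k⟩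

/-- Cantor pairing. -/
def pair (i j : PE) : PE := .pos (j - i) (j * j + i) (i * i + i + j)

/-- Entry `(i, j)` of the array `a`. -/
def cell (a : Fin 30) (i j : PE) : PE := .get a (pair i j)

end PE

/-- The expression `e` has the value `v`, and all bounds of its sums and products are at
most `l`. -/
structure Ev (l : ℕ) (μ : Mem) (env : List ℤ) (e : PE) (v : ℤ) : Prop where
  ok : e.Ok l μ env
  eval : e.eval μ env = v

namespace Ev

variable {l : ℕ} {μ : Mem} {env : List ℤ} {a b c e : PE} {u v w : ℤ}

lemma congr (h : Ev l μ env e v) (hv : v = w) : Ev l μ env e w := hv ▸ h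

lemma num (k : ℕ) : Ev l μ env (OfNat.ofNat k : PE) k := ⟨trivial, rfl⟩

lemma var (k : ℕ) : Ev l μ env (.var k) (env.getD k 0) := ⟨trivial, rfl⟩

lemma get (x : Fin 30) (h : Ev l μ env a u) : Ev l μ env (.get x a) (μ x u) :=
  ⟨h.ok, congrArg (μ x) h.eval⟩

lemma add (ha : Ev l μ env a u) (hb : Ev l μ env b v) : Ev l μ env (a + b) (u + v) :=
  ⟨⟨ha.ok, hb.ok⟩, congrArg₂ (· + ·) ha.eval hb.eval⟩

lemma sub (ha : Ev l μ env a u) (hb : Ev l μ env b v) : Ev l μ env (a - b) (u - v) :=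
  ⟨⟨ha.ok, hb.ok⟩, congrArg₂ (· - ·) ha.eval hb.eval⟩

lemma mul (ha : Ev l μ env a u) (hb : Ev l μ env b v) : Ev l μ env (a * b) (u * v) :=
  ⟨⟨ha.ok, hb.ok⟩, congrArg₂ (· * ·) ha.eval hb.eval⟩

lemma div (ha : Ev l μ env a u) (hb : Ev l μ env b v) : Ev l μ env (a / b) (u / v) :=
  ⟨⟨ha.ok, hb.ok⟩, congrArg₂ (· / ·) ha.eval hb.eval⟩

lemma pos (hc : Ev l μ env c w) (ha : 0 < w → Ev l μ env a u) (hb : ¬ 0 < w → Ev l μ env b v) :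
    Ev l μ env (.pos c a b) (if 0 < w then u else v) := by
  refine ⟨⟨hc.ok, ?_⟩, ?_⟩
  · rw [hc.eval]; split_ifs with h
    · exact (ha h).ok
    · exact (hb h).ok
  · simp only [PE.eval, hc.eval]; split_ifs with h
    · exact (ha h).eval
    · exact (hb h).eval

lemma size (h : Ev l μ env a u) : Ev l μ env (.size a) u.natAbs.size := ⟨h.ok, by simp [PE.eval, h.eval]⟩

lemma fold (p : Bool) {N : ℕ} {f : ℕ → ℤ} (hb : Ev l μ env b N) (hN : N ≤ l)
    (he : ∀ k < N, Ev l μ ((k : ℤ) :: env) e (f k)) : Ev l μ env (.fold p b e) (foldVal p f N) := by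
  refine ⟨⟨hb.ok, by rw [hb.eval]; exact_mod_cast hN, fun k hk => (he k ?_).ok⟩, ?_⟩
  · rw [hb.eval] at hk; exact_mod_cast hk
  · simp only [PE.eval, hb.eval, Int.toNat_natCast, foldVal]
    rw [Finset.prod_congr rfl fun k hk => (he k (Finset.mem_range.1 hk)).eval,
      Finset.sum_congr rfl fun k hk => (he k (Finset.mem_range.1 hk)).eval]

lemma sum {N : ℕ} {f : ℕ → ℤ} (hb : Ev l μ env b N) (hN : N ≤ l)
    (he : ∀ k < N, Ev l μ ((k : ℤ) :: env) e (f k)) :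
    Ev l μ env (.fold false b e) (∑ k ∈ Finset.range N, f k) := fold false hb hN he

lemma prod {N : ℕ} {f : ℕ → ℤ} (hb : Ev l μ env b N) (hN : N ≤ l)
    (he : ∀ k < N, Ev l μ ((k : ℤ) :: env) e (f k)) :
    Ev l μ env (.fold true b e) (∏ k ∈ Finset.range N, f k) := fold true hb hN he

lemma pair {x y : ℕ} (ha : Ev l μ env a x) (hb : Ev l μ env b y) :
    Ev l μ env (.pair a b) (Nat.pair x y : ℕ) := by
  refine ((hb.sub ha).pos (fun _ => (hb.mul hb).add ha)
    (fun _ => ((ha.mul ha).add ha).add hb)).congr ?_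
  have : (0 < (y : ℤ) - x) = (x < y) := by rw [eq_iff_iff]; omega
  simp only [this, Nat.pair]
  split_ifs <;> push_cast <;> rfl

end Ev

/-! ## Tables -/

/-- Contents of a two-dimensional array, and where they are known. -/
structure Table : Type where
  dom : ℕ → ℕ → Prop
  f : ℕ → ℕ → ℤ

/-- A table with `r` rows and `c` columns. -/
def Table.rect (r c : ℕ) (f : ℕ → ℕ → ℤ) : Table := ⟨fun x y => x < r ∧ y < c, f⟩

/-- The arrays in `S` have the contents described by `τ`. -/
def Know (τ : Fin 30 → Table) (S : List (Fin 30)) (μ : Mem) : Prop :=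
  ∀ a ∈ S, ∀ x y, (τ a).dom x y → μ a (Nat.pair x y : ℕ) = (τ a).f x y

lemma Know.mono {τ τ' : Fin 30 → Table} {S S' : List (Fin 30)} {μ : Mem} (h : Know τ S μ)
    (hS : ∀ a ∈ S', a ∈ S) (hτ : ∀ a ∈ S', τ' a = τ a) : Know τ' S' μ := fun a ha x y hd => by
  rw [hτ a ha] at hd ⊢
  exact h a (hS a ha) x y hd

lemma Ev.cell {τ : Fin 30 → Table} {S : List (Fin 30)} {l : ℕ} {μ : Mem} {env : List ℤ} {a b : PE}
    {x y : ℕ} (h : Know τ S μ) (c : Fin 30) (hc : c ∈ S) (ha : Ev l μ env a x)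
    (hb : Ev l μ env b y) (hd : (τ c).dom x y) : Ev l μ env (.cell c a b) ((τ c).f x y) :=
  ((ha.pair hb).get c).congr (h c hc x y hd)

/-! ## Statements with fixed bounds -/

/-- Started in a state with the property `P`, the statement `t` respects the bound `l`, and it
leads to a state with the property `Q`. -/
def Trip (l : ℕ) (P : HState → Prop) (env : List ℤ) (t : Stm) (Q : HState → Prop) : Prop :=
  ∀ θ, P θ → t.Ok l env θ ∧ Q (t.run env θ)

namespace Trip

variable {l : ℕ} {P P' Q Q' R : HState → Prop} {env : List ℤ} {t u : Stm}

lemma conseq (h : Trip l P env t Q) (hP : ∀ θ, P' θ → P θ) (hQ : ∀ θ, Q θ → Q' θ) :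
    Trip l P' env t Q' := fun θ hθ => ⟨(h θ (hP θ hθ)).1, hQ _ (h θ (hP θ hθ)).2⟩

lemma seq (h : Trip l P env t Q) (h' : Trip l Q env u R) : Trip l P env (.seq t u) R :=
  fun θ hθ => ⟨⟨(h θ hθ).1, (h' _ (h θ hθ).2).1⟩, (h' _ (h θ hθ).2).2⟩

lemma loop {b : PE} {N : ℕ} (hN : N ≤ l) (J : ℕ → HState → Prop)
    (hb : ∀ θ, J 0 θ → MemLe l θ.mem ∧ Ev l θ.mem env b N)
    (h : ∀ k < N, Trip l (J k) ((k : ℤ) :: env) t (J (k + 1))) :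
    Trip l (J 0) env (.loop b t) (J N) := by
  intro θ hθ
  obtain ⟨hμ, hE⟩ := hb θ hθ
  have key : ∀ k ≤ N, J k (iter (fun k => t.run ((k : ℤ) :: env)) k θ) := by
    intro k
    induction k with
    | zero => exact fun _ => hθ
    | succ k ih => exact fun hk => (h k (by omega) _ (ih (by omega))).2
  refine ⟨⟨hμ, hE.ok, by rw [hE.eval]; exact_mod_cast hN, fun k hk => ?_⟩, ?_⟩
  · rw [hE.eval] at hk
    exact (h k (by omega) _ (key k (by omega))).1
  · simp only [Stm.run, hE.eval, Int.toNat_natCast]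
    exact key N le_rfl

end Trip

lemma PE.Ok.mono {l l' : ℕ} (hl : l ≤ l') {μ : Mem} (e : PE) :
    ∀ {env : List ℤ}, e.Ok l μ env → e.Ok l' μ env := by
  induction e with
  | lit | var => exact fun _ => trivial
  | get a i ih => exact fun h => ih h
  | bin o a b iha ihb => exact fun h => ⟨iha h.1, ihb h.2⟩
  | pos c a b ihc iha ihb =>
    refine fun h => ⟨ihc h.1, ?_⟩
    have := h.2
    split_ifs at this ⊢
    · exact iha this
    · exact ihb this
  | size a ih => exact fun h => ih h
  | fold p b e ihb ihe => exact fun h => ⟨ihb h.1, h.2.1.trans (by exact_mod_cast hl), fun k hk => ihe (h.2.2 k hk)⟩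

lemma MemLe.mono {l l' : ℕ} {μ : Mem} (h : MemLe l μ) (hl : l ≤ l') : MemLe l' μ :=
  fun a i => pow_bound (h a i) hl

lemma MemLe.put {l : ℕ} {μ : Mem} (h : MemLe l μ) (a : Fin 30) (i : ℤ) {x : ℤ}
    (hx : |x| ≤ 2 ^ l) : MemLe l (μ.put a i x) := by
  intro b j
  rcases eq_or_ne b a with rfl | hb
  · rcases eq_or_ne j i with rfl | hj
    · simpa [Mem.put] using hx
    · simpa [Mem.put, hj] using h b j
  · simpa [Mem.put, hb] using h b j

lemma Mem.put_same (μ : Mem) (a : Fin 30) (i x : ℤ) : μ.put a i x a i = x := by simp [Mem.put]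

lemma Mem.put_of_ne (μ : Mem) {a b : Fin 30} {i j : ℤ} (x : ℤ) (h : b ≠ a ∨ j ≠ i) :
    μ.put a i x b j = μ b j := by
  rcases eq_or_ne b a with rfl | hb
  · simp [Mem.put, h.resolve_left (by simp)]
  · simp [Mem.put, hb]

lemma Know.put {τ : Fin 30 → Table} {S : List (Fin 30)} {μ : Mem} (h : Know τ S μ) {a : Fin 30}
    (ha : a ∉ S) (i x : ℤ) : Know τ S (μ.put a i x) := fun b hb y z hd => by
  rw [Mem.put_of_ne _ _ (.inl (by rintro rfl; exact ha hb))]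
  exact h b hb y z hd

/-- Fill the array `a` with the values of `e`, with `b` rows and `c` columns. -/
def Stm.tab (a : Fin 30) (b c e : PE) : Stm :=
  .loop b (.loop c (.set a (.pair (.var 1) (.var 0)) e))

/-- Property of the memory, with bounded entries and a fixed output. -/
def Bd (h : ℕ) (o : List ℤ) (P : Mem → Prop) (θ : HState) : Prop :=
  P θ.mem ∧ MemLe h θ.mem ∧ θ.out = o

/-- The expression reads only arrays in `S`, to which `a` does not belong. Filling `a` entry by
entry therefore never changes a value still to be computed. -/
lemma Trip.tab {τ τ' : Fin 30 → Table} {S : List (Fin 30)} {a : Fin 30} {b c e : PE} {env : List ℤ}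
    {r q h : ℕ} {E : ℕ → ℕ → ℤ} (o : List ℤ) (ha : a ∉ S) (hτ : ∀ x ∈ S, τ' x = τ x)
    (hT : τ' a = .rect r q E) (hr : r ≤ h) (hq : q ≤ h)
    (hb : ∀ μ, Know τ S μ → Ev h μ env b r)
    (hc : ∀ μ, Know τ S μ → ∀ x < r, Ev h μ ((x : ℤ) :: env) c q)
    (he : ∀ μ, Know τ S μ → ∀ x < r, ∀ y < q, Ev h μ ((y : ℤ) :: (x : ℤ) :: env) e (E x y))
    (hE : ∀ x < r, ∀ y < q, |E x y| ≤ 2 ^ h) :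
    Trip h (Bd h o (Know τ S)) env (.tab a b c e) (Bd h o (Know τ' (a :: S))) := by
  -- Invariant: the positions lexicographically before row `k`, column `j` are filled.
  set J : ℕ → ℕ → Mem → Prop := fun k j μ => Know τ S μ ∧
    ∀ x < r, ∀ y < q, (x < k ∨ x = k ∧ y < j) → μ a (Nat.pair x y : ℕ) = E x y with hJ
  have main : Trip h (Bd h o (J 0 0)) env (.tab a b c e) (Bd h o (J r 0)) := by
    refine Trip.loop (J := fun k => Bd h o (J k 0)) hr (fun θ hθ => ⟨hθ.2.1, hb _ hθ.1.1⟩)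
      fun k hk => ?_
    refine Trip.conseq (Trip.loop (J := fun j => Bd h o (J k j)) hq
      (fun θ hθ => ⟨hθ.2.1, hc _ hθ.1.1 k hk⟩) fun j hj => ?_) (fun _ => id) fun θ hθ => ?_
    · intro θ hθ
      obtain ⟨⟨h1, h2⟩, h3, h4⟩ := hθ
      have e1 : Ev h θ.mem ((j : ℤ) :: (k : ℤ) :: env) (.pair (.var 1) (.var 0))
          (Nat.pair k j : ℕ) := Ev.pair (Ev.var 1) (Ev.var 0)
      have e2 := he _ h1 k hk j hj
      refine ⟨⟨h3, e1.ok, e2.ok⟩, ?_⟩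
      simp only [Stm.run, e1.eval, e2.eval]
      refine ⟨⟨h1.put ha _ _, fun x hx y hy hxy => ?_⟩, h3.put _ _ (hE k hk j hj), h4⟩
      by_cases heq : x = k ∧ y = j
      · obtain ⟨rfl, rfl⟩ := heq
        exact Mem.put_same ..
      · simp only
        rw [Mem.put_of_ne _ _ (.inr (by rwa [Ne, Nat.cast_inj, Nat.pair_eq_pair]))]
        exact h2 x hx y hy (by omega)
    · exact ⟨⟨hθ.1.1, fun x hx y hy hxy => hθ.1.2 x hx y hy (by omega)⟩, hθ.2⟩
  refine main.conseq (fun θ hθ => ⟨⟨hθ.1, fun x _ y _ hxy => by omega⟩, hθ.2⟩) fun θ hθ => ⟨?_, hθ.2⟩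
  intro x hx y z hd
  rcases List.mem_cons.1 hx with rfl | hx
  · rw [hT] at hd ⊢
    exact hθ.1.2 y hd.1 z hd.2 (.inl hd.1)
  · rw [hτ x hx] at hd ⊢
    exact hθ.1.1 x hx y z hd

/-! ## Statements with polynomial bounds -/

/-- On memories with the property `P`, the statement `t` respects polynomial bounds, and it leads
to memories with the property `Q`. -/
def Tri {ι : Type} (sz : ι → ℕ) (P : ι → Mem → Prop) (t : Stm) (Q : ι → Mem → Prop) : Prop :=
  ∃ p : ℕ[X], ∀ i l θ, sz i ≤ l → P i θ.mem → MemLe l θ.mem →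
    t.Ok (p.eval l) [] θ ∧ Bd (p.eval l) θ.out (Q i) (t.run [] θ)

lemma Stm.Ok.mono {l l' : ℕ} (hl : l ≤ l') (t : Stm) :
    ∀ {env : List ℤ} {θ : HState}, t.Ok l env θ → t.Ok l' env θ := by
  induction t with
  | set a i e => exact fun h => ⟨h.1.mono hl, h.2.1.mono hl, h.2.2.mono hl⟩
  | read a i => exact fun h => ⟨h.1.mono hl, h.2.1.mono hl, pow_bound h.2.2 hl⟩
  | write e => exact fun h => ⟨h.1.mono hl, h.2.mono hl⟩
  | seq t u iht ihu => exact fun h => ⟨iht h.1, ihu h.2⟩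
  | pos c t u iht ihu =>
    refine fun h => ⟨h.1.mono hl, h.2.1.mono hl, ?_⟩
    have := h.2.2
    split_ifs at this ⊢
    · exact iht this
    · exact ihu this
  | loop b t ih =>
    exact fun h => ⟨h.1.mono hl, h.2.1.mono hl, h.2.2.1.trans (by exact_mod_cast hl),
      fun k hk => ih (h.2.2.2 k hk)⟩

namespace Tri

variable {ι : Type} {sz : ι → ℕ} {P Q R : ι → Mem → Prop}

/-- The second phase starts with numbers bounded by the polynomial of the first, so the bounds are
composed. This stays polynomial because the number of phases is fixed. -/
lemma seq {t u : Stm} (h : Tri sz P t Q) (h' : Tri sz Q u R) : Tri sz P (.seq t u) R := by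
  obtain ⟨p, hp⟩ := h
  obtain ⟨q, hq⟩ := h'
  refine ⟨p + q.comp (p + X), fun i l θ hl hP hμ => ?_⟩
  obtain ⟨h1, h2, h3, h4⟩ := hp i l θ hl hP hμ
  simp only [eval_add, eval_comp, eval_X]
  obtain ⟨h1', h2', h3', h4'⟩ := hq i (p.eval l + l) _ (by omega) h2 (h3.mono (by omega))
  exact ⟨⟨h1.mono (by omega), h1'.mono (by omega)⟩, h2', h3'.mono (by omega), h4'.trans h4⟩

/-- A statement for which all bounds can be given in advance. -/
lemma of_trip {t : Stm} (p : ℕ[X])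
    (h : ∀ i l μ, sz i ≤ l → P i μ → MemLe l μ → l ≤ p.eval l ∧ ∀ o,
      Trip (p.eval l) (Bd (p.eval l) o (P i)) [] t (Bd (p.eval l) o (Q i))) : Tri sz P t Q := by
  refine ⟨p, fun i l θ hl hP hμ => ?_⟩
  obtain ⟨h1, h2⟩ := h i l θ.mem hl hP hμ
  exact h2 θ.out θ ⟨hP, hμ.mono h1, rfl⟩

/-- All entries are computed from arrays that existed before, so a single bound on the value of `e`
serves the whole table and sizes do not accumulate from entry to entry. -/
lemma tab {τ : ι → Fin 30 → Table} {S : List (Fin 30)} {a : Fin 30} {b c e : PE}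
    {r q : ι → ℕ} {E : ι → ℕ → ℕ → ℤ} (ha : a ∉ S) (hT : ∀ i, τ i a = .rect (r i) (q i) (E i))
    (hr : ∀ i, r i ≤ sz i) (hq : ∀ i, q i ≤ sz i)
    (hb : ∀ i l μ, sz i ≤ l → Know (τ i) S μ → Ev l μ [] b (r i))
    (hc : ∀ i l μ, sz i ≤ l → Know (τ i) S μ → ∀ x < r i, Ev l μ [(x : ℤ)] c (q i))
    (he : ∀ i l μ, sz i ≤ l → Know (τ i) S μ → ∀ x < r i, ∀ y < q i,
      Ev l μ [(y : ℤ), (x : ℤ)] e (E i x y)) :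
    Tri sz (fun i => Know (τ i) S) (.tab a b c e) (fun i => Know (τ i) (a :: S)) := by
  refine of_trip (e.bits + X) fun i l μ hl hP hμ => ?_
  simp only [eval_add, eval_X]
  have hl' : sz i ≤ e.bits.eval l + l := by omega
  refine ⟨by omega, fun o => Trip.tab o ha (fun _ _ => rfl) (hT i) ((hr i).trans hl')
    ((hq i).trans hl') (fun μ hK => hb i _ μ hl' hK) (fun μ hK => hc i _ μ hl' hK)
    (fun μ hK => he i _ μ hl' hK) fun x hx y hy => ?_⟩
  have h1 := he i l μ hl hP x hx y hy
  have hx' := (hx.le.trans (hr i)).trans hl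
  have hy' := (hy.le.trans (hq i)).trans hl
  have h2 := e.abs_eval_le hμ (((show EnvLe l [] by simp [EnvLe]).cons hx').cons hy') h1.ok
  rw [h1.eval] at h2
  exact pow_bound h2 (by omega)

end Tri

end Ram

namespace ParamMC

open Ram

namespace WeightedInstance

variable (I : WeightedInstance) (ab neg : Bool)

/-! ## Values of the polynomials at a power of two -/

noncomputable def base : ℤ := 2 ^ I.precision

noncomputable def val (s t : ℕ) : ℤ := (I.hat s t).eval I.base

noncomputable def matZ : ℕ → ℕ → ℤ := sysMat I.n (I.rep ab) (I.live ab) I.denProd I.val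

noncomputable def denZ : ℤ := sysDen I.n (I.rep ab) (I.live ab) I.denProd I.val

/-- Kronecker substitution: solving over the integers with every polynomial replaced by its value at
the base gives the value of the polynomial solution at the base. -/
lemma eval_solNum (x : ℕ) : (I.solNum ab neg x).eval I.base =
    sysSol I.n (I.rep ab) (I.live ab) (I.sel neg) I.denProd I.val x := by
  have := sysSol_map (evalRingHom I.base) I.n (I.rep ab) (I.live ab) (I.sel neg) (C I.denProd)
    I.hat x
  simp only [coe_evalRingHom, eval_C] at this
  exact this

lemma eval_solDen : (I.solDen ab).eval I.base = I.denZ ab := by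
  have := sysDen_map (evalRingHom I.base) I.n (I.rep ab) (I.live ab) (C I.denProd) I.hat
  simp only [coe_evalRingHom, eval_C] at this
  exact this

lemma outPoly_small_base (x : ℕ) :
    ((2 * nu (I.outPoly ab neg x) + 1 : ℕ) : ℤ) ≤ I.base := (I.outPoly_small ab neg x).1

/-- Whether the denominator is the zero polynomial can be tested on its value, because a polynomial
with small coefficients vanishes at the base only if it is zero. -/
lemma eval_outPoly (x : ℕ) : (I.outPoly ab neg x).eval I.base =
    if x < 2 * I.n then sysSol I.n (I.rep ab) (I.live ab) (I.sel neg) I.denProd I.val x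
    else if 0 < I.denZ ab * I.denZ ab then I.denZ ab else 1 := by
  by_cases hx : x < 2 * I.n
  · rw [outPoly, if_pos hx, if_pos hx, eval_solNum]
  have h := eval_eq_zero_iff_of_small (I.outPoly_small_base ab neg x)
  rw [if_neg hx]
  simp only [outPoly, if_neg hx, mul_self_pos, ← I.eval_solDen ab] at h ⊢
  split_ifs at h ⊢ with h1 h2 h2
  · simp [h1] at h2
  · simp
  · rfl
  · exact absurd (h.1 (not_not.1 h2)) h1

/-! ## Contents of the arrays -/

/-- Contents of the arrays: number of states, degrees, numerators, denominators and targets of the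
input, the precision, the product of all denominators, the base, the values of the polynomials,
edges, states with edges, reachability, an auxiliary array, representatives, the matrix of the
linear system, the adjugate matrix, an auxiliary array, the determinant, the right hand side, the
values of the solution, the rounded quotients, the degrees of the solution, and the states that
miss the target. -/
noncomputable def spec (a : Fin 30) : Table :=
  match a.val with
  | 0 => .rect 1 1 fun _ _ => I.n
  | 1 => .rect I.n (I.n + 2) fun s t => (I.poly s t).natDegree
  | 2 => ⟨fun z k => z.unpair.1 < I.n ∧ z.unpair.2 < I.n + 2 ∧
      k ≤ (I.poly z.unpair.1 z.unpair.2).natDegree,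
      fun z k => ((I.poly z.unpair.1 z.unpair.2).coeff k).num⟩
  | 3 => ⟨fun z k => z.unpair.1 < I.n ∧ z.unpair.2 < I.n + 2 ∧
      k ≤ (I.poly z.unpair.1 z.unpair.2).natDegree,
      fun z k => ((I.poly z.unpair.1 z.unpair.2).coeff k).den⟩
  | 4 => .rect I.n 1 fun s _ => I.tgt s
  | 5 => .rect 1 1 fun _ _ => I.precision
  | 6 => .rect 1 1 fun _ _ => I.denProd
  | 7 => .rect 1 1 fun _ _ => I.base
  | 8 => .rect I.n (I.n + 2) I.val
  | 9 => .rect I.n I.n (I.edge ab)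
  | 10 => .rect I.n 1 fun s _ => I.live ab s
  | 11 => .rect I.n I.n (I.reach ab)
  | 13 => .rect I.n 1 fun s _ => I.rep ab s
  | 14 => .rect (2 * I.n) (2 * I.n) (I.matZ ab)
  | 15 => .rect (2 * I.n) (2 * I.n) (fl (I.matZ ab) (2 * I.n) (2 * I.n)).1
  | 17 => .rect 1 1 fun _ _ => (fl (I.matZ ab) (2 * I.n) (2 * I.n)).2
  | 18 => .rect I.n 1 fun s _ => sysRhs I.n (I.sel neg) I.denProd I.val s
  | 19 => .rect (2 * I.n + 1) 1 fun x _ => (I.outPoly ab neg x).eval I.base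
  | 20 => .rect (2 * I.n + 1) (I.precision + 1) fun x k =>
      (divX^[k] (I.outPoly ab neg x)).eval I.base
  | 21 => .rect (2 * I.n + 1) 1 fun x _ => (I.outPoly ab neg x).natDegree
  | 22 => .rect I.n 1 fun s _ => I.miss ab s
  -- Nothing is claimed about the remaining arrays, among them the buffers `12` and `16`.
  | _ => .rect 0 0 fun _ _ => 0

/-- Bound for the numbers of iterations. -/
noncomputable def bound : ℕ := I.precision + 1

lemma bounds {l : ℕ} (hl : I.bound ≤ l) : I.precision + 1 ≤ l ∧ I.totalSize ≤ l ∧ 1 ≤ l ∧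
    I.n + 2 ≤ l ∧ 2 * I.n + 1 ≤ l := by
  have := I.le_precision
  unfold bound at hl
  omega

lemma degree_bound {l : ℕ} (hl : I.bound ≤ l) {s t : ℕ} (hs : s < I.n) (ht : t < I.n + 2) :
    (I.poly s t).natDegree + 1 ≤ l :=
  Nat.succ_le_of_lt (lt_of_lt_of_le (I.natDegree_lt_polySize s t) ((I.polySize_le hs ht).trans (I.bounds hl).2.1))

variable {I ab neg} {l : ℕ} {μ : Mem} {S : List (Fin 30)} (hK : Know (I.spec ab neg) S μ)
  {env : List ℤ} {a b c d : PE} {x y k : ℕ} {u v : ℤ}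

include hK

lemma ev_n (h : 0 ∈ S) : Ev l μ env (.cell 0 0 0) I.n :=
  Ev.cell hK 0 h (Ev.num 0) (Ev.num 0) ⟨zero_lt_one, zero_lt_one⟩

lemma ev_deg (h : 1 ∈ S) (ha : Ev l μ env a x) (hb : Ev l μ env b y) (hx : x < I.n)
    (hy : y < I.n + 2) : Ev l μ env (.cell 1 a b) (I.poly x y).natDegree :=
  Ev.cell hK 1 h ha hb ⟨hx, hy⟩

lemma ev_num (h : 2 ∈ S) (ha : Ev l μ env a x) (hb : Ev l μ env b y) (hc : Ev l μ env c k)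
    (hx : x < I.n) (hy : y < I.n + 2) (hk : k < (I.poly x y).natDegree + 1) :
    Ev l μ env (.cell 2 (.pair a b) c) ((I.poly x y).coeff k).num :=
  (Ev.cell hK 2 h (ha.pair hb) hc (by simpa [spec] using ⟨hx, hy, by omega⟩)).congr (by simp [spec])

lemma ev_den (h : 3 ∈ S) (ha : Ev l μ env a x) (hb : Ev l μ env b y) (hc : Ev l μ env c k)
    (hx : x < I.n) (hy : y < I.n + 2) (hk : k < (I.poly x y).natDegree + 1) :
    Ev l μ env (.cell 3 (.pair a b) c) ((I.poly x y).coeff k).den :=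
  (Ev.cell hK 3 h (ha.pair hb) hc (by simpa [spec] using ⟨hx, hy, by omega⟩)).congr (by simp [spec])

lemma ev_tgt (h : 4 ∈ S) (ha : Ev l μ env a x) (hx : x < I.n) : Ev l μ env (.cell 4 a 0) (I.tgt x) :=
  Ev.cell hK 4 h ha (Ev.num 0) ⟨hx, zero_lt_one⟩

lemma ev_precision (h : 5 ∈ S) : Ev l μ env (.cell 5 0 0) I.precision :=
  Ev.cell hK 5 h (Ev.num 0) (Ev.num 0) ⟨zero_lt_one, zero_lt_one⟩

lemma ev_denProd (h : 6 ∈ S) : Ev l μ env (.cell 6 0 0) I.denProd :=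
  Ev.cell hK 6 h (Ev.num 0) (Ev.num 0) ⟨zero_lt_one, zero_lt_one⟩

lemma ev_base (h : 7 ∈ S) : Ev l μ env (.cell 7 0 0) I.base :=
  Ev.cell hK 7 h (Ev.num 0) (Ev.num 0) ⟨zero_lt_one, zero_lt_one⟩

lemma ev_val (h : 8 ∈ S) (ha : Ev l μ env a x) (hb : Ev l μ env b y) (hx : x < I.n)
    (hy : y < I.n + 2) : Ev l μ env (.cell 8 a b) (I.val x y) :=
  Ev.cell hK 8 h ha hb ⟨hx, hy⟩

lemma ev_edge (h : 9 ∈ S) (ha : Ev l μ env a x) (hb : Ev l μ env b y) (hx : x < I.n)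
    (hy : y < I.n) : Ev l μ env (.cell 9 a b) (I.edge ab x y) :=
  Ev.cell hK 9 h ha hb ⟨hx, hy⟩

lemma ev_live (h : 10 ∈ S) (ha : Ev l μ env a x) (hx : x < I.n) :
    Ev l μ env (.cell 10 a 0) (I.live ab x) :=
  Ev.cell hK 10 h ha (Ev.num 0) ⟨hx, zero_lt_one⟩

lemma ev_reach (h : 11 ∈ S) (ha : Ev l μ env a x) (hb : Ev l μ env b y) (hx : x < I.n)
    (hy : y < I.n) : Ev l μ env (.cell 11 a b) (I.reach ab x y) :=
  Ev.cell hK 11 h ha hb ⟨hx, hy⟩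

lemma ev_rep (h : 13 ∈ S) (ha : Ev l μ env a x) (hx : x < I.n) :
    Ev l μ env (.cell 13 a 0) (I.rep ab x) :=
  Ev.cell hK 13 h ha (Ev.num 0) ⟨hx, zero_lt_one⟩

lemma ev_adj (h : 15 ∈ S) (ha : Ev l μ env a x) (hb : Ev l μ env b y) (hx : x < 2 * I.n)
    (hy : y < 2 * I.n) :
    Ev l μ env (.cell 15 a b) ((fl (I.matZ ab) (2 * I.n) (2 * I.n)).1 x y) :=
  Ev.cell hK 15 h ha hb ⟨hx, hy⟩

lemma ev_det (h : 17 ∈ S) : Ev l μ env (.cell 17 0 0) (fl (I.matZ ab) (2 * I.n) (2 * I.n)).2 :=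
  Ev.cell hK 17 h (Ev.num 0) (Ev.num 0) ⟨zero_lt_one, zero_lt_one⟩

lemma ev_rhs (h : 18 ∈ S) (ha : Ev l μ env a x) (hx : x < I.n) :
    Ev l μ env (.cell 18 a 0) (sysRhs I.n (I.sel neg) I.denProd I.val x) :=
  Ev.cell hK 18 h ha (Ev.num 0) ⟨hx, zero_lt_one⟩

lemma ev_out (h : 19 ∈ S) (ha : Ev l μ env a x) (hx : x < 2 * I.n + 1) :
    Ev l μ env (.cell 19 a 0) ((I.outPoly ab neg x).eval I.base) :=
  Ev.cell hK 19 h ha (Ev.num 0) ⟨hx, zero_lt_one⟩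

lemma ev_quot (h : 20 ∈ S) (ha : Ev l μ env a x) (hb : Ev l μ env b y) (hx : x < 2 * I.n + 1)
    (hy : y < I.precision + 1) :
    Ev l μ env (.cell 20 a b) ((divX^[y] (I.outPoly ab neg x)).eval I.base) :=
  Ev.cell hK 20 h ha hb ⟨hx, hy⟩

lemma ev_degOut (h : 21 ∈ S) (ha : Ev l μ env a x) (hx : x < 2 * I.n + 1) :
    Ev l μ env (.cell 21 a 0) (I.outPoly ab neg x).natDegree :=
  Ev.cell hK 21 h ha (Ev.num 0) ⟨hx, zero_lt_one⟩

lemma ev_miss (h : 22 ∈ S) (ha : Ev l μ env a x) (hx : x < I.n) :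
    Ev l μ env (.cell 22 a 0) (I.miss ab x) :=
  Ev.cell hK 22 h ha (Ev.num 0) ⟨hx, zero_lt_one⟩

end WeightedInstance

end ParamMC

namespace Ram

namespace PE

/-- `c` if `a = b`, and `d` otherwise. -/
def ifEq (a b c d : PE) : PE := .pos ((a - b) * (a - b)) d c

/-- `c` if `a < b`, and `d` otherwise. -/
def ifLt (a b c d : PE) : PE := .pos (b - a) c d

end PE

namespace Ev

variable {l : ℕ} {μ : Mem} {env : List ℤ} {a b c d : PE} {u v : ℤ} {x y : ℕ}

lemma zero : Ev l μ env (0 : PE) 0 := num 0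

lemma one : Ev l μ env (1 : PE) 1 := num 1

lemma ifEq (ha : Ev l μ env a x) (hb : Ev l μ env b y) (hc : x = y → Ev l μ env c u)
    (hd : x ≠ y → Ev l μ env d v) : Ev l μ env (.ifEq a b c d) (if x = y then u else v) := by
  have h : 0 < ((x : ℤ) - y) * (x - y) ↔ x ≠ y := by rw [mul_self_pos]; omega
  refine (((ha.sub hb).mul (ha.sub hb)).pos (fun h' => hd (h.1 h'))
    (fun h' => hc (not_not.1 fun hn => h' (h.2 hn)))).congr ?_
  simp only [h, ite_not]

lemma ifLt (ha : Ev l μ env a x) (hb : Ev l μ env b y) (hc : x < y → Ev l μ env c u)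
    (hd : ¬ x < y → Ev l μ env d v) : Ev l μ env (.ifLt a b c d) (if x < y then u else v) := by
  have h : 0 < (y : ℤ) - x ↔ x < y := by omega
  refine ((hb.sub ha).pos (fun h' => hc (h.1 h')) (fun h' => hd fun hn => h' (h.2 hn))).congr ?_
  simp only [h]

lemma addNat (ha : Ev l μ env a x) (hb : Ev l μ env b y) : Ev l μ env (a + b) (x + y : ℕ) :=
  (ha.add hb).congr (by push_cast; rfl)

lemma mulNat (ha : Ev l μ env a x) (hb : Ev l μ env b y) : Ev l μ env (a * b) (x * y : ℕ) :=
  (ha.mul hb).congr (by push_cast; rfl)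

lemma subNat (ha : Ev l μ env a x) (hb : Ev l μ env b y) (h : y ≤ x) :
    Ev l μ env (a - b) (x - y : ℕ) :=
  (ha.sub hb).congr (by push_cast [h]; rfl)

end Ev

end Ram

namespace ParamMC

open Ram

/-- A bound for all rounds at once. Composing a size bound round by round would not stay polynomial,
since the number of rounds depends on the input. -/
lemma abs_fl_le {A : ℕ → ℕ → ℤ} {m l : ℕ} (hm : m ≤ l)
    (hA : ∀ x < m, ∀ y < m, |A x y| ≤ 2 ^ l) {k : ℕ} (hk : k ≤ m) :
    (∀ x < m, ∀ y < m, |(fl A m k).1 x y| ≤ 2 ^ ((3 * l + 1) * (l + 1))) ∧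
      |(fl A m k).2| ≤ 2 ^ ((3 * l + 1) * (l + 1)) := by
  have cast : ∀ (z : ℤ) (b : ℕ), |z| ≤ 2 ^ b ↔ z.natAbs ≤ 2 ^ b := fun z b => by
    rw [← Int.natCast_natAbs]; exact_mod_cast Iff.rfl
  simp only [cast] at hA ⊢
  rcases Nat.eq_zero_or_pos m with rfl | hpos
  · obtain rfl : k = 0 := by omega
    exact ⟨fun x hx => absurd hx (by omega), Nat.one_le_two_pow⟩
  obtain ⟨h1, h2⟩ := isSize_natAbs.fl_le hpos Nat.one_le_two_pow hA k hk
  have hl : m ≤ 2 ^ l := hm.trans Nat.lt_two_pow_self.le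
  have h3 : 2 * m ^ 2 * 2 ^ l ≤ 2 ^ (3 * l + 1) := by
    calc 2 * m ^ 2 * 2 ^ l ≤ 2 * (2 ^ l) ^ 2 * 2 ^ l := by gcongr
      _ = _ := by ring
  have h4 : (2 * m ^ 2 * 2 ^ l) ^ k ≤ 2 ^ ((3 * l + 1) * l) := by
    rw [pow_mul]
    exact (Nat.pow_le_pow_left h3 _).trans (Nat.pow_le_pow_right Nat.one_le_two_pow (by omega))
  refine ⟨fun x hx y hy => ((h1 x hx y hy).trans h4).trans
    (Nat.pow_le_pow_right (by norm_num) (by gcongr; omega)), h2.trans ?_⟩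
  calc _ ≤ 2 ^ (3 * l + 1) * 2 ^ ((3 * l + 1) * l) :=
        Nat.mul_le_mul (le_trans (by rw [mul_assoc]; omega) h3) h4
    _ = _ := by rw [← pow_add]; ring_nf

namespace Prog

/-! ## The program that computes the solution -/

abbrev nE : PE := .cell 0 0 0
abbrev KE : PE := .cell 5 0 0
abbrev DE : PE := .cell 6 0 0

/-- Sum (or product) over all coefficients, with the loop variables `0`, `1`, `2`. -/
abbrev allCoeff (p : Bool) (e : PE) : PE :=
  .fold p nE (.fold p (nE + 2) (.fold p (.cell 1 (.var 1) (.var 0) + 1) e))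

abbrev sizeE : PE := allCoeff false
  (.size (.cell 2 (.pair (.var 2) (.var 1)) (.var 0)) +
    .size (.cell 3 (.pair (.var 2) (.var 1)) (.var 0)) + 1) + nE + 1

abbrev precisionE : PE := 16 * (sizeE * sizeE)

abbrev denProdE : PE := allCoeff true (.cell 3 (.pair (.var 2) (.var 1)) (.var 0))

abbrev valE : PE := .fold false (.cell 1 (.var 1) (.var 0) + 1)
  (.cell 2 (.pair (.var 2) (.var 1)) (.var 0) *
    (DE / .cell 3 (.pair (.var 2) (.var 1)) (.var 0)) * .fold true (.var 0) (.cell 7 0 0))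

/-- A polynomial is zero exactly when its coefficient at the stored degree is zero; squaring the
numerator turns this into a test for positivity. -/
abbrev edgeE (ab : Bool) : PE := .pos (if ab then .cell 4 (.var 1) 0 else 0) 0
  (.pos (.cell 2 (.pair (.var 1) (.var 0)) (.cell 1 (.var 1) (.var 0)) *
    .cell 2 (.pair (.var 1) (.var 0)) (.cell 1 (.var 1) (.var 0))) 1 0)

abbrev liveE : PE := .pos (.fold false nE (.cell 9 (.var 2) (.var 0))) 1 0

abbrev reachE : PE := .pos (.cell 11 (.var 1) (.var 0) +
  .fold false nE (.cell 11 (.var 2) (.var 0) * .cell 9 (.var 0) (.var 1))) 1 0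

abbrev repE : PE := .pos (.fold false nE (.pos (.cell 11 (.var 2) (.var 0))
  (.pos (.cell 11 (.var 0) (.var 2)) (.pos (.var 2 - .var 0) 1 0) 1) 0)) 0 1

abbrev matE : PE := .ifLt (.var 1) nE
  (.ifLt (.var 0) nE (.pos (.cell 13 (.var 1) 0) 0 (.pos (.cell 10 (.var 1) 0)
    (.ifEq (.var 1) (.var 0) DE 0 - .cell 8 (.var 1) (.var 0)) 0))
    (.pos (.cell 13 (.var 1) 0) (.ifEq (.var 0) (.var 1 + nE) 1 0) 0))
  (.ifLt (.var 0) nE (.ifEq (.var 1) (.var 0 + nE) DE 0) (.pos (.cell 10 (.var 1 - nE) 0)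
    (.ifEq (.var 1) (.var 0) DE 0 - .cell 8 (.var 1 - nE) (.var 0 - nE)) 0))

/-- Variable `2` is the round of the enclosing loop, the factor that replaces the division in the
recursion. -/
abbrev adjE : PE := .var 2 * .fold false (2 * nE) (.cell 14 (.var 2) (.var 0) *
  .cell 15 (.var 0) (.var 1)) + .ifEq (.var 1) (.var 0) (.cell 17 0 0) 0

abbrev detE : PE := 0 - .fold false (2 * nE) (.fold false (2 * nE)
  (.cell 14 (.var 1) (.var 0) * .cell 15 (.var 0) (.var 1)))

abbrev rhsE (neg : Bool) : PE :=
  DE * (if neg then 1 - .cell 4 (.var 1) 0 else .cell 4 (.var 1) 0) *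
    .fold true nE (.ifEq (.var 0) (.var 2) (.cell 8 (.var 0) nE) (.cell 8 (.var 0) (nE + 1)))

abbrev denE : PE := (0 - .cell 17 0 0) * .fold true nE (.cell 8 (.var 0) (nE + 1))

abbrev outE : PE := .ifLt (.var 1) (2 * nE)
  (2 * nE * .fold false nE (.cell 15 (.var 2) (nE + .var 0) * .cell 18 (.var 0) 0))
  (.pos (denE * denE) denE 1)

/-- Adding half of the divisor before the integer division, with everything doubled, rounds to the
nearest integer. -/
abbrev quotE : PE := (2 * .cell 19 (.var 1) 0 + .fold true (.var 0) (.cell 7 0 0)) /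
  (2 * .fold true (.var 0) (.cell 7 0 0))

abbrev degE : PE := .fold false KE
  (.pos (.cell 20 (.var 2) (.var 0 + 1) * .cell 20 (.var 2) (.var 0 + 1)) 1 0)

abbrev missE : PE := .fold false nE (.pos (.cell 11 (.var 2) (.var 0))
  (.pos (.cell 13 (.var 0) 0) (1 - .cell 4 (.var 0) 0) 0) 0)

variable {ab neg : Bool}

/-- The arrays in `S` have the contents that the computation prescribes. -/
abbrev Filled (ab neg : Bool) (S : List (Fin 30)) (I : WeightedInstance) : Mem → Prop :=
  Know (I.spec ab neg) S

open WeightedInstance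

lemma fill {S : List (Fin 30)} {a : Fin 30} {b c e : PE} (r q : WeightedInstance → ℕ)
    (hr : ∀ I, r I ≤ I.bound) (hq : ∀ I, q I ≤ I.bound) {E : WeightedInstance → ℕ → ℕ → ℤ}
    (ha : a ∉ S) (hT : ∀ I : WeightedInstance, I.spec ab neg a = .rect (r I) (q I) (E I))
    (hb : ∀ I l μ, bound I ≤ l → Filled ab neg S I μ → Ev l μ [] b (r I))
    (hc : ∀ I l μ, bound I ≤ l → Filled ab neg S I μ → ∀ x < r I, Ev l μ [(x : ℤ)] c (q I))
    (he : ∀ I l μ, bound I ≤ l → Filled ab neg S I μ → ∀ x < r I, ∀ y < q I,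
      Ev l μ [(y : ℤ), (x : ℤ)] e (E I x y)) :
    Tri bound (Filled ab neg S) (.tab a b c e) (Filled ab neg (a :: S)) :=
  Tri.tab ha hT hr hq hb hc he

lemma tri_precision : Tri bound (Filled ab neg [4, 3, 2, 1, 0]) (.tab 5 1 1 precisionE)
    (Filled ab neg [5, 4, 3, 2, 1, 0]) := by
  refine fill (fun _ => 1) (fun _ => 1) (fun I => (I.bounds le_rfl).2.2.1)
    (fun I => (I.bounds le_rfl).2.2.1) (by decide) (fun _ => rfl)
    (fun _ _ _ _ _ => Ev.num 1) (fun _ _ _ _ _ _ _ => Ev.num 1) fun I l μ hl hK x hx y hy => ?_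
  have hb := I.bounds hl
  have h1 : ∀ env, Ev l μ env sizeE (I.totalSize + I.n + 1 : ℕ) := fun env => by
    refine Ev.congr ((Ev.add (Ev.sum (ev_n hK (by decide)) (by omega) fun s hs =>
      Ev.sum (Ev.addNat (ev_n hK (by decide)) (Ev.num 2)) (by omega) fun t ht =>
        Ev.sum (Ev.addNat (ev_deg hK (by decide) (Ev.var 1) (Ev.var 0) hs ht) (Ev.num 1))
          (I.degree_bound hl hs ht) fun k hk =>
        (Ev.add (Ev.add (Ev.size (ev_num hK (by decide) (Ev.var 2) (Ev.var 1) (Ev.var 0) hs ht hk))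
          (Ev.size (ev_den hK (by decide) (Ev.var 2) (Ev.var 1) (Ev.var 0) hs ht hk)))
          (Ev.num 1))) (ev_n hK (by decide))).add (Ev.num 1)) ?_
    simp [totalSize, polySize]
  exact Ev.congr ((Ev.num 16).mul ((h1 _).mul (h1 _))) (by simp [precision])

lemma tri_denProd : Tri bound (Filled ab neg [5, 4, 3, 2, 1, 0]) (.tab 6 1 1 denProdE)
    (Filled ab neg [6, 5, 4, 3, 2, 1, 0]) := by
  refine fill (fun _ => 1) (fun _ => 1) (fun I => (I.bounds le_rfl).2.2.1)
    (fun I => (I.bounds le_rfl).2.2.1) (by decide) (fun _ => rfl)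
    (fun _ _ _ _ _ => Ev.num 1) (fun _ _ _ _ _ _ _ => Ev.num 1) fun I l μ hl hK x hx y hy => ?_
  have hb := I.bounds hl
  exact Ev.prod (ev_n hK (by decide)) (by omega) fun s hs =>
      Ev.prod (Ev.addNat (ev_n hK (by decide)) (Ev.num 2)) (by omega) fun t ht =>
        Ev.prod (Ev.addNat (ev_deg hK (by decide) (Ev.var 1) (Ev.var 0) hs ht) (Ev.num 1))
          (I.degree_bound hl hs ht) fun k hk =>
          ev_den hK (by decide) (Ev.var 2) (Ev.var 1) (Ev.var 0) hs ht hk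

lemma tri_base : Tri bound (Filled ab neg [6, 5, 4, 3, 2, 1, 0]) (.tab 7 1 1 (.fold true KE 2))
    (Filled ab neg [7, 6, 5, 4, 3, 2, 1, 0]) := by
  refine fill (fun _ => 1) (fun _ => 1) (fun I => (I.bounds le_rfl).2.2.1)
    (fun I => (I.bounds le_rfl).2.2.1) (by decide) (fun _ => rfl)
    (fun _ _ _ _ _ => Ev.num 1) (fun _ _ _ _ _ _ _ => Ev.num 1) fun I l μ hl hK x hx y hy => ?_
  have hb := I.bounds hl
  exact Ev.congr (Ev.prod (ev_precision hK (by decide)) (by omega) fun k _ => Ev.num 2)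
    (by simp [base])

/-- Powers of the base. -/
lemma ev_pow {I : WeightedInstance} {l : ℕ} {μ : Mem} {S : List (Fin 30)}
    (hK : Know (I.spec ab neg) S μ) (h : 7 ∈ S) {env : List ℤ} {a : PE} {k : ℕ}
    (ha : Ev l μ env a k) (hk : k ≤ l) : Ev l μ env (.fold true a (.cell 7 0 0)) (I.base ^ k) :=
  Ev.congr (Ev.prod ha hk fun _ _ => ev_base hK h) (by simp)

lemma tri_val : Tri bound (Filled ab neg [7, 6, 5, 4, 3, 2, 1, 0]) (.tab 8 nE (nE + 2) valE)
    (Filled ab neg [8, 7, 6, 5, 4, 3, 2, 1, 0]) := by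
  refine fill (fun I => I.n) (fun I => I.n + 2) (fun I => by have := I.bounds le_rfl; omega)
    (fun I => by have := I.bounds le_rfl; omega) (by decide) (fun _ => rfl) (fun _ _ _ _ hK => ev_n hK (by decide))
    (fun _ _ _ _ hK _ _ => Ev.addNat (ev_n hK (by decide)) (Ev.num 2))
    fun I l μ hl hK x hx y hy => ?_
  have hb := I.bounds hl
  have hd := I.degree_bound hl hx hy
  refine Ev.congr (Ev.sum (Ev.addNat (ev_deg hK (by decide) (Ev.var 1) (Ev.var 0) hx hy) (Ev.num 1))
    hd fun k hk => Ev.mul (Ev.mul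
      (ev_num hK (by decide) (Ev.var 2) (Ev.var 1) (Ev.var 0) hx hy hk)
      (Ev.div (ev_denProd hK (by decide))
        (ev_den hK (by decide) (Ev.var 2) (Ev.var 1) (Ev.var 0) hx hy hk)))
      (ev_pow hK (by decide) (Ev.var 0) (by omega))) ?_
  simp [val, hat, eval_finsetSum]

lemma tri_edge : Tri bound (Filled ab neg [8, 7, 6, 5, 4, 3, 2, 1, 0])
    (.tab 9 nE nE (edgeE ab)) (Filled ab neg [9, 8, 7, 6, 5, 4, 3, 2, 1, 0]) := by
  refine fill (fun I => I.n) (fun I => I.n) (fun I => by have := I.bounds le_rfl; omega)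
    (fun I => by have := I.bounds le_rfl; omega) (by decide) (fun _ => rfl) (fun _ _ _ _ hK => ev_n hK (by decide))
    (fun _ _ _ _ hK _ _ => ev_n hK (by decide)) fun I l μ hl hK x hx y hy => ?_
  have h1 : Ev l μ [(y : ℤ), (x : ℤ)] (if ab then .cell 4 (.var 1) 0 else 0)
      (if ab then I.tgt x else 0) := by
    cases ab
    · exact Ev.zero
    · exact ev_tgt hK (by decide) (Ev.var 1) hx
  have hy' : y < I.n + 2 := by omega
  have h2 : Ev l μ [(y : ℤ), (x : ℤ)]
      (.cell 2 (.pair (.var 1) (.var 0)) (.cell 1 (.var 1) (.var 0))) _ :=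
    ev_num hK (by decide) (Ev.var 1) (Ev.var 0)
      (ev_deg hK (by decide) (Ev.var 1) (Ev.var 0) hx hy') hx hy' (Nat.lt_succ_self _)
  refine Ev.congr (Ev.pos h1 (fun _ => Ev.zero)
    fun _ => Ev.pos (Ev.mul h2 h2) (fun _ => Ev.one) fun _ => Ev.zero) ?_
  unfold edge
  simp only [mul_self_pos, Rat.num_ne_zero, coeff_natDegree, ne_eq, leadingCoeff_eq_zero, ite_not]

lemma tri_live : Tri bound (Filled ab neg [9, 8, 7, 6, 5, 4, 3, 2, 1, 0])
    (.tab 10 nE 1 liveE) (Filled ab neg [10, 9, 8, 7, 6, 5, 4, 3, 2, 1, 0]) := by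
  refine fill (fun I => I.n) (fun I => 1) (fun I => by have := I.bounds le_rfl; omega)
    (fun I => by have := I.bounds le_rfl; omega) (by decide) (fun _ => rfl) (fun _ _ _ _ hK => ev_n hK (by decide))
    (fun _ _ _ _ _ _ _ => Ev.num 1) fun I l μ hl hK x hx y hy => ?_
  have hb := I.bounds hl
  exact Ev.pos (Ev.sum (ev_n hK (by decide)) (by omega) fun t ht =>
    ev_edge hK (by decide) (Ev.var 2) (Ev.var 0) hx ht) (fun _ => Ev.one) fun _ => Ev.zero

lemma tri_rep : Tri bound (Filled ab neg [11, 10, 9, 8, 7, 6, 5, 4, 3, 2, 1, 0])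
    (.tab 13 nE 1 repE) (Filled ab neg [13, 11, 10, 9, 8, 7, 6, 5, 4, 3, 2, 1, 0]) := by
  refine fill (fun I => I.n) (fun I => 1) (fun I => by have := I.bounds le_rfl; omega)
    (fun I => by have := I.bounds le_rfl; omega) (by decide) (fun _ => rfl) (fun _ _ _ _ hK => ev_n hK (by decide))
    (fun _ _ _ _ _ _ _ => Ev.num 1) fun I l μ hl hK x hx y hy => ?_
  have hb := I.bounds hl
  exact Ev.pos (Ev.sum (ev_n hK (by decide)) (by omega) fun t ht =>
    Ev.pos (ev_reach hK (by decide) (Ev.var 2) (Ev.var 0) hx ht)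
      (fun _ => Ev.pos (ev_reach hK (by decide) (Ev.var 0) (Ev.var 2) ht hx)
        (fun _ => Ev.pos (Ev.sub (Ev.var 2) (Ev.var 0)) (fun _ => Ev.one) fun _ => Ev.zero)
        fun _ => Ev.one)
      fun _ => Ev.zero) (fun _ => Ev.zero) fun _ => Ev.one

lemma tri_mat : Tri bound (Filled ab neg [13, 11, 10, 9, 8, 7, 6, 5, 4, 3, 2, 1, 0])
    (.tab 14 (2 * nE) (2 * nE) matE)
    (Filled ab neg [14, 13, 11, 10, 9, 8, 7, 6, 5, 4, 3, 2, 1, 0]) := by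
  refine fill (fun I => 2 * I.n) (fun I => 2 * I.n) (fun I => by have := I.bounds le_rfl; omega)
    (fun I => by have := I.bounds le_rfl; omega) (by decide) (fun _ => rfl)
    (fun _ _ _ _ hK => Ev.mulNat (Ev.num 2) (ev_n hK (by decide)))
    (fun _ _ _ _ hK _ _ => Ev.mulNat (Ev.num 2) (ev_n hK (by decide)))
    fun I l μ hl hK x hx y hy => ?_
  have hn : Ev l μ [(y : ℤ), (x : ℤ)] nE I.n := ev_n hK (by decide)
  have hX : Ev l μ [(y : ℤ), (x : ℤ)] (.var 1) x := Ev.var 1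
  have hY : Ev l μ [(y : ℤ), (x : ℤ)] (.var 0) y := Ev.var 0
  have hD : Ev l μ [(y : ℤ), (x : ℤ)] (.ifEq (.var 1) (.var 0) DE 0)
      (if x = y then I.denProd else 0) :=
    Ev.ifEq hX hY (fun _ => ev_denProd hK (by decide)) fun _ => Ev.zero
  exact Ev.ifLt hX hn
    (fun h1 => Ev.ifLt hY hn
      (fun h2 => Ev.pos (ev_rep hK (by decide) hX h1) (fun _ => Ev.zero) fun _ =>
        Ev.pos (ev_live hK (by decide) hX h1)
          (fun _ => Ev.sub hD (ev_val hK (by decide) hX hY h1 (by omega))) fun _ => Ev.zero)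
      fun h2 => Ev.pos (ev_rep hK (by decide) hX h1)
        (fun _ => Ev.ifEq hY (Ev.addNat hX hn) (fun _ => Ev.one) fun _ => Ev.zero)
        fun _ => Ev.zero)
    fun h1 => Ev.ifLt hY hn
      (fun h2 => Ev.ifEq hX (Ev.addNat hY hn) (fun _ => ev_denProd hK (by decide))
        fun _ => Ev.zero)
      fun h2 => Ev.pos (ev_live hK (by decide) (Ev.subNat hX hn (by omega)) (by omega))
        (fun _ => Ev.sub hD (ev_val hK (by decide) (Ev.subNat hX hn (by omega))
          (Ev.subNat hY hn (by omega)) (by omega) (by omega))) fun _ => Ev.zero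

end Prog

end ParamMC

namespace ParamMC

open Ram WeightedInstance

namespace Prog

variable {ab neg : Bool}

/-- `Trip.tab` for an array whose contents change. -/
lemma trip_update {τ : Fin 30 → Table} {S : List (Fin 30)} {a : Fin 30} {b c e : PE}
    {env : List ℤ} {r q h : ℕ} (E : ℕ → ℕ → ℤ) (o : List ℤ) (ha : a ∉ S) (hr : r ≤ h) (hq : q ≤ h)
    (hb : ∀ μ, Know τ S μ → Ev h μ env b r)
    (hc : ∀ μ, Know τ S μ → ∀ x < r, Ev h μ ((x : ℤ) :: env) c q)
    (he : ∀ μ, Know τ S μ → ∀ x < r, ∀ y < q, Ev h μ ((y : ℤ) :: (x : ℤ) :: env) e (E x y))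
    (hE : ∀ x < r, ∀ y < q, |E x y| ≤ 2 ^ h) :
    Trip h (Bd h o (Know τ S)) env (.tab a b c e)
      (Bd h o (Know (Function.update τ a (.rect r q E)) (a :: S))) :=
  Trip.tab o ha (fun x hx => Function.update_of_ne (by rintro rfl; exact ha hx) _ _)
    (Function.update_self ..) hr hq hb hc he hE

lemma Bd.mono {h : ℕ} {o : List ℤ} {P Q : Mem → Prop} (hPQ : ∀ μ, P μ → Q μ) (θ : HState)
    (hθ : Bd h o P θ) : Bd h o Q θ := ⟨hPQ _ hθ.1, hθ.2⟩

/-! ### Reachability -/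

abbrev reachS : Stm := .seq (.tab 11 nE nE (.ifEq (.var 1) (.var 0) 1 0))
  (.loop nE (.seq (.tab 12 nE nE reachE) (.tab 11 nE nE (.cell 12 (.var 1) (.var 0)))))

/-- A round reads the whole old relation, so the new one is first written to array `12` and then
copied back. The entries are always `0` or `1`, so no round increases the bound. -/
lemma tri_reach : Tri bound (Filled ab neg [10, 9, 8, 7, 6, 5, 4, 3, 2, 1, 0]) reachS
    (Filled ab neg [11, 10, 9, 8, 7, 6, 5, 4, 3, 2, 1, 0]) := by
  refine Tri.of_trip X fun I l μ hl _ _ => ?_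
  rw [eval_X]
  refine ⟨le_rfl, fun o => ?_⟩
  have hb := I.bounds hl
  set τ : ℕ → Fin 30 → Table := fun k => Function.update (I.spec ab neg) 11
    (.rect I.n I.n (reachI (I.edge ab) I.n k)) with hτ
  have hle : ∀ k x y, |reachI (I.edge ab) I.n k x y| ≤ 2 ^ l := fun k x y => by
    rw [abs_of_nonneg (reachI_nonneg ..)]
    exact (reachI_le_one ..).trans (one_le_pow₀ (by norm_num))
  have hn : ∀ {τ : Fin 30 → Table} {S μ env}, Know τ S μ → τ 0 = I.spec ab neg 0 → 0 ∈ S →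
      Ev l μ env nE I.n := fun hK h0 h1 =>
    ev_n (I := I) (ab := ab) (neg := neg)
      (hK.mono (S' := [0]) (by simpa using h1) (by simpa using h0.symm)) (by decide)
  refine Trip.seq (Q := Bd l o (Know (τ 0) [11, 10, 9, 8, 7, 6, 5, 4, 3, 2, 1, 0])) ?_ ?_
  · exact trip_update (reachI (I.edge ab) I.n 0) o (by decide) (by omega) (by omega)
      (fun μ hK => hn hK rfl (by decide)) (fun μ hK _ _ => hn hK rfl (by decide))
      (fun μ hK x hx y hy => Ev.ifEq (Ev.var 1) (Ev.var 0) (fun _ => Ev.one) fun _ => Ev.zero)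
      fun x _ y _ => hle ..
  refine (Trip.loop (N := I.n) (by omega)
    (fun k => Bd l o (Know (τ k) [11, 10, 9, 8, 7, 6, 5, 4, 3, 2, 1, 0]))
    (fun θ hθ => ⟨hθ.2.1, hn hθ.1 rfl (by decide)⟩) fun k hk => ?_).conseq (fun _ => id)
    (Bd.mono fun μ hK => hK.mono (fun _ => id) fun a ha => by fin_cases ha <;> rfl)
  refine Trip.seq (trip_update (reachI (I.edge ab) I.n (k + 1)) o (by decide)
    (by omega : I.n ≤ l) (by omega : I.n ≤ l)
    (fun μ hK => hn hK rfl (by decide)) (fun μ hK _ _ => hn hK rfl (by decide))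
    (fun μ hK x hx y hy => ?_) fun x _ y _ => hle ..) ?_
  · have hR : ∀ {env a b x y}, Ev l μ env a (x : ℕ) → Ev l μ env b (y : ℕ) → x < I.n → y < I.n →
        Ev l μ env (.cell 11 a b) (reachI (I.edge ab) I.n k x y) := fun ha hb hx hy =>
      Ev.cell hK 11 (by decide) ha hb ⟨hx, hy⟩
    have hE : ∀ {env a b x y}, Ev l μ env a (x : ℕ) → Ev l μ env b (y : ℕ) → x < I.n → y < I.n →
        Ev l μ env (.cell 9 a b) (I.edge ab x y) := fun ha hb hx hy =>
      Ev.cell hK 9 (by decide) ha hb ⟨hx, hy⟩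
    exact Ev.pos (Ev.add (hR (Ev.var 1) (Ev.var 0) hx hy)
      (Ev.sum (hn hK rfl (by decide)) (by omega) fun j hj =>
        Ev.mul (hR (Ev.var 2) (Ev.var 0) hx hj) (hE (Ev.var 0) (Ev.var 1) hj hy)))
      (fun _ => Ev.one) fun _ => Ev.zero
  · refine (trip_update (τ := Function.update (τ k) 12 (.rect I.n I.n (reachI (I.edge ab) I.n (k + 1))))
      (S := [12, 10, 9, 8, 7, 6, 5, 4, 3, 2, 1, 0])
      (reachI (I.edge ab) I.n (k + 1)) o (by decide) (by omega : I.n ≤ l) (by omega : I.n ≤ l)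
      (fun μ hK => hn hK rfl (by decide)) (fun μ hK _ _ => hn hK rfl (by decide))
      (fun μ hK x hx y hy => Ev.cell hK 12 (by decide) (Ev.var 1) (Ev.var 0) ⟨hx, hy⟩)
      fun x _ y _ => hle ..).conseq ?_ ?_
    · exact Bd.mono fun μ hK => hK.mono (by decide) fun a _ => rfl
    · exact Bd.mono fun μ hK => hK.mono (by decide) fun a ha => by fin_cases ha <;> rfl

/-! ### The adjugate matrix and the determinant -/

abbrev flS : Stm := .seq (.tab 15 (2 * nE) (2 * nE) 0) (.seq (.tab 17 1 1 1)
  (.loop (2 * nE) (.seq (.tab 16 (2 * nE) (2 * nE) adjE)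
    (.seq (.tab 15 (2 * nE) (2 * nE) (.cell 16 (.var 1) (.var 0))) (.tab 17 1 1 detE)))))

/-- Array `16` buffers the new matrix while the old one is read. The scalar in array `17` is updated
last, because the matrix step needs the old scalar and the scalar step needs the new matrix. The
bound is the one of `abs_fl_le`, valid in every round. -/
lemma tri_fl : Tri bound (Filled ab neg [14, 13, 11, 10, 9, 8, 7, 6, 5, 4, 3, 2, 1, 0]) flS
    (Filled ab neg [17, 15, 14, 13, 11, 10, 9, 8, 7, 6, 5, 4, 3, 2, 1, 0]) := by
  refine Tri.of_trip ((3 * X + 1) * (X + 1)) fun I l μ hl hK0 hμ => ?_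
  simp only [eval_mul, eval_add, eval_ofNat, eval_X, eval_one]
  set L := (3 * l + 1) * (l + 1) with hL
  have hlL : l ≤ L := by rw [hL]; nlinarith
  refine ⟨hlL, fun o => ?_⟩
  have hb := I.bounds hl
  set m := 2 * I.n with hm
  -- The matrix is already stored in array `14`, so the bound on the memory is a bound on its
  -- entries.
  have hA : ∀ x < m, ∀ y < m, |I.matZ ab x y| ≤ 2 ^ l := fun x hx y hy => by
    have := hK0 14 (by decide) x y ⟨hx, hy⟩
    change _ = I.matZ ab x y at this
    rw [← this]
    exact hμ _ _
  have hle := fun {k : ℕ} (hk : k ≤ m) => abs_fl_le (by omega : m ≤ l) hA hk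
  have hone : (1 : ℤ) ≤ 2 ^ L := one_le_pow₀ (by norm_num)
  set τ : ℕ → Fin 30 → Table := fun k => Function.update (Function.update (I.spec ab neg) 15
    (.rect m m (fl (I.matZ ab) m k).1)) 17 (.rect 1 1 fun _ _ => (fl (I.matZ ab) m k).2) with hτ
  have hn : ∀ {τ : Fin 30 → Table} {S μ env}, Know τ S μ → τ 0 = I.spec ab neg 0 → 0 ∈ S →
      Ev L μ env (2 * nE) m := fun hK h0 h1 => Ev.mulNat (Ev.num 2)
    (ev_n (I := I) (ab := ab) (neg := neg)
      (hK.mono (S' := [0]) (by simpa using h1) (by simpa using h0.symm)) (by decide))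
  refine Trip.seq (trip_update (r := m) (q := m) (fun _ _ => 0) o (by decide) (by omega) (by omega)
    (fun μ hK => hn hK rfl (by decide)) (fun μ hK _ _ => hn hK rfl (by decide))
    (fun μ hK x hx y hy => Ev.zero) fun x _ y _ => by simp) ?_
  refine Trip.seq (trip_update (r := 1) (q := 1) (fun _ _ => 1) o (by decide) (by omega) (by omega)
    (fun μ hK => Ev.num 1) (fun μ hK _ _ => Ev.num 1)
    (fun μ hK x hx y hy => Ev.one) fun x _ y _ => by simpa using hone) ?_
  refine (Trip.loop (N := m) (by omega)
    (fun k => Bd L o (Know (τ k) [17, 15, 14, 13, 11, 10, 9, 8, 7, 6, 5, 4, 3, 2, 1, 0]))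
    (fun θ hθ => ⟨hθ.2.1, hn hθ.1 rfl (by decide)⟩) fun k hk => ?_).conseq (fun _ => id)
    (Bd.mono fun μ hK => hK.mono (fun _ => id) fun a ha => by fin_cases ha <;> rfl)
  refine Trip.seq (trip_update (fl (I.matZ ab) m (k + 1)).1 o (by decide)
    (by omega : m ≤ L) (by omega : m ≤ L)
    (fun μ hK => hn hK rfl (by decide)) (fun μ hK _ _ => hn hK rfl (by decide))
    (fun μ hK x hx y hy => ?_) fun x hx y hy => (hle hk).1 x hx y hy) (Trip.seq (Q := Bd L o
      (Know (Function.update (Function.update (τ k) 16 (.rect m m (fl (I.matZ ab) m (k + 1)).1)) 15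
        (.rect m m (fl (I.matZ ab) m (k + 1)).1))
        [15, 16, 14, 13, 11, 10, 9, 8, 7, 6, 5, 4, 3, 2, 1, 0])) ?_ ?_)
  · have hM : ∀ {env a b x y}, Ev L μ env a (x : ℕ) → Ev L μ env b (y : ℕ) → x < m → y < m →
        Ev L μ env (.cell 15 a b) ((fl (I.matZ ab) m k).1 x y) := fun ha hb hx hy =>
      Ev.cell hK 15 (by decide) ha hb ⟨hx, hy⟩
    have hA : ∀ {env a b x y}, Ev L μ env a (x : ℕ) → Ev L μ env b (y : ℕ) → x < m → y < m →
        Ev L μ env (.cell 14 a b) (I.matZ ab x y) := fun ha hb hx hy =>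
      Ev.cell hK 14 (by decide) ha hb ⟨hx, hy⟩
    have he : ∀ {env}, Ev L μ env (.cell 17 0 0) (fl (I.matZ ab) m k).2 :=
      Ev.cell hK 17 (by decide) (Ev.num 0) (Ev.num 0) ⟨zero_lt_one, zero_lt_one⟩
    exact Ev.add (Ev.mul (Ev.var 2) (Ev.sum (hn hK rfl (by decide)) (by omega) fun j hj =>
      Ev.mul (hA (Ev.var 2) (Ev.var 0) hx hj) (hM (Ev.var 0) (Ev.var 1) hj hy)))
      (Ev.ifEq (Ev.var 1) (Ev.var 0) (fun _ => he) fun _ => Ev.zero)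
  · exact (trip_update (τ := Function.update (τ k) 16 (.rect m m (fl (I.matZ ab) m (k + 1)).1))
      (S := [16, 14, 13, 11, 10, 9, 8, 7, 6, 5, 4, 3, 2, 1, 0])
      (fl (I.matZ ab) m (k + 1)).1 o (by decide) (by omega : m ≤ L) (by omega : m ≤ L)
      (fun μ hK => hn hK rfl (by decide)) (fun μ hK _ _ => hn hK rfl (by decide))
      (fun μ hK x hx y hy => Ev.cell hK 16 (by decide) (Ev.var 1) (Ev.var 0) ⟨hx, hy⟩)
      fun x hx y hy => (hle hk).1 x hx y hy).conseq
        (Bd.mono fun μ hK => hK.mono (by decide) fun a _ => rfl) (fun _ => id)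
  · refine (trip_update (r := 1) (q := 1) (fun _ _ => (fl (I.matZ ab) m (k + 1)).2) o (by decide)
      (by omega) (by omega) (fun μ hK => Ev.num 1) (fun μ hK _ _ => Ev.num 1)
      (fun μ hK x hx y hy => ?_) fun x hx y hy => (hle hk).2).conseq (fun _ => id)
      (Bd.mono fun μ hK => hK.mono (by decide) fun a ha => by fin_cases ha <;> rfl)
    have hM : ∀ {env a b x y}, Ev L μ env a (x : ℕ) → Ev L μ env b (y : ℕ) → x < m → y < m →
        Ev L μ env (.cell 15 a b) ((fl (I.matZ ab) m (k + 1)).1 x y) := fun ha hb hx hy =>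
      Ev.cell hK 15 (by decide) ha hb ⟨hx, hy⟩
    have hA : ∀ {env a b x y}, Ev L μ env a (x : ℕ) → Ev L μ env b (y : ℕ) → x < m → y < m →
        Ev L μ env (.cell 14 a b) (I.matZ ab x y) := fun ha hb hx hy =>
      Ev.cell hK 14 (by decide) ha hb ⟨hx, hy⟩
    refine Ev.congr (Ev.sub Ev.zero (Ev.sum (hn hK rfl (by decide)) (by omega) fun i hi =>
      Ev.sum (hn hK rfl (by decide)) (by omega) fun j hj =>
        Ev.mul (hA (Ev.var 1) (Ev.var 0) hi hj) (hM (Ev.var 0) (Ev.var 1) hj hi))) ?_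
    rw [zero_sub]
    rfl

/-! ### The solution -/

lemma tri_rhs : Tri bound (Filled ab neg [17, 15, 14, 13, 11, 10, 9, 8, 7, 6, 5, 4, 3, 2, 1, 0])
    (.tab 18 nE 1 (rhsE neg))
    (Filled ab neg [18, 17, 15, 14, 13, 11, 10, 9, 8, 7, 6, 5, 4, 3, 2, 1, 0]) := by
  refine fill (fun I => I.n) (fun I => 1) (fun I => by have := I.bounds le_rfl; omega)
    (fun I => by have := I.bounds le_rfl; omega) (by decide) (fun _ => rfl)
    (fun _ _ _ _ hK => ev_n hK (by decide)) (fun _ _ _ _ _ _ _ => Ev.num 1)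
    fun I l μ hl hK x hx y hy => ?_
  have hb := I.bounds hl
  have hn : ∀ {env}, Ev l μ env nE I.n := ev_n hK (by decide)
  have hsel : Ev l μ [(y : ℤ), (x : ℤ)]
      (if neg then 1 - .cell 4 (.var 1) 0 else .cell 4 (.var 1) 0) (I.sel neg x) := by
    cases neg
    · exact ev_tgt hK (by decide) (Ev.var 1) hx
    · exact Ev.sub Ev.one (ev_tgt hK (by decide) (Ev.var 1) hx)
  exact Ev.mul (Ev.mul (ev_denProd hK (by decide)) hsel) (Ev.prod hn (by omega) fun t ht =>
    Ev.ifEq (Ev.var 0) (Ev.var 2)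
      (fun _ => ev_val hK (by decide) (Ev.var 0) hn ht (by omega))
      fun _ => ev_val hK (by decide) (Ev.var 0) (Ev.addNat hn (Ev.num 1)) ht (by omega))

lemma tri_out :
    Tri bound (Filled ab neg [18, 17, 15, 14, 13, 11, 10, 9, 8, 7, 6, 5, 4, 3, 2, 1, 0])
    (.tab 19 (2 * nE + 1) 1 outE)
    (Filled ab neg [19, 18, 17, 15, 14, 13, 11, 10, 9, 8, 7, 6, 5, 4, 3, 2, 1, 0]) := by
  refine fill (fun I => 2 * I.n + 1) (fun I => 1) (fun I => by have := I.bounds le_rfl; omega)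
    (fun I => by have := I.bounds le_rfl; omega) (by decide) (fun _ => rfl)
    (fun _ _ _ _ hK => Ev.addNat (Ev.mulNat (Ev.num 2) (ev_n hK (by decide))) (Ev.num 1))
    (fun _ _ _ _ _ _ _ => Ev.num 1) fun I l μ hl hK x hx y hy => ?_
  have hb := I.bounds hl
  have hn : ∀ {env}, Ev l μ env nE I.n := ev_n hK (by decide)
  have hden : Ev l μ [(y : ℤ), (x : ℤ)] denE (I.denZ ab) := by
    refine Ev.congr (Ev.mul (Ev.sub Ev.zero (ev_det hK (by decide)))
      (Ev.prod hn (by omega) fun t ht =>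
        ev_val hK (by decide) (Ev.var 0) (Ev.addNat hn (Ev.num 1)) ht (by omega))) ?_
    rw [zero_sub]
    rfl
  refine Ev.congr (Ev.ifLt (Ev.var 1) (Ev.mulNat (Ev.num 2) hn)
    (fun h => Ev.mul (Ev.mulNat (Ev.num 2) hn) (Ev.sum hn (by omega) fun j hj =>
      Ev.mul (ev_adj hK (by decide) (Ev.var 2) (Ev.addNat hn (Ev.var 0)) h (by omega))
        (ev_rhs hK (by decide) (Ev.var 0) hj)))
    fun _ => Ev.pos (Ev.mul hden hden) (fun _ => hden) fun _ => Ev.one) ?_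
  rw [eval_outPoly]
  rfl

lemma tri_quot :
    Tri bound (Filled ab neg [19, 18, 17, 15, 14, 13, 11, 10, 9, 8, 7, 6, 5, 4, 3, 2, 1, 0])
    (.tab 20 (2 * nE + 1) (KE + 1) quotE)
    (Filled ab neg [20, 19, 18, 17, 15, 14, 13, 11, 10, 9, 8, 7, 6, 5, 4, 3, 2, 1, 0]) := by
  refine fill (fun I => 2 * I.n + 1) (fun I => I.precision + 1)
    (fun I => by have := I.bounds le_rfl; omega)
    (fun I => by have := I.bounds le_rfl; omega) (by decide) (fun _ => rfl)
    (fun _ _ _ _ hK => Ev.addNat (Ev.mulNat (Ev.num 2) (ev_n hK (by decide))) (Ev.num 1))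
    (fun _ _ _ _ hK _ _ => Ev.addNat (ev_precision hK (by decide)) (Ev.num 1))
    fun I l μ hl hK x hx y hy => ?_
  have hb := I.bounds hl
  have hp : Ev l μ [(y : ℤ), (x : ℤ)] (.fold true (.var 0) (.cell 7 0 0)) (I.base ^ y) :=
    ev_pow hK (by decide) (Ev.var 0) (by omega)
  exact Ev.congr (Ev.div (Ev.add (Ev.mul (Ev.num 2) (ev_out hK (by decide) (Ev.var 1) hx)) hp)
    (Ev.mul (Ev.num 2) hp)) (rounded_quotient (I.outPoly_small_base ab neg x) y)

lemma tri_deg :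
    Tri bound (Filled ab neg [20, 19, 18, 17, 15, 14, 13, 11, 10, 9, 8, 7, 6, 5, 4, 3, 2, 1, 0])
    (.tab 21 (2 * nE + 1) 1 degE)
    (Filled ab neg [21, 20, 19, 18, 17, 15, 14, 13, 11, 10, 9, 8, 7, 6, 5, 4, 3, 2, 1, 0]) := by
  refine fill (fun I => 2 * I.n + 1) (fun I => 1)
    (fun I => by have := I.bounds le_rfl; omega)
    (fun I => by have := I.bounds le_rfl; omega) (by decide) (fun _ => rfl)
    (fun _ _ _ _ hK => Ev.addNat (Ev.mulNat (Ev.num 2) (ev_n hK (by decide))) (Ev.num 1))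
    (fun _ _ _ _ _ _ _ => Ev.num 1) fun I l μ hl hK x hx y hy => ?_
  have hb := I.bounds hl
  refine Ev.congr (Ev.sum (ev_precision hK (by decide)) (by omega) fun k hk =>
    have hq := ev_quot hK (by decide) (Ev.var 2) (Ev.addNat (Ev.var 0) (Ev.num 1)) hx
      (by omega : k + 1 < I.precision + 1)
    Ev.pos (Ev.mul hq hq) (fun _ => Ev.one) fun _ => Ev.zero) ?_
  exact (natDegree_eq_sum (I.outPoly_small_base ab neg x) (I.outPoly_small ab neg x).2).symm

lemma tri_miss :
    Tri bound (Filled ab neg [21, 20, 19, 18, 17, 15, 14, 13, 11, 10, 9, 8, 7, 6, 5, 4, 3, 2, 1, 0])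
    (.tab 22 nE 1 missE) (Filled ab neg [22, 21, 20, 7, 0]) := by
  obtain ⟨p, hp⟩ : Tri bound
      (Filled ab neg [21, 20, 19, 18, 17, 15, 14, 13, 11, 10, 9, 8, 7, 6, 5, 4, 3, 2, 1, 0])
      (.tab 22 nE 1 missE)
      (Filled ab neg [22, 21, 20, 19, 18, 17, 15, 14, 13, 11, 10, 9, 8, 7, 6, 5, 4, 3, 2, 1, 0]) := by
    refine fill (fun I => I.n) (fun I => 1)
      (fun I => by have := I.bounds le_rfl; omega)
      (fun I => by have := I.bounds le_rfl; omega) (by decide) (fun _ => rfl)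
      (fun _ _ _ _ hK => ev_n hK (by decide)) (fun _ _ _ _ _ _ _ => Ev.num 1)
      fun I l μ hl hK x hx y hy => ?_
    have hb := I.bounds hl
    exact Ev.sum (ev_n hK (by decide)) (by omega) fun t ht =>
      Ev.pos (ev_reach hK (by decide) (Ev.var 2) (Ev.var 0) hx ht)
        (fun _ => Ev.pos (ev_rep hK (by decide) (Ev.var 0) ht)
          (fun _ => Ev.sub Ev.one (ev_tgt hK (by decide) (Ev.var 0) ht)) fun _ => Ev.zero)
        fun _ => Ev.zero
  exact ⟨p, fun i l θ h1 h2 h3 => ⟨(hp i l θ h1 h2 h3).1,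
    Bd.mono (fun μ hK => hK.mono (by decide) fun _ _ => rfl) _ (hp i l θ h1 h2 h3).2⟩⟩

/-- The computation, between input and output. -/
abbrev computeS (ab neg : Bool) : Stm :=
  .seq (.tab 5 1 1 precisionE) (.seq (.tab 6 1 1 denProdE) (.seq (.tab 7 1 1 (.fold true KE 2))
    (.seq (.tab 8 nE (nE + 2) valE) (.seq (.tab 9 nE nE (edgeE ab)) (.seq (.tab 10 nE 1 liveE)
      (.seq reachS (.seq (.tab 13 nE 1 repE) (.seq (.tab 14 (2 * nE) (2 * nE) matE) (.seq flS
        (.seq (.tab 18 nE 1 (rhsE neg)) (.seq (.tab 19 (2 * nE + 1) 1 outE)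
          (.seq (.tab 20 (2 * nE + 1) (KE + 1) quotE) (.seq (.tab 21 (2 * nE + 1) 1 degE)
            (.tab 22 nE 1 missE))))))))))))))

theorem tri_compute : Tri bound (Filled ab neg [4, 3, 2, 1, 0]) (computeS ab neg)
    (Filled ab neg [22, 21, 20, 7, 0]) :=
  tri_precision.seq (tri_denProd.seq (tri_base.seq (tri_val.seq (tri_edge.seq (tri_live.seq
    (tri_reach.seq (tri_rep.seq (tri_mat.seq (tri_fl.seq (tri_rhs.seq (tri_out.seq (tri_quot.seq
      (tri_deg.seq tri_miss)))))))))))))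

end Prog

end ParamMC

namespace ParamMC

open Ram WeightedInstance

namespace Prog

/-! ## Reading the input -/

/-- Property of the memory, with bounded entries, a fixed rest of the input and no output. -/
def In (l : ℕ) (x : List ℤ) (P : Mem → Prop) (θ : HState) : Prop :=
  P θ.mem ∧ MemLe l θ.mem ∧ θ.inp = x ∧ θ.out = []

variable {l : ℕ} {env : List ℤ} {P Q : Mem → Prop}

lemma In.mono {x : List ℤ} (h : ∀ μ, P μ → Q μ) (θ : HState) (hθ : In l x P θ) : In l x Q θ :=
  ⟨h _ hθ.1, hθ.2⟩

lemma trip_read {a : Fin 30} {i : PE} {z x : ℤ} {y : List ℤ} (hx : |x| ≤ 2 ^ l)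
    (hi : ∀ μ, P μ → Ev l μ env i z) (hQ : ∀ μ, P μ → Q (μ.put a z x)) :
    Trip l (In l (x :: y) P) env (.read a i) (In l y Q) := by
  rintro θ ⟨h1, h2, h3, h4⟩
  have h5 := hi _ h1
  refine ⟨⟨h2, h5.ok, by rw [h3]; exact hx⟩, ?_⟩
  simp only [Stm.run, h5.eval, h3]
  exact ⟨hQ _ h1, h2.put _ _ hx, rfl, h4⟩

lemma trip_set {a : Fin 30} {i e : PE} {z x : ℤ} {y : List ℤ} (hx : |x| ≤ 2 ^ l)
    (hi : ∀ μ, P μ → Ev l μ env i z) (he : ∀ μ, P μ → Ev l μ env e x)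
    (hQ : ∀ μ, P μ → Q (μ.put a z x)) :
    Trip l (In l y P) env (.set a i e) (In l y Q) := by
  rintro θ ⟨h1, h2, h3, h4⟩
  have h5 := hi _ h1
  have h6 := he _ h1
  refine ⟨⟨h2, h5.ok, h6.ok⟩, ?_⟩
  simp only [Stm.run, h5.eval, h6.eval]
  exact ⟨hQ _ h1, h2.put _ _ hx, h3, h4⟩

lemma trip_readLoop {N : ℕ} {b : PE} {t : Stm} {f : ℕ → List ℤ} {P : ℕ → Mem → Prop} (hN : N ≤ l)
    (hb : ∀ μ, P 0 μ → Ev l μ env b N)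
    (h : ∀ k < N, ∀ y, Trip l (In l (f k ++ y) (P k)) ((k : ℤ) :: env) t (In l y (P (k + 1))))
    (y : List ℤ) :
    Trip l (In l ((List.range N).flatMap f ++ y) (P 0)) env (.loop b t) (In l y (P N)) := by
  have key := Trip.loop (l := l) (env := env) (b := b) (t := t) hN
    (fun k => In l ((List.range' k (N - k)).flatMap f ++ y) (P k))
    (fun θ hθ => ⟨hθ.2.1, hb _ hθ.1⟩) fun k hk => ?_
  · simpa [List.range_eq_range'] using key
  · rw [show N - k = (N - (k + 1)) + 1 by omega, List.range'_succ, List.flatMap_cons,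
      List.append_assoc]
    exact h k hk _

/-- The polynomial `p` is stored at the address `z`. -/
def PolyAt (μ : Mem) (z : ℕ) (p : ℚ[X]) : Prop :=
  μ 1 z = p.natDegree ∧ ∀ k < p.natDegree + 1,
    μ 2 (Nat.pair z k : ℕ) = (p.coeff k).num ∧ μ 3 (Nat.pair z k : ℕ) = (p.coeff k).den

/-- Read a polynomial; `r'` is `r` below one more loop. -/
abbrev readPolyS (r r' : PE) : Stm := .seq (.read 1 r) (.loop (.get 1 r + 1)
  (.seq (.read 2 (.pair r' (.var 0))) (.read 3 (.pair r' (.var 0)))))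

/-- Bounds for the degree and the coefficients of a polynomial. -/
def PolyLe (l : ℕ) (p : ℚ[X]) : Prop := p.natDegree + 1 ≤ l ∧
  ∀ k < p.natDegree + 1, |(p.coeff k).num| ≤ 2 ^ l ∧ |((p.coeff k).den : ℤ)| ≤ 2 ^ l

lemma natCast_bound {n l : ℕ} (h : n ≤ l) : |(n : ℤ)| ≤ 2 ^ l := by
  rw [Nat.abs_cast]
  exact_mod_cast h.trans Nat.lt_two_pow_self.le

/-- The memory outside the cells of the polynomial at `z`. -/
def Agree (z : ℕ) (μ ν : Mem) : Prop := ∀ a : Fin 30, ∀ i : ℤ,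
  (a = 1 → i ≠ z) → (a = 2 ∨ a = 3 → ∀ k : ℕ, i ≠ (Nat.pair z k : ℕ)) → ν a i = μ a i

/-- Here `P` is any property that does not depend on the cells of the polynomial being read, so it
survives. The invariant `K i j` says that `i` numerators and `j` denominators have been stored, as
these alternate on the tape. -/
lemma trip_readPoly {z : ℕ} {r r' : PE} {p : ℚ[X]} (hp : PolyLe l p)
    (hP : ∀ μ ν, P μ → Agree z μ ν → P ν) (hr : ∀ μ, P μ → Ev l μ env r z)
    (hr' : ∀ μ, P μ → ∀ k : ℕ, Ev l μ ((k : ℤ) :: env) r' z) (y : List ℤ) :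
    Trip l (In l (encPoly p ++ y) P) env (readPolyS r r')
      (In l y fun μ => P μ ∧ PolyAt μ z p) := by
  set K : ℕ → ℕ → Mem → Prop := fun i j μ => P μ ∧ μ 1 z = p.natDegree ∧
    (∀ k < i, μ 2 (Nat.pair z k : ℕ) = (p.coeff k).num) ∧
    ∀ k < j, μ 3 (Nat.pair z k : ℕ) = (p.coeff k).den with hK
  rw [encPoly, List.cons_append]
  refine Trip.seq (trip_read (Q := K 0 0) (natCast_bound (by have := hp.1; omega)) hr
    fun μ h => ⟨hP μ _ h fun a i h1 _ => Mem.put_of_ne _ _ ?_, Mem.put_same .., by simp, by simp⟩) ?_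
  · by_cases ha : a = 1
    · exact .inr (h1 ha)
    · exact .inl ha
  refine (trip_readLoop (P := fun k => K k k) hp.1 (fun μ h => ?_) (fun k hk y => ?_) y).conseq
    (fun _ => id) (In.mono fun μ h => ⟨h.1, h.2.1, fun k hk => ⟨h.2.2.1 k hk, h.2.2.2 k hk⟩⟩)
  · exact Ev.addNat (((hr μ h.1).get 1).congr h.2.1) (Ev.num 1)
  have hpair : ∀ {i j : ℕ}, i ≠ j → ((Nat.pair z i : ℕ) : ℤ) ≠ (Nat.pair z j : ℕ) := by
    intro i j hij
    rw [Ne, Nat.cast_inj, Nat.pair_eq_pair]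
    tauto
  refine Trip.seq (trip_read (Q := K (k + 1) k) (hp.2 k hk).1
    (fun μ h => Ev.pair (hr' μ h.1 k) (Ev.var 0)) fun μ h => ?_)
    (trip_read (hp.2 k hk).2 (fun μ h => Ev.pair (hr' μ h.1 k) (Ev.var 0)) fun μ h => ?_)
  · refine ⟨hP μ _ h.1 fun a i _ h2 => Mem.put_of_ne _ _ ?_, ?_, fun j hj => ?_, fun j hj => ?_⟩
    · by_cases ha : a = 2
      · exact .inr (h2 (.inl ha) k)
      · exact .inl ha
    · rw [Mem.put_of_ne _ _ (.inl (by decide))]; exact h.2.1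
    · rcases (by omega : j = k ∨ j < k) with rfl | hjk
      · exact Mem.put_same ..
      · rw [Mem.put_of_ne _ _ (.inr (hpair hjk.ne))]; exact h.2.2.1 j hjk
    · rw [Mem.put_of_ne _ _ (.inl (by decide))]; exact h.2.2.2 j hj
  · refine ⟨hP μ _ h.1 fun a i _ h2 => Mem.put_of_ne _ _ ?_, ?_, fun j hj => ?_, fun j hj => ?_⟩
    · by_cases ha : a = 3
      · exact .inr (h2 (.inr ha) k)
      · exact .inl ha
    · rw [Mem.put_of_ne _ _ (.inl (by decide))]; exact h.2.1
    · rw [Mem.put_of_ne _ _ (.inl (by decide))]; exact h.2.2.1 j hj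
    · rcases (by omega : j = k ∨ j < k) with rfl | hjk
      · exact Mem.put_same ..
      · rw [Mem.put_of_ne _ _ (.inr (hpair hjk.ne))]; exact h.2.2.2 j hjk

/-- Store the polynomial `1`. -/
abbrev setOneS (r : PE) : Stm :=
  .seq (.set 1 r 0) (.seq (.set 2 (.pair r 0) 1) (.set 3 (.pair r 0) 1))

lemma trip_setOne {z : ℕ} {r : PE} (hP : ∀ μ ν, P μ → Agree z μ ν → P ν)
    (hr : ∀ μ, P μ → Ev l μ env r z) (y : List ℤ) :
    Trip l (In l y P) env (setOneS r) (In l y fun μ => P μ ∧ PolyAt μ z 1) := by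
  have h1 : |(1 : ℤ)| ≤ 2 ^ l := by simpa using one_le_pow₀ (by norm_num : (1 : ℤ) ≤ 2)
  refine Trip.seq (trip_set (Q := fun μ => P μ ∧ μ 1 z = 0) (x := 0) (by simp) hr
    (fun _ _ => Ev.zero) fun μ h =>
      ⟨hP μ _ h fun a i h1 _ => Mem.put_of_ne _ _ ?_, Mem.put_same ..⟩) (Trip.seq (trip_set
    (Q := fun μ => P μ ∧ μ 1 z = 0 ∧ μ 2 (Nat.pair z 0 : ℕ) = 1) h1
    (fun μ h => Ev.pair (hr μ h.1) (Ev.num 0)) (fun _ _ => Ev.one) fun μ h => ?_) (trip_set h1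
    (fun μ h => Ev.pair (hr μ h.1) (Ev.num 0)) (fun _ _ => Ev.one) fun μ h => ?_))
  · by_cases ha : a = 1
    · exact .inr (h1 ha)
    · exact .inl ha
  · refine ⟨hP μ _ h.1 fun a i _ h2 => Mem.put_of_ne _ _ ?_, ?_, Mem.put_same ..⟩
    · by_cases ha : a = 2
      · exact .inr (h2 (.inl ha) 0)
      · exact .inl ha
    · rw [Mem.put_of_ne _ _ (.inl (by decide))]; exact h.2
  · refine ⟨hP μ _ h.1 fun a i _ h2 => Mem.put_of_ne _ _ ?_, ?_, fun k hk => ?_⟩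
    · by_cases ha : a = 3
      · exact .inr (h2 (.inr ha) 0)
      · exact .inl ha
    · rw [Mem.put_of_ne _ _ (.inl (by decide))]; simpa using h.2.1
    · obtain rfl : k = 0 := by simpa using hk
      rw [Mem.put_of_ne _ _ (.inl (by decide)), Mem.put_same]
      simpa using h.2.2

/-- Contents of the memory while the input is read. -/
structure Loaded (I : WeightedInstance) (G : ℕ → ℕ → Prop) (j : ℕ) (μ : Mem) : Prop where
  n : μ 0 0 = I.n
  poly : ∀ s t, G s t → PolyAt μ (Nat.pair s t) (I.poly s t)
  tgt : ∀ s < j, μ 4 (Nat.pair s 0 : ℕ) = I.tgt s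

variable {I : WeightedInstance} {G G' : ℕ → ℕ → Prop} {j : ℕ}

lemma Loaded.ev_n {μ : Mem} (h : Loaded I G j μ) : Ev l μ env nE I.n :=
  ((Ev.pair (Ev.num 0) (Ev.num 0)).get 0).congr h.n

lemma Loaded.agree {s t : ℕ} (hG : ¬ G s t) (μ ν : Mem) (h : Loaded I G j μ)
    (hA : Agree (Nat.pair s t) μ ν) : Loaded I G j ν := by
  refine ⟨?_, fun s' t' hG' => ?_, fun k hk => ?_⟩
  · rw [hA 0 _ (fun h => absurd h (by decide)) fun h => absurd h (by decide)]; exact h.n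
  · have hne : Nat.pair s' t' ≠ Nat.pair s t := fun he => by
      obtain ⟨rfl, rfl⟩ := Nat.pair_eq_pair.1 he
      exact hG hG'
    have hne' : ∀ k k' : ℕ, ((Nat.pair (Nat.pair s' t') k : ℕ) : ℤ) ≠
        (Nat.pair (Nat.pair s t) k' : ℕ) := fun k k' he =>
      hne (Nat.pair_eq_pair.1 (Nat.cast_injective he)).1
    obtain ⟨h1, h2⟩ := h.poly s' t' hG'
    refine ⟨?_, fun k hk => ⟨?_, ?_⟩⟩
    · rw [hA 1 _ (fun _ => by exact_mod_cast hne) fun h => absurd h (by decide)]; exact h1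
    · rw [hA 2 _ (fun h => absurd h (by decide)) fun _ k' => hne' k k']; exact (h2 k hk).1
    · rw [hA 3 _ (fun h => absurd h (by decide)) fun _ k' => hne' k k']; exact (h2 k hk).2
  · rw [hA 4 _ (fun h => absurd h (by decide)) fun h => absurd h (by decide)]; exact h.tgt k hk

lemma Loaded.insert {s t : ℕ} {μ : Mem} (h : Loaded I G j μ)
    (hp : PolyAt μ (Nat.pair s t) (I.poly s t))
    (hG : ∀ s' t', G' s' t' → G s' t' ∨ (s' = s ∧ t' = t)) : Loaded I G' j μ := by
  refine ⟨h.n, fun s' t' h' => ?_, h.tgt⟩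
  rcases hG s' t' h' with h1 | ⟨rfl, rfl⟩
  · exact h.poly s' t' h1
  · exact hp

lemma polyLe {s t : ℕ} (hl : I.bound ≤ l) (hs : s < I.n) (ht : t < I.n + 2) :
    PolyLe l (I.poly s t) := by
  have h1 := (I.polySize_le hs ht).trans (I.bounds hl).2.1
  refine ⟨I.degree_bound hl hs ht, fun k hk => ?_⟩
  have h2 : ((I.poly s t).coeff k).num.natAbs.size + ((I.poly s t).coeff k).den.size + 1 ≤ l :=
    (Finset.single_le_sum (f := fun k => ((I.poly s t).coeff k).num.natAbs.size +
      ((I.poly s t).coeff k).den.size + 1) (fun _ _ => Nat.zero_le _) (Finset.mem_range.2 hk)).trans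
      h1
  rw [← Int.natCast_natAbs, ← Int.natCast_natAbs, Int.natAbs_natCast]
  constructor
  · exact_mod_cast (Nat.lt_size_self _).le.trans
      (Nat.pow_le_pow_right (by norm_num) (by omega))
  · exact_mod_cast (Nat.lt_size_self _).le.trans
      (Nat.pow_le_pow_right (by norm_num) (by omega))

/-- The initial state does not influence the output, which is given for every state; it is consumed
into the spare array `29`. -/
abbrev readInstanceS : Stm := .seq (.read 0 0) (.seq (.read 29 0) (.seq
  (.loop nE (.loop nE (readPolyS (.pair (.var 1) (.var 0)) (.pair (.var 2) (.var 1)))))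
  (.loop nE (.read 4 (.pair (.var 0) 0)))))

abbrev readWeightsS : Stm := .loop nE (.seq (readPolyS (.pair (.var 0) nE) (.pair (.var 1) nE))
  (readPolyS (.pair (.var 0) (nE + 1)) (.pair (.var 1) (nE + 1))))

abbrev setWeightsS : Stm := .loop nE (.seq (setOneS (.pair (.var 0) nE))
  (setOneS (.pair (.var 0) (nE + 1))))

lemma encVec_eq {α : Type} {enc : α → List ℤ} {n : ℕ} {v : Fin n → α} {f : ℕ → List ℤ}
    (h : ∀ s : Fin n, enc (v s) = f s) : encVec enc v = (List.range n).flatMap f := by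
  simp only [encVec, h]
  rw [← List.map_coe_finRange_eq_range, List.flatMap_map]

lemma encInstance_eq (I : WeightedInstance) : encInstance I.toInstance =
    (I.n : ℤ) :: (I.M.init : ℤ) ::
      ((List.range I.n).flatMap (fun s => (List.range I.n).flatMap fun t => encPoly (I.poly s t)) ++
        (List.range I.n).flatMap fun s => [I.tgt s]) := by
  have h1 : encVec (encVec encPoly) I.M.P =
      (List.range I.n).flatMap fun s => (List.range I.n).flatMap fun t => encPoly (I.poly s t) :=
    encVec_eq fun s => encVec_eq (f := fun t => encPoly (I.poly s t)) fun t => by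
      rw [← I.poly_trans s t]
  have h2 : encVec (fun s => [if s ∈ I.T then 1 else 0]) id =
      (List.range I.n).flatMap fun s => [I.tgt s] := encVec_eq fun s => by rw [I.tgt_eq]; rfl
  rw [encInstance, h1, h2]

lemma encWeights_eq (I : WeightedInstance) : encVec encFraction I.wgt =
    (List.range I.n).flatMap fun s => encPoly (I.poly s I.n) ++ encPoly (I.poly s (I.n + 1)) :=
  encVec_eq fun s => by rw [encFraction, ← I.poly_num, ← I.poly_den]

lemma trip_readInstance (hl : I.bound ≤ l) (y : List ℤ) :
    Trip l (In l (encInstance I.toInstance ++ y) fun _ => True) [] readInstanceS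
      (In l y (Loaded I (fun s t => s < I.n ∧ t < I.n) I.n)) := by
  have hb := I.bounds hl
  rw [encInstance_eq, List.cons_append, List.cons_append, List.append_assoc]
  refine Trip.seq (trip_read (Q := fun μ => μ 0 0 = I.n) (natCast_bound (by omega))
    (fun _ _ => Ev.zero) fun μ _ => Mem.put_same ..) (Trip.seq (trip_read
    (Q := Loaded I (fun s t => s < 0 ∧ t < I.n) 0)
    (natCast_bound (n := I.M.init) (by have := I.M.init.isLt; omega))
    (fun _ _ => Ev.zero) fun μ h => ⟨?_, by simp, by simp⟩) (Trip.seq (trip_readLoop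
      (P := fun s' => Loaded I (fun s t => s < s' ∧ t < I.n) 0) (by omega) (fun μ h => h.ev_n)
      (fun s hs y => ?_) _) (trip_readLoop (P := Loaded I (fun s t => s < I.n ∧ t < I.n)) (by omega)
      (fun μ h => h.ev_n) (fun s hs y => ?_) _)))
  · rw [Mem.put_of_ne _ _ (.inl (by decide))]; exact h
  · refine (trip_readLoop (P := fun t' =>
      Loaded I (fun s' t => (s' < s ∧ t < I.n) ∨ (s' = s ∧ t < t')) 0) (by omega)
      (fun μ h => h.ev_n) (fun t ht y => ?_) y).conseq
      (In.mono fun μ h => ⟨h.n, fun s' t h' => h.poly s' t (by omega), h.tgt⟩)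
      (In.mono fun μ h => ⟨h.n, fun s' t h' => h.poly s' t (by omega), h.tgt⟩)
    exact (trip_readPoly (polyLe hl hs (by omega)) (Loaded.agree (s := s) (t := t) (by omega))
      (fun _ _ => Ev.pair (Ev.var 1) (Ev.var 0)) (fun _ _ k => Ev.pair (Ev.var 2) (Ev.var 1))
      y).conseq (fun _ => id) (In.mono fun μ h => h.1.insert h.2 fun s' t' h' => by omega)
  · refine trip_read (z := (Nat.pair s 0 : ℕ)) ?_ (fun _ _ => Ev.pair (Ev.var 0) (Ev.num 0))
      fun μ h => ⟨?_, fun s' t h' => ⟨?_, fun k hk => ⟨?_, ?_⟩⟩, fun k hk => ?_⟩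
    · have : I.tgt s = 0 ∨ I.tgt s = 1 := by unfold tgt; split_ifs <;> simp
      rcases this with h | h
      · simp [h]
      · simpa [h] using one_le_pow₀ (by norm_num : (1 : ℤ) ≤ 2)
    · rw [Mem.put_of_ne _ _ (.inl (by decide))]; exact h.n
    · rw [Mem.put_of_ne _ _ (.inl (by decide))]; exact (h.poly s' t h').1
    · rw [Mem.put_of_ne _ _ (.inl (by decide))]; exact ((h.poly s' t h').2 k hk).1
    · rw [Mem.put_of_ne _ _ (.inl (by decide))]; exact ((h.poly s' t h').2 k hk).2
    · rcases (by omega : k = s ∨ k < s) with rfl | hks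
      · exact Mem.put_same ..
      · rw [Mem.put_of_ne _ _ (.inr _)]
        · exact h.tgt k hks
        · rw [Ne, Nat.cast_inj, Nat.pair_eq_pair]; omega

lemma trip_readWeights (hl : I.bound ≤ l) (y : List ℤ) :
    Trip l (In l (encVec encFraction I.wgt ++ y) (Loaded I (fun s t => s < I.n ∧ t < I.n) I.n)) []
      readWeightsS (In l y (Loaded I (fun s t => s < I.n ∧ t < I.n + 2) I.n)) := by
  have hb := I.bounds hl
  rw [encWeights_eq]
  refine (trip_readLoop (P := fun s' => Loaded I
    (fun s t => (s < I.n ∧ t < I.n) ∨ (s < s' ∧ t < I.n + 2)) I.n) (by omega) (fun μ h => h.ev_n)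
    (fun s hs y => ?_) y).conseq
    (In.mono fun μ h => ⟨h.n, fun s' t h' => h.poly s' t (by omega), h.tgt⟩)
    (In.mono fun μ h => ⟨h.n, fun s' t h' => h.poly s' t (by omega), h.tgt⟩)
  rw [List.append_assoc]
  refine Trip.seq (Q := In l (encPoly (I.poly s (I.n + 1)) ++ y) (Loaded I (fun s' t =>
    (s' < I.n ∧ t < I.n) ∨ (s' < s ∧ t < I.n + 2) ∨ (s' = s ∧ t = I.n)) I.n)) ?_ ?_
  · exact (trip_readPoly (polyLe hl hs (by omega)) (Loaded.agree (s := s) (t := I.n) (by omega))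
      (fun _ h => Ev.pair (Ev.var 0) h.ev_n) (fun _ h k => Ev.pair (Ev.var 1) h.ev_n)
      _).conseq (fun _ => id) (In.mono fun μ h => h.1.insert h.2 fun s' t' h' => by omega)
  · exact (trip_readPoly (polyLe hl hs (by omega)) (Loaded.agree (s := s) (t := I.n + 1) (by omega))
      (fun _ h => Ev.pair (Ev.var 0) (Ev.addNat h.ev_n (Ev.num 1)))
      (fun _ h k => Ev.pair (Ev.var 1) (Ev.addNat h.ev_n (Ev.num 1)))
      _).conseq (fun _ => id) (In.mono fun μ h => h.1.insert h.2 fun s' t' h' => by omega)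

lemma trip_setWeights (hl : I.bound ≤ l) (hI : ∀ s < I.n, I.poly s I.n = 1 ∧ I.poly s (I.n + 1) = 1)
    (y : List ℤ) :
    Trip l (In l y (Loaded I (fun s t => s < I.n ∧ t < I.n) I.n)) []
      setWeightsS (In l y (Loaded I (fun s t => s < I.n ∧ t < I.n + 2) I.n)) := by
  have hb := I.bounds hl
  refine (Trip.loop (N := I.n) (by omega) (fun s' => In l y (Loaded I
    (fun s t => (s < I.n ∧ t < I.n) ∨ (s < s' ∧ t < I.n + 2)) I.n))
    (fun θ h => ⟨h.2.1, h.1.ev_n⟩) (fun s hs => ?_)).conseq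
    (In.mono fun μ h => ⟨h.n, fun s' t h' => h.poly s' t (by omega), h.tgt⟩)
    (In.mono fun μ h => ⟨h.n, fun s' t h' => h.poly s' t (by omega), h.tgt⟩)
  refine Trip.seq (Q := In l y (Loaded I (fun s' t =>
    (s' < I.n ∧ t < I.n) ∨ (s' < s ∧ t < I.n + 2) ∨ (s' = s ∧ t = I.n)) I.n)) ?_ ?_
  · exact (trip_setOne (Loaded.agree (s := s) (t := I.n) (by omega))
      (fun _ h => Ev.pair (Ev.var 0) h.ev_n) _).conseq (fun _ => id) (In.mono fun μ h =>
        h.1.insert (by rw [(hI s hs).1]; exact h.2) fun s' t' h' => by omega)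
  · exact (trip_setOne (Loaded.agree (s := s) (t := I.n + 1) (by omega))
      (fun _ h => Ev.pair (Ev.var 0) (Ev.addNat h.ev_n (Ev.num 1))) _).conseq (fun _ => id)
      (In.mono fun μ h =>
        h.1.insert (by rw [(hI s hs).2]; exact h.2) fun s' t' h' => by omega)

lemma Loaded.filled {ab neg : Bool} {μ : Mem}
    (h : Loaded I (fun s t => s < I.n ∧ t < I.n + 2) I.n μ) : Filled ab neg [4, 3, 2, 1, 0] I μ := by
  intro a ha x y hd
  fin_cases ha
  · obtain ⟨hx, hy⟩ : x < I.n ∧ y < 1 := hd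
    obtain rfl : y = 0 := by omega
    exact h.tgt x hx
  · have := ((h.poly _ _ ⟨hd.1, hd.2.1⟩).2 y (Nat.lt_succ_of_le hd.2.2)).2
    rwa [Nat.pair_unpair] at this
  · have := ((h.poly _ _ ⟨hd.1, hd.2.1⟩).2 y (Nat.lt_succ_of_le hd.2.2)).1
    rwa [Nat.pair_unpair] at this
  · exact (h.poly x y hd).1
  · obtain ⟨hx, hy⟩ : x < 1 ∧ y < 1 := hd
    obtain rfl : y = 0 := by omega
    obtain rfl : x = 0 := by omega
    exact h.n

end Prog

end ParamMC

namespace ParamMC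

open Ram WeightedInstance

/-! ## Size of the input -/

lemma tapeSize_append (x y : List ℤ) : tapeSize (x ++ y) = tapeSize x + tapeSize y := by
  simp [tapeSize]

lemma tapeSize_flatMap_range (n : ℕ) (f : ℕ → List ℤ) :
    tapeSize ((List.range n).flatMap f) = ∑ s ∈ Finset.range n, tapeSize (f s) := by
  induction n with
  | zero => rfl
  | succ n ih =>
    rw [List.range_succ, List.flatMap_append, tapeSize_append, ih, Finset.sum_range_succ]
    simp

lemma polySize_le_tapeSize (I : WeightedInstance) (s t : ℕ) :
    I.polySize s t ≤ tapeSize (encPoly (I.poly s t)) := by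
  rw [encPoly, show ∀ a x, tapeSize (a :: x) = bitLen a + tapeSize x from fun _ _ => by
    simp [tapeSize], tapeSize_flatMap_range, polySize]
  refine le_trans (Finset.sum_le_sum fun k _ => ?_) (Nat.le_add_left _ _)
  simp only [tapeSize, bitLen, List.map_cons, List.map_nil, List.sum_cons, List.sum_nil,
    Int.natAbs_natCast]
  omega

lemma sum_polySize_add_le (I : WeightedInstance) :
    (∑ s ∈ Finset.range I.n, ∑ t ∈ Finset.range I.n, I.polySize s t) + I.n ≤
      tapeSize (encInstance I.toInstance) := by
  rw [Prog.encInstance_eq, show ∀ a b x, tapeSize (a :: b :: x) =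
    bitLen a + bitLen b + tapeSize x from fun _ _ _ => by simp [tapeSize, add_assoc],
    tapeSize_append, tapeSize_flatMap_range, tapeSize_flatMap_range]
  have h1 : (∑ s ∈ Finset.range I.n, ∑ t ∈ Finset.range I.n, I.polySize s t) ≤
      ∑ s ∈ Finset.range I.n,
        tapeSize ((List.range I.n).flatMap fun t => encPoly (I.poly s t)) := by
    refine Finset.sum_le_sum fun s _ => ?_
    rw [tapeSize_flatMap_range]
    exact Finset.sum_le_sum fun t _ => polySize_le_tapeSize I s t
  -- Every state contributes at least one bit through its target flag, so the number of states is
  -- bounded by the input size.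
  have h2 : I.n ≤ ∑ s ∈ Finset.range I.n, tapeSize [I.tgt s] := by
    refine le_trans (by simp) (Finset.card_nsmul_le_sum _ _ 1 fun s _ => ?_)
    simp [tapeSize, bitLen]
  omega

lemma totalSize_eq (I : WeightedInstance) : I.totalSize =
    (∑ s ∈ Finset.range I.n, ∑ t ∈ Finset.range I.n, I.polySize s t) +
      ∑ s ∈ Finset.range I.n, (I.polySize s I.n + I.polySize s (I.n + 1)) := by
  rw [totalSize, ← Finset.sum_add_distrib]
  refine Finset.sum_congr rfl fun s _ => ?_
  rw [Finset.sum_range_succ, Finset.sum_range_succ, add_assoc]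

lemma totalSize_le_tapeSize (I : WeightedInstance) :
    I.totalSize + I.n ≤ tapeSize (encWeightedInstance I) := by
  have h1 := sum_polySize_add_le I
  have h2 : ∑ s ∈ Finset.range I.n, (I.polySize s I.n + I.polySize s (I.n + 1)) ≤
      tapeSize (encVec encFraction I.wgt) := by
    rw [Prog.encWeights_eq, tapeSize_flatMap_range]
    refine Finset.sum_le_sum fun s _ => ?_
    rw [tapeSize_append]
    exact Nat.add_le_add (polySize_le_tapeSize ..) (polySize_le_tapeSize ..)
  rw [totalSize_eq, encWeightedInstance, tapeSize_append]
  omega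

lemma Instance.weighted_poly (I : Instance) (s : ℕ) (hs : s < I.n) :
    I.weighted.poly s I.weighted.n = 1 ∧ I.weighted.poly s (I.weighted.n + 1) = 1 :=
  ⟨I.weighted.poly_num ⟨s, hs⟩, I.weighted.poly_den ⟨s, hs⟩⟩

/-- The constant polynomial one has size `3`, so the artificial weights add `6` per state, and the
number of states is at most the tape size. -/
lemma totalSize_weighted_le (I : Instance) :
    I.weighted.totalSize + I.weighted.n ≤ 7 * tapeSize (encInstance I) := by
  have h1 := sum_polySize_add_le I.weighted
  have hone : ∀ s t, I.weighted.poly s t = 1 → I.weighted.polySize s t = 3 := by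
    intro s t h
    simp [polySize, h]
  have h2 : ∑ s ∈ Finset.range I.weighted.n, (I.weighted.polySize s I.weighted.n +
      I.weighted.polySize s (I.weighted.n + 1)) = 6 * I.weighted.n := by
    rw [Finset.sum_congr rfl (g := fun _ => 6) fun s hs => ?_]
    · simp [mul_comm]
    · have := I.weighted_poly s (Finset.mem_range.1 hs)
      rw [hone _ _ this.1, hone _ _ this.2]
  have h3 : tapeSize (encInstance I) = tapeSize (encInstance I.weighted.toInstance) := rfl
  rw [totalSize_eq]
  omega

lemma bound_le (I : WeightedInstance) {U : ℕ} (h : I.totalSize + I.n ≤ U) :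
    I.bound ≤ 16 * ((U + 1) * (U + 1)) + 1 := by
  unfold bound precision
  gcongr

namespace Prog

/-! ## Writing the output -/

/-- A fixed memory and output. -/
def Out (μ : Mem) (o : List ℤ) (θ : HState) : Prop := θ.mem = μ ∧ θ.out = o

variable {l : ℕ} {μ : Mem} {env : List ℤ}

lemma trip_write (hμ : MemLe l μ) {e : PE} {v : ℤ} (he : Ev l μ env e v) (o : List ℤ) :
    Trip l (Out μ o) env (.write e) (Out μ (o ++ [v])) := by
  rintro θ ⟨rfl, rfl⟩
  refine ⟨⟨hμ, he.ok⟩, rfl, ?_⟩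
  simp only [Stm.run, he.eval]

lemma trip_writeLoop (hμ : MemLe l μ) {N : ℕ} {b : PE} {t : Stm} {f : ℕ → List ℤ} (hN : N ≤ l)
    (hb : Ev l μ env b N)
    (h : ∀ k < N, ∀ o, Trip l (Out μ o) ((k : ℤ) :: env) t (Out μ (o ++ f k))) (o : List ℤ) :
    Trip l (Out μ o) env (.loop b t) (Out μ (o ++ (List.range N).flatMap f)) := by
  have key := Trip.loop (l := l) (env := env) (b := b) (t := t) hN
    (fun k => Out μ (o ++ (List.range k).flatMap f))
    (fun θ hθ => ⟨hθ.1 ▸ hμ, hθ.1 ▸ hb⟩) fun k hk => ?_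
  · simpa using key
  · rw [List.range_succ, List.flatMap_append, ← List.append_assoc]
    simpa using h k hk (o ++ (List.range k).flatMap f)

/-- Write a component of the solution; `r'` is `r` below one more loop. -/
abbrev writePolyS (r r' : PE) : Stm := .seq (.write (.cell 21 r 0)) (.loop (.cell 21 r 0 + 1)
  (.seq (.write (.cell 20 r' (.var 0) - .cell 7 0 0 * .cell 20 r' (.var 0 + 1))) (.write 1)))

variable {I : WeightedInstance} {ab neg : Bool}

lemma natDegree_lt_precision (x : ℕ) : (I.outPoly ab neg x).natDegree < I.precision := by
  rcases eq_or_ne (I.outPoly ab neg x) 0 with h0 | h0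
  · rw [h0, natDegree_zero]
    have := I.le_precision
    omega
  have h1 := (natAbs_coeff_le_nu _ (I.outPoly ab neg x).natDegree).trans_lt
    (I.outPoly_small ab neg x).2
  have h2 : 1 ≤ ((I.outPoly ab neg x).coeff (I.outPoly ab neg x).natDegree).natAbs :=
    Int.natAbs_pos.2 (leadingCoeff_ne_zero.2 h0)
  by_contra! hle
  have h3 : 2 ^ I.precision ≤ 2 ^ (I.outPoly ab neg x).natDegree :=
    Nat.pow_le_pow_right (by norm_num) hle
  exact absurd (h1.trans_le h3) (not_lt.2 (Nat.le_mul_of_pos_left _ h2))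

lemma encPoly_map (p : ℤ[X]) : encPoly (p.map (Int.castRingHom ℚ)) =
    [(p.natDegree : ℤ)] ++ (List.range (p.natDegree + 1)).flatMap fun k => [p.coeff k] ++ [1] := by
  rw [encPoly, natDegree_map_eq_of_injective (RingHom.injective_int _)]
  simp

lemma trip_writePoly (hl : I.bound ≤ l) (hμ : MemLe l μ)
    (hK : Filled ab neg [22, 21, 20, 7, 0] I μ) {r r' : PE} {x : ℕ} (hx : x < 2 * I.n + 1)
    (hr : Ev l μ env r x) (hr' : ∀ k : ℕ, Ev l μ ((k : ℤ) :: env) r' x) (o : List ℤ) :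
    Trip l (Out μ o) env (writePolyS r r')
      (Out μ (o ++ encPoly ((I.outPoly ab neg x).map (Int.castRingHom ℚ)))) := by
  have hb := I.bounds hl
  have hd := natDegree_lt_precision (I := I) (ab := ab) (neg := neg) x
  have hdeg := ev_degOut hK (by decide) hr hx
  rw [encPoly_map, ← List.append_assoc]
  refine Trip.seq (trip_write hμ hdeg o) (trip_writeLoop hμ (by omega)
    (Ev.addNat hdeg (Ev.num 1)) (fun k hk o => ?_) _)
  rw [← List.append_assoc]
  refine Trip.seq (trip_write hμ (Ev.congr (Ev.sub
    (ev_quot hK (by decide) (hr' k) (Ev.var 0) hx (by omega))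
    (Ev.mul (ev_base hK (by decide))
      (ev_quot hK (by decide) (hr' k) (Ev.addNat (Ev.var 0) (Ev.num 1)) hx (by omega)))) ?_) o)
    (trip_write hμ Ev.one _)
  -- The Horner step, read backwards, identifies the number written as the coefficient.
  rw [eval_iterate_divX _ _ k]
  ring

lemma encFraction_solFrac {x : ℕ} (hx : x < 2 * I.n) : encFraction (I.solFrac ab neg x) =
    encPoly ((I.outPoly ab neg x).map (Int.castRingHom ℚ)) ++
      encPoly ((I.outPoly ab neg (2 * I.n)).map (Int.castRingHom ℚ)) := by
  simp only [encFraction, solFrac, outPoly, if_pos hx, lt_irrefl, if_false]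

abbrev writeFracS (r r' : PE) : Stm := .seq (writePolyS r r') (writePolyS (2 * nE) (2 * nE))

lemma trip_writeFrac (hl : I.bound ≤ l) (hμ : MemLe l μ)
    (hK : Filled ab neg [22, 21, 20, 7, 0] I μ) {r r' : PE} {x : ℕ} (hx : x < 2 * I.n)
    (hr : Ev l μ env r x) (hr' : ∀ k : ℕ, Ev l μ ((k : ℤ) :: env) r' x) (o : List ℤ) :
    Trip l (Out μ o) env (writeFracS r r') (Out μ (o ++ encFraction (I.solFrac ab neg x))) := by
  have h2 : ∀ {env}, Ev l μ env (2 * nE) (2 * I.n : ℕ) :=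
    Ev.mulNat (Ev.num 2) (WeightedInstance.ev_n hK (by decide))
  rw [encFraction_solFrac hx, ← List.append_assoc]
  exact Trip.seq (trip_writePoly hl hμ hK (by omega) hr hr' o)
    (trip_writePoly hl hμ hK (by omega) h2 (fun _ => h2) _)

abbrev writeGainS : Stm := .loop nE (writeFracS (.var 0) (.var 1))

lemma trip_writeGain (hl : I.bound ≤ l) (hμ : MemLe l μ)
    (hK : Filled ab neg [22, 21, 20, 7, 0] I μ) : Trip l (Out μ []) [] writeGainS
      (Out μ (encVec encFraction fun s : Fin I.n => I.solFrac ab neg s)) := by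
  have hb := I.bounds hl
  rw [encVec_eq (f := fun s => encFraction (I.solFrac ab neg s)) fun _ => rfl]
  exact trip_writeLoop hμ (by omega) (WeightedInstance.ev_n hK (by decide)) (fun s hs o =>
    trip_writeFrac hl hμ hK (by omega) (Ev.var 0) (fun _ => Ev.var 1) o) []

abbrev writeBiasS : Stm := .loop nE (.pos (.cell 22 (.var 0) 0) (.write 0)
  (.seq (.write 1) (writeFracS (nE + .var 0) (nE + .var 1))))

/-- The expected accumulated weight, if the target is reached almost surely. -/
noncomputable def bias (I : WeightedInstance) (s : Fin I.n) : Option Fraction :=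
  if 0 < I.miss true s then none else some (I.solFrac true true (I.n + s))

lemma trip_writeBias (hl : I.bound ≤ l) (hμ : MemLe l μ)
    (hK : Filled true true [22, 21, 20, 7, 0] I μ) : Trip l (Out μ []) [] writeBiasS
      (Out μ (encVec encOption (bias I))) := by
  have hb := I.bounds hl
  have hn : ∀ {env}, Ev l μ env nE I.n := WeightedInstance.ev_n hK (by decide)
  rw [encVec_eq (f := fun s => if 0 < I.miss true s then [0] else
    [1] ++ encFraction (I.solFrac true true (I.n + s))) fun s => by
      unfold bias; split_ifs <;> rfl]
  refine trip_writeLoop hμ (by omega) hn (fun s hs o => ?_) []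
  have hc : Ev l μ [(s : ℤ)] (.cell 22 (.var 0) 0) (I.miss true s) :=
    ev_miss hK (by decide) (Ev.var 0) hs
  have h1 : Trip l (Out μ o) [(s : ℤ)] (.write 0) (Out μ (o ++ [0])) := trip_write hμ Ev.zero o
  have h2 : Trip l (Out μ o) [(s : ℤ)] (.seq (.write 1) (writeFracS (nE + .var 0) (nE + .var 1)))
      (Out μ (o ++ ([1] ++ encFraction (I.solFrac true true (I.n + s))))) := by
    rw [← List.append_assoc]
    exact Trip.seq (trip_write hμ Ev.one o) (trip_writeFrac hl hμ hK (by omega)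
      (Ev.addNat hn (Ev.var 0)) (fun _ => Ev.addNat hn (Ev.var 1)) _)
  rintro θ ⟨rfl, rfl⟩
  simp only [Stm.Ok, Stm.run, hc.eval]
  split_ifs with h
  · exact ⟨⟨hμ, hc.ok, (h1 θ ⟨rfl, rfl⟩).1⟩, (h1 θ ⟨rfl, rfl⟩).2⟩
  · exact ⟨⟨hμ, hc.ok, (h2 θ ⟨rfl, rfl⟩).1⟩, (h2 θ ⟨rfl, rfl⟩).2⟩

/-! ## The algorithms -/

/-- Reading, computing and writing in polynomial time. -/
theorem polyTimeComputable {α : Type} {β : α → Type} {encIn : α → List ℤ}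
    {encOut : ∀ a, β a → List ℤ} {f : ∀ a, β a} (ab neg : Bool) (I : α → WeightedInstance)
    (c : ℕ) (readS writeS : Stm)
    (hsize : ∀ a, (I a).totalSize + (I a).n ≤ c * tapeSize (encIn a))
    (hread : ∀ a l, (I a).bound ≤ l → Trip l (In l (encIn a) fun _ => True) [] readS
      (In l [] (Loaded (I a) (fun s t => s < (I a).n ∧ t < (I a).n + 2) (I a).n)))
    (hwrite : ∀ a l μ, (I a).bound ≤ l → MemLe l μ → Filled ab neg [22, 21, 20, 7, 0] (I a) μ →
      Trip l (Out μ []) [] writeS (Out μ (encOut a (f a)))) :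
    PolyTimeComputable encIn encOut f := by
  obtain ⟨p, hp⟩ := tri_compute (ab := ab) (neg := neg)
  refine polyTimeComputable_of_stm (.seq readS (.seq (computeS ab neg) writeS))
    ((p + X).comp (16 * ((C c * X + 1) * (C c * X + 1)) + 1)) fun a => ?_
  set l := 16 * ((c * tapeSize (encIn a) + 1) * (c * tapeSize (encIn a) + 1)) + 1 with hl
  have hI : (I a).bound ≤ l := bound_le (I a) (hsize a)
  obtain ⟨h1, h2, h3, h4, h5⟩ := hread a l hI (.init (encIn a)) ⟨trivial, fun _ _ => by
    simp [HState.init], rfl, rfl⟩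
  obtain ⟨h1', h2', h3', h4'⟩ := hp (I a) l _ hI h2.filled h3
  obtain ⟨h1'', h2'', h3''⟩ := hwrite a (p.eval l + l) _ (by omega) (h3'.mono (by omega)) h2' _
    ⟨rfl, h4'.trans h5⟩
  refine ⟨p.eval l + l, ?_, ⟨h1.mono (by omega), h1'.mono (by omega), h1''⟩, h3''⟩
  simp [eval_comp, hl]

theorem reachability : PolyTimeComputable encInstance (fun _ => encVec encFraction)
    fun (I : Instance) (s : Fin I.n) => I.weighted.solFrac true false s :=
  polyTimeComputable true false Instance.weighted 7 (.seq readInstanceS setWeightsS) writeGainS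
    totalSize_weighted_le
    (fun I l hl => by
      have := trip_readInstance (I := I.weighted) hl []
      rw [List.append_nil] at this
      exact Trip.seq this (trip_setWeights hl I.weighted_poly []))
    fun I l μ hl hμ hK => trip_writeGain hl hμ hK

theorem accumulatedWeight :
    PolyTimeComputable encWeightedInstance (fun _ => encVec encOption) bias :=
  polyTimeComputable true true id 1 (.seq readInstanceS readWeightsS) writeBiasS
    (fun I => by rw [one_mul]; exact totalSize_le_tapeSize I)
    (fun I l hl => by
      have := trip_readWeights hl (I := I) []
      rw [List.append_nil] at this
      exact Trip.seq (trip_readInstance hl _) this)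
    fun I l μ hl hμ hK => trip_writeBias hl hμ hK

theorem meanPayoff : PolyTimeComputable encWeightedInstance (fun _ => encVec encFraction)
    fun (I : WeightedInstance) (s : Fin I.n) => I.solFrac false false s :=
  polyTimeComputable false false id 1 (.seq readInstanceS readWeightsS) writeGainS
    (fun I => by rw [one_mul]; exact totalSize_le_tapeSize I)
    (fun I l hl => by
      have := trip_readWeights hl (I := I) []
      rw [List.append_nil] at this
      exact Trip.seq (trip_readInstance hl _) this)
    fun I l μ hl hμ hK => trip_writeGain hl hμ hK

end Prog

end ParamMC

theorem mainTheorem9 :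
    -- reachability probabilities
    (∃ f : (I : ParamMC.Instance) → Fin I.n → ParamMC.Fraction,
      Ram.PolyTimeComputable ParamMC.encInstance
        (fun _ => ParamMC.encVec ParamMC.encFraction) f ∧
      ∀ (I : ParamMC.Instance) (s : Fin I.n) (ξ : ℝ) (hξ : I.M.Admissible ξ),
        (f I s).DefinedAt ξ ∧ (f I s).eval ξ = (I.M.inst ξ hξ).reachProb s I.T) ∧
    -- expected accumulated weight until reaching `T`
    (∃ f : (I : ParamMC.WeightedInstance) → Fin I.n → Option ParamMC.Fraction,
      Ram.PolyTimeComputable ParamMC.encWeightedInstance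
        (fun _ => ParamMC.encVec ParamMC.encOption) f ∧
      ∀ (I : ParamMC.WeightedInstance) (s : Fin I.n) (ξ : ℝ) (hξ : I.M.Admissible ξ),
        I.WeightsDefinedAt ξ →
        ((I.M.inst ξ hξ).reachProb s I.T < 1 → f I s = none) ∧
        ((I.M.inst ξ hξ).reachProb s I.T = 1 →
          ∃ r, f I s = some r ∧ r.DefinedAt ξ ∧
            MeasureTheory.Integrable (ParamMC.accWeight (I.evalWgt ξ) I.T)
              ((I.M.inst ξ hξ).pathMeasure s) ∧
            r.eval ξ = ∫ ω, ParamMC.accWeight (I.evalWgt ξ) I.T ω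
              ∂((I.M.inst ξ hξ).pathMeasure s))) ∧
    -- expected mean payoff
    (∃ f : (I : ParamMC.WeightedInstance) → Fin I.n → ParamMC.Fraction,
      Ram.PolyTimeComputable ParamMC.encWeightedInstance
        (fun _ => ParamMC.encVec ParamMC.encFraction) f ∧
      ∀ (I : ParamMC.WeightedInstance) (s : Fin I.n) (ξ : ℝ) (hξ : I.M.Admissible ξ),
        I.WeightsDefinedAt ξ →
        (f I s).DefinedAt ξ ∧
        MeasureTheory.Integrable (ParamMC.meanPayoff (I.evalWgt ξ) I.T)
          ((I.M.inst ξ hξ).pathMeasure s) ∧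
        (f I s).eval ξ = ∫ ω, ParamMC.meanPayoff (I.evalWgt ξ) I.T ω
          ∂((I.M.inst ξ hξ).pathMeasure s)) := by
  refine ⟨⟨_, ParamMC.Prog.reachability, fun I s ξ hξ => I.reachProb_spec s hξ⟩,
    ⟨_, ParamMC.Prog.accumulatedWeight, fun I s ξ hξ hw => ⟨fun h => ?_, fun h => ?_⟩⟩,
    ⟨_, ParamMC.Prog.meanPayoff, fun I s ξ hξ hw => I.meanPayoff_spec s hξ hw⟩⟩
  -- The graph test is exact at every admissible value, so a probability below one rules out a
  -- negative test.
  · refine if_pos ?_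
    by_contra hmiss
    exact h.ne ((I.miss_eq_zero_iff s hξ).1 hmiss)
  · exact ⟨_, if_neg ((I.miss_eq_zero_iff s hξ).2 h), I.accWeight_spec s hξ hw h⟩
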